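/- Let $K/k$ be a finite Galois extension of global fields with Galois group $G$. Let $S$ be a finite non-empty set of places of $k$ containing all archimedean places, and let $S_K$ be the set of places of $K$ above $S$. Let $\mathfrak m=\mathfrak m_f\mathfrak m_\infty$ be an $S$-modulus of $k$, that is, $\mathfrak m_f$ is a non-zero ideal of the ring $\mathcal O_{k,S}$ of $S$-integers and $\mathfrak m_\infty$ is a set of real places of $k$ (empty if $k$ is a function field). Let $S(\mathfrak m_f)$ be the finite set of places $v\notin S$ of $k$ dividing $\mathfrak m_f$. Let $\mathcal O_v$, $\mathcal O_w$ denote the rings of integers of the completions $k_v$, $K_w$ at finite places $v$ of $k$ and $w$ of $K$. Let $K^{\mathfrak m}$ be the group of all $x\in K^\times$ with $x-1\in\mathfrak m_f\mathcal O_w$ for every place $w$ of $K$ above a place in $S(\mathfrak m_f)$, and with $w(x)>0$ for every real place $w$ of $K$ above a place in $\mathfrak m_\infty$. For $v\in S(\mathfrak m_f)$ and $w\mid v$ put $1+\mathfrak m\mathcal O_v=1+\mathfrak m_f\mathcal O_v$ and $1+\mathfrak m\mathcal O_w=1+\mathfrak m_f\mathcal O_w$; the group $G$ acts naturally on $K^{\mathfrak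 m}$ and on $\prod_{w\mid v}(1+\mathfrak m\mathcal O_w)\subset\prod_{w\mid v}K_w^\times$. Then $$H^1(G,K^{\mathfrak m})\cong\prod_{v\in S(\mathfrak m_f)}H^1\Bigl(G,\prod_{w\mid v}(1+\mathfrak m\mathcal O_w)\Bigr).$$ Furthermore, if $K/k$ is cyclic, then $H^1(G,K^{\mathfrak m})$ is finite, $N\bigl(\prod_{w\mid v}(1+\mathfrak m\mathcal O_w)\bigr)\subseteq 1+\mathfrak m\mathcal O_v$ for all $v\in S(\mathfrak m_f)$, and $$|H^1(G,K^{\mathfrak m})|=\prod_{v\in S(\mathfrak m_f)}\Bigl[1+\mathfrak m\mathcal O_v:N\bigl(\prod_{w\mid v}(1+\mathfrak m\mathcal O_w)\bigr)\Bigr],$$ where $N:\prod_{w\mid v}K_w^\times\to k_v^\times$, $(x_w)_w\mapsto\prod_{w\mid v}N_{K_w/k_v}(x_w)$, is the norm. -/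

import Mathlib

open IsDedekindDomain NumberField
open scoped WithZero

noncomputable section

namespace RayClass

/-- A global field: a finite extension of `ℚ`, or a finite extension of `𝔽_p(t)` for a prime `p`. -/
def IsGlobalField (F : Type*) [Field F] : Prop :=
  NumberField F ∨
    ∃ (p : ℕ) (_ : Fact p.Prime) (_ : Algebra (RatFunc (ZMod p)) F),
      FiniteDimensional (RatFunc (ZMod p)) F

/-! ### Places and completions -/

/-- A finite (that is, non-archimedean) place of `F`, given by its valuation ring, a discrete
valuation ring with field of fractions `F`. -/
@[ext]
structure FinitePlace (F : Type*) [Field F] where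
  ring : ValuationSubring F
  isDVR : IsDiscreteValuationRing ring

attribute [instance] FinitePlace.isDVR

/-- A place of `F`, finite or archimedean. -/
inductive Place (F : Type*) [Field F] where
  | finite (w : FinitePlace F) : Place F
  | infinite (w : InfinitePlace F) : Place F

namespace FinitePlace

variable {F F' F'' : Type*} [Field F] [Field F'] [Field F'']

/-- The normalized valuation `F → ℤᵐ⁰` of a finite place. -/
abbrev val (w : FinitePlace F) : Valuation F ℤᵐ⁰ :=
  (IsDiscreteValuationRing.maximalIdeal w.ring).valuation F

/-- The completion `F_w`. -/
abbrev Completion (w : FinitePlace F) : Type _ :=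
  (IsDiscreteValuationRing.maximalIdeal w.ring).adicCompletion F

/-- The ring of integers `𝒪_w` of the completion `F_w`. -/
abbrev Integers (w : FinitePlace F) : ValuationSubring w.Completion :=
  (IsDiscreteValuationRing.maximalIdeal w.ring).adicCompletionIntegers F

lemma val_le_one_iff (w : FinitePlace F) (x : F) : w.val x ≤ 1 ↔ x ∈ w.ring := by
  constructor
  · intro h
    obtain ⟨a, rfl⟩ := IsDiscreteValuationRing.exists_lift_of_le_one h
    exact a.2
  · intro h
    exact HeightOneSpectrum.valuation_le_one _ (⟨x, h⟩ : w.ring)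

lemma isDVR_comap (f : F →+* F') (hf : f.IsIntegral) (w : FinitePlace F') :
    IsDiscreteValuationRing (w.ring.comap f) := by
  have h1 : w.ring.comap f = (w.val.comap f).valuationSubring := by
    ext x
    rw [ValuationSubring.mem_comap, ← val_le_one_iff]; rfl
  have h2 : ∃ x : F, x ≠ 0 ∧ w.val (f x) ≠ 1 := by
    by_contra! hc
    apply IsDiscreteValuationRing.not_isField w.ring
    have hmem : ∀ x : F, f x ∈ w.ring := fun x ↦ by
      rw [← val_le_one_iff]
      rcases eq_or_ne x 0 with rfl | hx
      · simp
      · exact (hc x hx).le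
    have hall : ∀ y : F', y ∈ w.ring := fun y ↦ by
      obtain ⟨p, hp, hy⟩ := hf y
      have : IsIntegral w.ring y := by
        refine ⟨p.map (f.codRestrict w.ring.toSubring hmem), hp.map _, ?_⟩
        rw [Polynomial.eval₂_map]
        exact hy
      obtain ⟨z, rfl⟩ := IsIntegrallyClosed.isIntegral_iff.mp this
      exact z.2
    refine ⟨⟨0, 1, zero_ne_one⟩, mul_comm, fun {a} ha ↦ ⟨⟨(a : F')⁻¹, hall _⟩, ?_⟩⟩
    ext
    exact mul_inv_cancel₀ (fun h ↦ ha (Subtype.ext h))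
  obtain ⟨x, hx0, hx1⟩ := h2
  have : Nontrivial (MonoidWithZeroHom.valueGroup (.ofClass (w.val.comap f))) := by
    rw [Subgroup.nontrivial_iff_exists_ne_one]
    refine ⟨Units.mk0 (w.val (f x)) (by simpa using hx0), ?_, ?_⟩
    · apply MonoidWithZeroHom.mem_valueGroup
      exact ⟨x, rfl⟩
    · intro h
      exact hx1 (by simpa using congrArg Units.val h)
  rw [h1]
  infer_instance

/-- The restriction of a finite place along an integral (that is, algebraic) embedding of
fields. -/
def comap (f : F →+* F') (hf : f.IsIntegral) (w : FinitePlace F') : FinitePlace F :=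
  ⟨w.ring.comap f, isDVR_comap f hf w⟩

lemma continuous_toCompletion (f : F →+* F') {v : FinitePlace F} {w : FinitePlace F'}
    (h : w.ring.comap f = v.ring) :
    Continuous ((algebraMap F' w.Completion).comp
      (f.comp (WithVal.equiv v.val : WithVal v.val →+* F))) := by
  refine continuous_of_continuousAt_zero _ ?_
  rw [ContinuousAt, map_zero, Filter.tendsto_def]
  intro s hs
  obtain ⟨γ, hγ⟩ := Valued.mem_nhds_zero.mp hs
  obtain ⟨π, hπ⟩ := HeightOneSpectrum.valuation_exists_uniformizer F
    (IsDiscreteValuationRing.maximalIdeal v.ring)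
  have hπ0 : π ≠ 0 := by
    rintro rfl
    rw [map_zero] at hπ
    exact WithZero.coe_ne_zero hπ.symm
  have hfπ0 : w.val (f π) ≠ 0 := by simpa using hπ0
  have hfπ : w.val (f π) < 1 := by
    have h1 : π⁻¹ ∉ v.ring := by
      rw [← val_le_one_iff, not_le, map_inv₀, val, hπ]
      decide
    rw [← h, ValuationSubring.mem_comap, ← val_le_one_iff, not_le, map_inv₀, map_inv₀] at h1
    exact (one_lt_inv₀ (zero_lt_iff.mpr hfπ0)).mp h1
  have hγ0 : MonoidWithZeroHom.ValueGroup₀.embedding γ.1 ≠ 0 := by simp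
  obtain ⟨n, hn⟩ := exists_pow_lt₀ hfπ (Units.mk0 _ hγ0)
  rw [Valued.mem_nhds_zero]
  refine ⟨Units.mk0 (Valued.v.restrict (WithVal.toVal v.val (π ^ n))) ?_, fun x hx ↦ hγ ?_⟩
  · rw [Ne, Valuation.restrict_eq_zero_iff]
    change v.val (π ^ n) ≠ 0
    simpa using fun h ↦ absurd h hπ0
  · rw [Set.mem_ofPred_eq, Units.val_mk0, Valuation.restrict_lt_iff] at hx
    replace hx : v.val x.ofVal < v.val (π ^ n) := hx
    have hmem : x.ofVal / π ^ n ∈ v.ring := by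
      rw [← val_le_one_iff, map_div₀]
      exact div_le_one_of_le₀ hx.le zero_le
    rw [← h, ValuationSubring.mem_comap, ← val_le_one_iff, map_div₀, map_div₀, map_pow, map_pow,
      div_le_one₀ (pow_pos (zero_lt_iff.mpr hfπ0) n)] at hmem
    rw [Set.mem_ofPred_eq, Valuation.restrict_lt_iff_lt_embedding]
    refine lt_of_le_of_lt ?_ hn
    refine le_trans (le_of_eq ?_) hmem
    exact HeightOneSpectrum.valuedAdicCompletion_eq_valuation' _ (f x.ofVal)

/-- If `v` is the restriction of `w` along `f : F → F'`, the continuous extension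
`F_v → F'_w` of `f`. -/
def completionMap (f : F →+* F') {v : FinitePlace F} {w : FinitePlace F'}
    (h : w.ring.comap f = v.ring) : v.Completion →+* w.Completion :=
  (UniformSpace.Completion.extensionHom _ (continuous_toCompletion f h)).comp
    (HeightOneSpectrum.adicCompletion.equiv F
      (IsDiscreteValuationRing.maximalIdeal v.ring)).toRingHom

lemma continuous_completionMap (f : F →+* F') {v : FinitePlace F} {w : FinitePlace F'}
    (h : w.ring.comap f = v.ring) : Continuous (completionMap f h) :=
  UniformSpace.Completion.continuous_extension.comp
    (HeightOneSpectrum.adicCompletion.continuous_toCompletion F _)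

lemma completionMap_algebraMap (f : F →+* F') {v : FinitePlace F} {w : FinitePlace F'}
    (h : w.ring.comap f = v.ring) (x : F) :
    completionMap f h (algebraMap F v.Completion x) = algebraMap F' w.Completion (f x) :=
  UniformSpace.Completion.extensionHom_coe _ (continuous_toCompletion f h) (WithVal.toVal _ x)

lemma completionMap_mem_integers (f : F →+* F') {v : FinitePlace F} {w : FinitePlace F'}
    (h : w.ring.comap f = v.ring) {x : v.Completion} (hx : x ∈ v.Integers) :
    completionMap f h x ∈ w.Integers := by
  have hdense : DenseRange (algebraMap F v.Completion) :=
    HeightOneSpectrum.denseRange_algebraMap _ _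
  have hopen : IsOpen (v.Integers : Set v.Completion) := Valued.isOpen_integer _
  have hclosed : IsClosed (completionMap f h ⁻¹' (w.Integers : Set w.Completion)) :=
    (Valued.isClosed_integer _).preimage (continuous_completionMap f h)
  have hsub : (v.Integers : Set v.Completion) ⊆
      closure (v.Integers ∩ Set.range (algebraMap F v.Completion)) :=
    hdense.open_subset_closure_inter hopen
  refine hclosed.closure_subset_iff.mpr ?_ (hsub hx)
  rintro _ ⟨ha, a, rfl⟩
  have ha' : a ∈ v.ring := by
    rw [← val_le_one_iff, ← HeightOneSpectrum.valuedAdicCompletion_eq_valuation']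
    exact ha
  rw [← h, ValuationSubring.mem_comap, ← val_le_one_iff,
    ← HeightOneSpectrum.valuedAdicCompletion_eq_valuation'] at ha'
  rw [Set.mem_preimage, completionMap_algebraMap]
  exact ha'

lemma completionMap_comp (f : F →+* F') (g : F' →+* F'') {u : FinitePlace F}
    {v : FinitePlace F'} {w : FinitePlace F''} (hf : v.ring.comap f = u.ring)
    (hg : w.ring.comap g = v.ring) (hgf : w.ring.comap (g.comp f) = u.ring) (x : u.Completion) :
    completionMap (g.comp f) hgf x = completionMap g hg (completionMap f hf x) := by
  refine congrFun (DenseRange.equalizer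
    (HeightOneSpectrum.denseRange_algebraMap _ _ : DenseRange (algebraMap F u.Completion))
    (continuous_completionMap _ hgf)
    ((continuous_completionMap _ hg).comp (continuous_completionMap _ hf)) ?_) x
  ext a
  simp [completionMap_algebraMap]

lemma completionMap_id {u : FinitePlace F} (h : u.ring.comap (RingHom.id F) = u.ring)
    (x : u.Completion) : completionMap (RingHom.id F) h x = x := by
  refine congrFun (DenseRange.equalizer
    (HeightOneSpectrum.denseRange_algebraMap _ _ : DenseRange (algebraMap F u.Completion))
    (continuous_completionMap _ h) continuous_id ?_) x
  ext a
  simp [completionMap_algebraMap]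

/-- The restriction to `𝒪_v → 𝒪_w` of `F_v → F'_w`. -/
def integersMap (f : F →+* F') {v : FinitePlace F} {w : FinitePlace F'}
    (h : w.ring.comap f = v.ring) : v.Integers →+* w.Integers :=
  (completionMap f h).restrict v.Integers w.Integers fun _ hx ↦ completionMap_mem_integers f h hx

end FinitePlace

/-! ### Places in an extension -/

section Extension

variable (k : Type*) {K : Type*} [Field k] [Field K] [Algebra k K] [FiniteDimensional k K]

/-- The finite place of `k` below a finite place of `K`. -/
def FinitePlace.under (w : FinitePlace K) : FinitePlace k :=
  w.comap (algebraMap k K) (algebraMap_isIntegral_iff.mpr inferInstance)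

/-- The place of `k` below a place of `K`. -/
def Place.under : Place K → Place k
  | .finite w => .finite (w.under k)
  | .infinite w => .infinite (w.comap (algebraMap k K))

variable {k}

/-- The set of the finite places `w ∣ v` of `K`. -/
def FinitePlace.Over (v : FinitePlace k) (K : Type*) [Field K] [Algebra k K]
    [FiniteDimensional k K] : Type _ :=
  {w : FinitePlace K // w.under k = v}

/-- The place `w ∘ σ` of `K`; its valuation ring is `σ⁻¹(𝒪)` for `𝒪` the valuation ring of `w`. -/
def FinitePlace.twist (σ : K ≃ₐ[k] K) (w : FinitePlace K) : FinitePlace K :=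
  w.comap (σ : K →+* K) (RingHom.isIntegral_of_surjective _ σ.surjective)

lemma FinitePlace.under_twist (σ : K ≃ₐ[k] K) (w : FinitePlace K) :
    (w.twist σ).under k = w.under k := by
  ext x
  change σ (algebraMap k K x) ∈ w.ring ↔ algebraMap k K x ∈ w.ring
  rw [σ.commutes]

/-- `w ↦ w ∘ σ` on the places above `v`. -/
def FinitePlace.Over.twist {v : FinitePlace k} (σ : K ≃ₐ[k] K) (w : v.Over K) : v.Over K :=
  ⟨w.1.twist σ, (w.1.under_twist σ).trans w.2⟩

/-- Only finitely many places of `K` lie above a given finite place of `k`. -/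
instance FinitePlace.finite_over [Algebra.IsSeparable k K] (v : FinitePlace k) :
    Finite (v.Over K) := by
  let B := integralClosure v.ring K
  have hv : ∀ (w : v.Over K) (a : k), algebraMap k K a ∈ w.1.ring ↔ a ∈ v.ring := by
    rintro ⟨w, rfl⟩ a
    exact Iff.rfl
  have hB : ∀ (w : v.Over K) (b : B), (b : K) ∈ w.1.ring := by
    intro w b
    have hle : ∀ a : v.ring, algebraMap k K a ∈ w.1.ring := fun a ↦ (hv w a).mpr a.2
    obtain ⟨p, hp, hy⟩ := b.2
    have : IsIntegral w.1.ring (b : K) := by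
      refine ⟨p.map (((algebraMap k K).comp v.ring.subtype).codRestrict
        w.1.ring.toSubring hle), hp.map _, ?_⟩
      rw [Polynomial.eval₂_map]
      exact hy
    obtain ⟨z, hz⟩ := IsIntegrallyClosed.isIntegral_iff.mp this
    rw [← hz]
    exact z.2
  let φ : (w : v.Over K) → B →+* w.1.ring := fun w ↦
    (algebraMap B K).codRestrict w.1.ring.toSubring (hB w)
  let c : v.Over K → Ideal B := fun w ↦ (IsLocalRing.maximalIdeal w.1.ring).comap (φ w)
  have hded : IsDedekindDomain B := integralClosure.isDedekindDomain v.ring k K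
  have hfrac : IsFractionRing B K := integralClosure.isFractionRing_of_finite_extension k K
  have hinj : Function.Injective (algebraMap v.ring B) := fun a b hab ↦
    Subtype.ext ((algebraMap k K).injective (congrArg Subtype.val hab))
  have : FaithfulSMul v.ring B := (faithfulSMul_iff_algebraMap_injective _ _).mpr hinj
  have : Module.IsTorsionFree v.ring B :=
    (Module.isTorsionFree_iff_algebraMap_injective).mpr hinj
  have hfin : Finite ((IsLocalRing.maximalIdeal v.ring).primesOver B) :=
    IsDedekindDomain.primesOver_finite _ B
  have hprime : ∀ w, (c w).IsPrime := fun w ↦ Ideal.comap_isPrime _ _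
  have hc : ∀ w, c w ∈ (IsLocalRing.maximalIdeal v.ring).primesOver B := by
    refine fun w ↦ ⟨hprime w, ⟨le_antisymm (fun a ha ↦ ?_) ?_⟩⟩
    · rw [Ideal.under, Ideal.mem_comap, Ideal.mem_comap, IsLocalRing.mem_maximalIdeal]
      intro hu
      obtain ⟨u, hu⟩ := hu
      have hu' : ((u : w.1.ring) : K) = algebraMap k K a := congrArg Subtype.val hu
      have hmul : ((u : w.1.ring) : K) * ((u⁻¹ : w.1.ringˣ) : w.1.ring) = 1 :=
        congrArg (Subtype.val : w.1.ring → K) (Units.mul_inv u)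
      have hinv : algebraMap k K (a : k)⁻¹ ∈ w.1.ring := by
        rw [map_inv₀, ← hu', ← eq_inv_of_mul_eq_one_right hmul]
        exact Subtype.prop _
      rw [hv] at hinv
      refine (IsLocalRing.mem_maximalIdeal a).mp ha
        (IsUnit.of_mul_eq_one ⟨(a : k)⁻¹, hinv⟩ (Subtype.ext (mul_inv_cancel₀ ?_)))
      intro h0
      rw [h0, map_zero] at hu'
      rw [hu', zero_mul] at hmul
      exact zero_ne_one hmul
    · exact IsLocalRing.le_maximalIdeal (Ideal.IsPrime.under v.ring (c w)).ne_top
  have hle : ∀ w₁ w₂ : v.Over K, c w₁ = c w₂ → w₁.1.ring ≤ w₂.1.ring := by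
    intro w₁ w₂ h x hx
    have hb : c w₂ ≠ ⊥ := Ideal.ne_bot_of_mem_primesOver
      (IsDiscreteValuationRing.not_a_field v.ring) (hc w₂)
    have hunit : ∀ (w : v.Over K) (d : B), d ∉ c w → (d : K)⁻¹ ∈ w.1.ring := by
      intro w d hd
      rw [Ideal.mem_comap, IsLocalRing.mem_maximalIdeal, mem_nonunits_iff, not_not] at hd
      obtain ⟨u, hu⟩ := hd
      have hmul : ((u : w.1.ring) : K) * ((u⁻¹ : w.1.ringˣ) : w.1.ring) = 1 :=
        congrArg (Subtype.val : w.1.ring → K) (Units.mul_inv u)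
      have hu' : ((u : w.1.ring) : K) = d := congrArg Subtype.val hu
      rw [← hu', ← eq_inv_of_mul_eq_one_right hmul]
      exact Subtype.prop _
    have hne : ∀ d : B, d ∉ c w₂ → (d : K) ≠ 0 := fun d hd h0 ↦ hd (by
      rw [show d = 0 from Subtype.ext h0]
      exact zero_mem _)
    obtain ⟨n, ⟨d, hd⟩, hnd | hnd⟩ := HeightOneSpectrum.exists_primeCompl_mul_eq_or_mul_eq
      (⟨c w₂, hprime w₂, hb⟩ : HeightOneSpectrum B) x
    · replace hnd := (eq_mul_inv_iff_mul_eq₀ (hne d hd)).mpr hnd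
      rw [hnd]
      exact mul_mem (hB w₂ n) (hunit w₂ d hd)
    · by_cases hn : n ∈ c w₂
      · refine absurd ?_ hd
        change d ∈ c w₂
        rw [← h] at hn ⊢
        have hφ : φ w₁ d = ⟨x, hx⟩ * φ w₁ n := Subtype.ext hnd.symm
        rw [Ideal.mem_comap, hφ]
        exact Ideal.mul_mem_left _ _ hn
      · replace hnd := (eq_mul_inv_iff_mul_eq₀ (hne n hn)).mpr hnd
        rw [hnd]
        exact mul_mem (hB w₂ d) (hunit w₂ n hn)
  refine Finite.of_injective (fun w ↦ (⟨c w, hc w⟩ :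
    (IsLocalRing.maximalIdeal v.ring).primesOver B)) fun w₁ w₂ h ↦ ?_
  have h' : c w₁ = c w₂ := congrArg Subtype.val h
  exact Subtype.ext (FinitePlace.ext (le_antisymm (hle _ _ h') (hle _ _ h'.symm)))

/-! ### The product of the completions above a place -/

/-- The group `∏_{w ∣ v} K_wˣ`. -/
def LocalUnits (v : FinitePlace k) (K : Type*) [Field K] [Algebra k K]
    [FiniteDimensional k K] : Type _ :=
  (w : v.Over K) → (w.1.Completion)ˣ

instance (v : FinitePlace k) : CommGroup (LocalUnits v K) :=
  inferInstanceAs (CommGroup ((w : v.Over K) → (w.1.Completion)ˣ))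

/-- The natural action of `Gal(K/k)` on `∏_{w ∣ v} K_wˣ`: the component at `w` of `σ x` is the
image of the component of `x` at `w ∘ σ` under the isomorphism `K_{w ∘ σ} → K_w` extending `σ`. -/
instance (v : FinitePlace k) : MulDistribMulAction (K ≃ₐ[k] K) (LocalUnits v K) where
  smul σ x := fun w ↦
    Units.map (FinitePlace.completionMap (v := (w.twist σ).1) (w := w.1) (σ : K →+* K) rfl)
      (x (w.twist σ))
  one_smul x := by
    funext w
    exact Units.ext (FinitePlace.completionMap_id rfl _)
  mul_smul σ τ x := by
    funext w
    exact Units.ext (FinitePlace.completionMap_comp (u := ((w.twist σ).twist τ).1)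
      (v := (w.twist σ).1) (w := w.1) (τ : K →+* K) (σ : K →+* K) rfl rfl rfl _)
  smul_one σ := by
    funext w
    exact map_one _
  smul_mul σ x y := by
    funext w
    exact map_mul _ _ _

lemma LocalUnits.smul_apply {v : FinitePlace k} (σ : K ≃ₐ[k] K) (x : LocalUnits v K)
    (w : v.Over K) :
    (σ • x) w = Units.map (FinitePlace.completionMap (v := (w.twist σ).1) (w := w.1)
      (σ : K →+* K) rfl) (x (w.twist σ)) := rfl

/-- The local norm `N_{K_w/k_v} : K_wˣ → k_vˣ`. -/
def localNorm {v : FinitePlace k} (w : v.Over K) : (w.1.Completion)ˣ →* (v.Completion)ˣ :=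
  letI : Algebra v.Completion w.1.Completion :=
    (FinitePlace.completionMap (algebraMap k K) (congrArg FinitePlace.ring w.2)).toAlgebra
  Units.map (Algebra.norm v.Completion)

/-- The norm `N : ∏_{w ∣ v} K_wˣ → k_vˣ`, the product of the local norms. -/
def normMap [Algebra.IsSeparable k K] (v : FinitePlace k) :
    LocalUnits v K →* (v.Completion)ˣ where
  toFun x := ∏ᶠ w : v.Over K, localNorm w (x w)
  map_one' := by
    refine finprod_eq_one_of_forall_eq_one fun w ↦ map_one (localNorm w)
  map_mul' x y := by
    rw [← finprod_mul_distrib (Set.toFinite _) (Set.toFinite _)]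
    exact finprod_congr fun w ↦ map_mul (localNorm w) _ _

end Extension

/-! ### Moduli -/

/-- The ring `𝒪_{F,S}` of `S`-integers of `F`. -/
def SIntegers {F : Type*} [Field F] (S : Set (Place F)) : Subring F where
  carrier := {a | ∀ w : FinitePlace F, Place.finite w ∉ S → a ∈ w.ring}
  mul_mem' ha hb w hw := mul_mem (ha w hw) (hb w hw)
  one_mem' w _ := one_mem w.ring
  add_mem' ha hb w hw := add_mem (ha w hw) (hb w hw)
  zero_mem' w _ := zero_mem w.ring
  neg_mem' ha w hw := neg_mem (ha w hw)

/-- An `S`-modulus `𝔪 = 𝔪_f 𝔪_∞` of `F`: a nonzero ideal `𝔪_f` of `𝒪_{F,S}` and a set `𝔪_∞` of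
real places of `F`. -/
structure Modulus (F : Type*) [Field F] (S : Set (Place F)) where
  fin : Ideal (SIntegers S)
  fin_ne_bot : fin ≠ ⊥
  inf : Set (InfinitePlace F)
  isReal : ∀ w ∈ inf, w.IsReal

namespace Modulus

variable {F : Type*} [Field F] {S : Set (Place F)} (m : Modulus F S)

/-- The ideal generated by `𝔪_f` in the valuation ring of `w`, for `w ∉ S`. -/
def localIdeal (w : FinitePlace F) : Ideal w.ring :=
  Ideal.span {y | ∃ a ∈ m.fin, (a : F) = y}

/-- The ideal `𝔪 𝒪_w` of the ring of integers of the completion `F_w`, for `w ∉ S`. -/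
def completedIdeal (w : FinitePlace F) : Ideal w.Integers :=
  (m.localIdeal w).map (algebraMap w.ring w.Integers)

/-- The support `S(𝔪_f)` of `𝔪_f`: the finite places `w ∣ 𝔪_f`. -/
def finSupport : Set (FinitePlace F) :=
  {w | Place.finite w ∉ S ∧ m.localIdeal w ≠ ⊤}

/-- The group `F^𝔪` of the `x ∈ Fˣ` with `x ≡ 1 mod 𝔪_f` and `w(x) > 0` for all real
`w ∣ 𝔪_∞`. -/
def rayGroup : Subgroup Fˣ where
  carrier := {x | (∀ w ∈ m.finSupport, ∃ y ∈ m.localIdeal w, (y : F) = (x : F) - 1) ∧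
    ∀ (w : InfinitePlace F) (hw : w ∈ m.inf),
      0 < InfinitePlace.embedding_of_isReal (m.isReal w hw) (x : F)}
  one_mem' := ⟨fun w _ ↦ ⟨0, zero_mem _, by simp⟩, fun w hw ↦ by simp⟩
  mul_mem' := by
    rintro a b ⟨ha, ha'⟩ ⟨hb, hb'⟩
    refine ⟨fun w hw ↦ ?_, fun w hw ↦ ?_⟩
    · obtain ⟨y, hy, hya⟩ := ha w hw
      obtain ⟨z, hz, hzb⟩ := hb w hw
      refine ⟨y * z + y + z, add_mem (add_mem (Ideal.mul_mem_right _ _ hy) hy) hz, ?_⟩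
      push_cast
      rw [hya, hzb]
      ring
    · rw [Units.val_mul, map_mul]
      exact mul_pos (ha' w hw) (hb' w hw)
  inv_mem' := by
    rintro a ⟨ha, ha'⟩
    refine ⟨fun w hw ↦ ?_, fun w hw ↦ ?_⟩
    · obtain ⟨y, hy, hya⟩ := ha w hw
      have hu : IsUnit (y + 1) := by
        have := (IsLocalRing.le_maximalIdeal hw.2) hy
        by_contra h
        have h1 := (IsLocalRing.mem_maximalIdeal _).mpr h
        exact (IsLocalRing.mem_maximalIdeal (1 : w.ring)).mp ((add_sub_cancel_left y 1) ▸ sub_mem h1 this) isUnit_one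
      obtain ⟨u, hu⟩ := hu
      have hua : ((u : w.ring) : F) = a := by
        rw [hu]
        push_cast
        rw [hya]
        ring
      have hui : ((u⁻¹ : w.ringˣ) : w.ring) = ((a⁻¹ : Fˣ) : F) := by
        rw [Units.val_inv_eq_inv_val, ← hua]
        refine eq_inv_of_mul_eq_one_left ?_
        exact congrArg (Subtype.val : w.ring → F) (Units.inv_mul u)
      refine ⟨-(y * ((u⁻¹ : w.ringˣ) : w.ring)), neg_mem (Ideal.mul_mem_right _ _ hy), ?_⟩
      push_cast
      rw [hui, hya, Units.val_inv_eq_inv_val]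
      field_simp
      ring
    · rw [Units.val_inv_eq_inv_val, map_inv₀]
      exact inv_pos.mpr (ha' w hw)

/-- The group `1 + 𝔪 𝒪_w`, as a subgroup of `F_wˣ`: the units of `𝒪_w` that are congruent to `1`
modulo `𝔪 𝒪_w`. For `w ∣ 𝔪_f` every element of `1 + 𝔪 𝒪_w` is a unit of `𝒪_w`
(see `mem_rayUnits_iff`). -/
def rayUnits (w : FinitePlace F) : Subgroup (w.Completion)ˣ :=
  (Units.map (Ideal.Quotient.mk (m.completedIdeal w)).toMonoidHom).ker.map
    (Units.map w.Integers.subtype.toMonoidHom)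

lemma mem_rayUnits {w : FinitePlace F} {u : (w.Completion)ˣ} :
    u ∈ m.rayUnits w ↔ ∃ y : (w.Integers)ˣ, (y : w.Integers) - 1 ∈ m.completedIdeal w ∧
      ((y : w.Integers) : w.Completion) = u := by
  refine ⟨?_, ?_⟩
  · rintro ⟨y, hy, rfl⟩
    exact ⟨y, Ideal.Quotient.eq.mp (congrArg Units.val hy), rfl⟩
  · rintro ⟨y, hy, h⟩
    exact ⟨y, Units.ext (Ideal.Quotient.eq.mpr hy), Units.ext h⟩

lemma completedIdeal_ne_top {w : FinitePlace F} (hw : w ∈ m.finSupport) :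
    m.completedIdeal w ≠ ⊤ := by
  have hle : m.completedIdeal w ≤ IsLocalRing.maximalIdeal w.Integers := by
    rw [completedIdeal, Ideal.map_le_iff_le_comap]
    intro x hx
    have hx' := (IsLocalRing.le_maximalIdeal hw.2) hx
    rw [Ideal.mem_comap, IsLocalRing.mem_maximalIdeal, mem_nonunits_iff,
      HeightOneSpectrum.adicCompletionIntegers.isUnit_iff_valued_eq_one]
    refine ne_of_lt ?_
    rw [HeightOneSpectrum.algebraMap_adicCompletionIntegers_apply,
      HeightOneSpectrum.valuedAdicCompletion_eq_valuation']
    exact (HeightOneSpectrum.valuation_lt_one_iff_mem _ _).mpr hx'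
  exact fun h ↦ Ideal.IsPrime.ne_top' (top_le_iff.mp (h ▸ hle))

/-- For `w ∣ 𝔪_f` the group `rayUnits` is the set `1 + 𝔪 𝒪_w`. -/
lemma mem_rayUnits_iff {w : FinitePlace F} (hw : w ∈ m.finSupport) {u : (w.Completion)ˣ} :
    u ∈ m.rayUnits w ↔ ∃ y ∈ m.completedIdeal w, (u : w.Completion) = 1 + y := by
  rw [mem_rayUnits]
  refine ⟨?_, ?_⟩
  · rintro ⟨y, hy, h⟩
    refine ⟨_, hy, ?_⟩
    rw [← h]
    push_cast
    ring
  · rintro ⟨y, hy, h⟩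
    have hu : IsUnit (1 + y) := by
      have h0 := (IsLocalRing.le_maximalIdeal (m.completedIdeal_ne_top hw)) hy
      by_contra h'
      have h1 := (IsLocalRing.mem_maximalIdeal _).mpr h'
      exact (IsLocalRing.mem_maximalIdeal (1 : w.Integers)).mp
        ((add_sub_cancel_right 1 y) ▸ sub_mem h1 h0) isUnit_one
    refine ⟨hu.unit, by simpa using hy, ?_⟩
    rw [h, IsUnit.unit_spec]
    push_cast
    rfl

end Modulus

/-! ### The modulus of an extension field and the Galois action -/

section Galois

variable {k : Type*} (K : Type*) [Field k] [Field K] [Algebra k K] [FiniteDimensional k K]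
  {S : Set (Place k)}

/-- The inclusion `𝒪_{k,S} → 𝒪_{K,S_K}`, where `S_K` is the set of the places of `K` above `S`. -/
def SIntegers.map (S : Set (Place k)) :
    SIntegers S →+* SIntegers (Place.under k ⁻¹' S : Set (Place K)) :=
  (algebraMap k K).restrict _ _ fun _ ha w hw ↦ ha (w.under k) hw

/-- The modulus `𝔪_K` of `K` induced by a modulus `𝔪` of `k`: its finite part is `𝔪_f 𝒪_{K,S}`,
its infinite part consists of the real places of `K` above `𝔪_∞`. -/
def Modulus.induced (m : Modulus k S) : Modulus K (Place.under k ⁻¹' S) where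
  fin := m.fin.map (SIntegers.map K S)
  fin_ne_bot h := by
    refine m.fin_ne_bot ((Ideal.map_eq_bot_iff_of_injective ?_).mp h)
    intro a b hab
    exact Subtype.ext ((algebraMap k K).injective (congrArg Subtype.val hab))
  inf := {w | w.IsReal ∧ w.comap (algebraMap k K) ∈ m.inf}
  isReal _ hw := hw.1

variable {K} (m : Modulus k S)

lemma Modulus.apply_mem_induced (σ : K ≃ₐ[k] K)
    {a : SIntegers (Place.under k ⁻¹' S : Set (Place K))} (ha : a ∈ (m.induced K).fin) :
    ∃ b ∈ (m.induced K).fin, (b : K) = σ a := by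
  let φ : SIntegers (Place.under k ⁻¹' S : Set (Place K)) →+*
      SIntegers (Place.under k ⁻¹' S : Set (Place K)) :=
    (σ : K →+* K).restrict _ _ fun a ha w hw ↦ ha (w.twist σ) (by
      rw [Set.mem_preimage, Place.under, FinitePlace.under_twist]
      exact hw)
  have hφ : φ.comp (SIntegers.map K S) = SIntegers.map K S := by
    ext x
    exact σ.commutes _
  refine ⟨φ a, ?_, rfl⟩
  have := Ideal.mem_map_of_mem φ ha
  rwa [Modulus.induced, Ideal.map_map, hφ] at this

/-- `σ` as a map between the valuation rings of `w ∘ σ` and `w`. -/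
def ringTwist (σ : K ≃ₐ[k] K) (w : FinitePlace K) : (w.twist σ).ring →+* w.ring :=
  (σ : K →+* K).restrict (w.twist σ).ring w.ring fun _ hx ↦ hx

lemma Modulus.map_localIdeal_le (σ : K ≃ₐ[k] K) (w : FinitePlace K) :
    ((m.induced K).localIdeal (w.twist σ)).map (ringTwist σ w) ≤ (m.induced K).localIdeal w := by
  rw [Modulus.localIdeal, Ideal.map_span, Ideal.span_le]
  rintro _ ⟨y, ⟨a, ha, hay⟩, rfl⟩
  obtain ⟨b, hb, hba⟩ := m.apply_mem_induced σ ha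
  refine Ideal.subset_span ⟨b, hb, ?_⟩
  rw [hba, hay]
  rfl

lemma Modulus.twist_mem_finSupport (σ : K ≃ₐ[k] K) {w : FinitePlace K}
    (hw : w ∈ (m.induced K).finSupport) : w.twist σ ∈ (m.induced K).finSupport := by
  refine ⟨?_, fun h ↦ hw.2 ?_⟩
  · rw [Set.mem_preimage, Place.under, FinitePlace.under_twist]
    exact hw.1
  · have := m.map_localIdeal_le σ w
    rwa [h, Ideal.map_top, top_le_iff] at this

lemma Modulus.smul_mem_rayGroup (σ : K ≃ₐ[k] K) {x : Kˣ} (hx : x ∈ (m.induced K).rayGroup) :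
    σ • x ∈ (m.induced K).rayGroup := by
  refine ⟨fun w hw ↦ ?_, fun w hw ↦ ?_⟩
  · obtain ⟨y, hy, hyx⟩ := hx.1 _ (m.twist_mem_finSupport σ hw)
    refine ⟨ringTwist σ w y, m.map_localIdeal_le σ w (Ideal.mem_map_of_mem _ hy), ?_⟩
    change σ y = σ x - 1
    rw [hyx, map_sub, map_one]
  · have hw' : w.comap (σ : K →+* K) ∈ (m.induced K).inf := by
      refine ⟨hw.1.comap _, ?_⟩
      rw [← InfinitePlace.comap_comp]
      convert! hw.2 using 2
      ext x
      exact σ.commutes x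
    have h := hx.2 _ hw'
    convert! h using 1
    apply Complex.ofReal_injective
    rw [InfinitePlace.embedding_of_isReal_apply, InfinitePlace.embedding_of_isReal_apply,
      InfinitePlace.comap_embedding_of_isReal _ (hw.1.comap _)]
    rfl

/-- The group `∏_{w ∣ v} (1 + 𝔪 𝒪_w)`, as a subgroup of `∏_{w ∣ v} K_wˣ`. -/
def Modulus.rayProduct (K : Type*) [Field K] [Algebra k K] [FiniteDimensional k K]
    (m : Modulus k S) (v : FinitePlace k) : Subgroup (LocalUnits v K) where
  carrier := {x | ∀ w : v.Over K, x w ∈ (m.induced K).rayUnits w.1}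
  mul_mem' ha hb w := mul_mem (ha w) (hb w)
  one_mem' w := one_mem ((m.induced K).rayUnits w.1)
  inv_mem' ha w := inv_mem (ha w)

lemma Modulus.smul_mem_rayProduct {v : FinitePlace k} (σ : K ≃ₐ[k] K) {x : LocalUnits v K}
    (hx : x ∈ m.rayProduct K v) : σ • x ∈ m.rayProduct K v := by
  intro w
  obtain ⟨y, hy, hyx⟩ := ((m.induced K).mem_rayUnits).mp (hx (w.twist σ))
  let ψ : (w.1.twist σ).Integers →+* w.1.Integers :=
    FinitePlace.integersMap (σ : K →+* K) rfl
  have hle : ((m.induced K).completedIdeal (w.1.twist σ)).map ψ ≤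
      (m.induced K).completedIdeal w.1 := by
    have hcomm : ψ.comp (algebraMap (w.1.twist σ).ring (w.1.twist σ).Integers) =
        (algebraMap w.1.ring w.1.Integers).comp (ringTwist σ w.1) := by
      refine RingHom.ext fun a ↦ Subtype.ext ?_
      exact FinitePlace.completionMap_algebraMap (v := w.1.twist σ) (w := w.1)
        (σ : K →+* K) rfl (a : K)
    rw [Modulus.completedIdeal, Ideal.map_map, hcomm, ← Ideal.map_map]
    exact Ideal.map_mono (m.map_localIdeal_le σ w.1)
  refine ((m.induced K).mem_rayUnits).mpr ⟨Units.map ψ.toMonoidHom y, ?_, ?_⟩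
  · have := hle (Ideal.mem_map_of_mem ψ hy)
    have heq : ψ ((y : (w.twist σ).1.Integers) - 1 : (w.twist σ).1.Integers) =
        (Units.map ψ.toMonoidHom y : w.1.Integers) - 1 :=
      (map_sub ψ _ _).trans (congrArg _ (map_one ψ))
    exact heq ▸ this
  · rw [LocalUnits.smul_apply]
    exact congrArg (FinitePlace.completionMap (v := w.1.twist σ) (w := w.1) (σ : K →+* K) rfl) hyx

/-- The Galois action on `K^𝔪`. -/
instance : MulDistribMulAction (K ≃ₐ[k] K) (m.induced K).rayGroup where
  smul σ x := ⟨σ • (x : Kˣ), m.smul_mem_rayGroup σ x.2⟩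
  one_smul x := Subtype.ext (one_smul _ (x : Kˣ))
  mul_smul σ τ x := Subtype.ext (mul_smul σ τ (x : Kˣ))
  smul_one σ := Subtype.ext (MulDistribMulAction.smul_one (N := Kˣ) σ)
  smul_mul σ x y := Subtype.ext (smul_mul' σ (x : Kˣ) (y : Kˣ))

/-- The Galois action on `∏_{w ∣ v} (1 + 𝔪 𝒪_w)`. -/
instance (v : FinitePlace k) : MulDistribMulAction (K ≃ₐ[k] K) (m.rayProduct K v) where
  smul σ x := ⟨σ • (x : LocalUnits v K), m.smul_mem_rayProduct σ x.2⟩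
  one_smul x := Subtype.ext (one_smul _ (x : LocalUnits v K))
  mul_smul σ τ x := Subtype.ext (mul_smul σ τ (x : LocalUnits v K))
  smul_one σ := Subtype.ext (MulDistribMulAction.smul_one (N := LocalUnits v K) σ)
  smul_mul σ x y := Subtype.ext (smul_mul' σ (x : LocalUnits v K) (y : LocalUnits v K))

end Galois

end RayClass

end

/-!
Restriction `H¹(G, K^𝔪) → ∏_v H¹(G, ∏_{w ∣ v} (1 + 𝔪 𝒪_w))` is injective because, by Hilbert 90, a
cocycle in its kernel is the coboundary of some `x ∈ Kˣ` and of local elements `y_v`; then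
`x / y_v` comes from `k_vˣ`, and weak approximation in `k` moves `x` into `K^𝔪`. It is surjective
because local cocycles are coboundaries of elements of `∏_{w ∣ v} K_wˣ`, which can be approximated
by a single element of `Kˣ`; its signs at `𝔪_∞` are prescribed at the same time.

For cyclic `G`, the group `∏_{w ∣ v} (1 + 𝔪 𝒪_w)` has trivial Herbrand quotient: near `1` it is
filtered by subgroups whose graded pieces are those of a lattice spanned by a normal basis, which
has no cohomology. So its `H¹` has the order of its `Ĥ⁰`, which is the index of the norms, since
the invariants of `∏_{w ∣ v} K_wˣ` are `k_vˣ` and the product of the conjugates of `x` is the norm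
of `x`.
-/

open IsDedekindDomain NumberField
open scoped WithZero

noncomputable section

namespace RayClass

/-! ### First cohomology of multiplicative modules -/

section Cohomology

open groupCohomology

variable {G M M' : Type} [Group G] [CommGroup M] [CommGroup M'] [MulDistribMulAction G M]
  [MulDistribMulAction G M']

/-- The class in `H¹(G, M)` of a multiplicative `1`-cocycle. -/
def cocycleClass {f : G → M} (hf : IsMulCocycle₁ f) : H1 (Rep.ofMulDistribMulAction G M) :=
  H1π _ (cocyclesOfIsMulCocycle₁ hf)

lemma exists_cocycleClass_eq (x : H1 (Rep.ofMulDistribMulAction G M)) :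
    ∃ (f : G → M) (hf : IsMulCocycle₁ f), cocycleClass hf = x := by
  obtain ⟨f, rfl⟩ := (ModuleCat.epi_iff_surjective
    (H1π (Rep.ofMulDistribMulAction G M))).mp inferInstance x
  exact ⟨_, isMulCocycle₁_of_mem_cocycles₁ _ f.2, rfl⟩

lemma cocycleClass_eq_zero_iff {f : G → M} (hf : IsMulCocycle₁ f) :
    cocycleClass hf = 0 ↔ IsMulCoboundary₁ f := by
  rw [cocycleClass, H1π_eq_zero_iff]
  exact ⟨isMulCoboundary₁_of_mem_coboundaries₁ _, fun h ↦ (coboundariesOfIsMulCoboundary₁ h).2⟩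

lemma cocycleClass_eq_of_isMulCoboundary₁_div {f f' : G → M} (hf : IsMulCocycle₁ f)
    (hf' : IsMulCocycle₁ f') (h : IsMulCoboundary₁ (f / f')) :
    cocycleClass hf = cocycleClass hf' :=
  (H1π_eq_iff _ _).mpr (coboundariesOfIsMulCoboundary₁ h).2

lemma isMulCocycle₁_comp {f : G → M} (hf : IsMulCocycle₁ f) (φ : M →*[G] M') :
    IsMulCocycle₁ (φ ∘ f) := fun g h ↦ by
  simp only [Function.comp_apply, hf g h, map_mul, map_smul]

/-- The homomorphism `H¹(G, M) → H¹(G, M')` induced by an equivariant homomorphism `M → M'`. -/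
def mapH1 (φ : M →*[G] M') :
    H1 (Rep.ofMulDistribMulAction G M) →+ H1 (Rep.ofMulDistribMulAction G M') :=
  (map (MonoidHom.id G) (Rep.ofHom ((MonoidHom.toAdditive (φ : M →* M')).toIntLinearMap
    |>.intertwiningMap_of_isIntertwiningMap (Representation.ofMulDistribMulAction G M)
      (Representation.ofMulDistribMulAction G M')
      fun g x ↦ congrArg Additive.ofMul (map_smul φ g x.toMul))) 1).hom.toAddMonoidHom

lemma mapH1_cocycleClass (φ : M →*[G] M') {f : G → M} (hf : IsMulCocycle₁ f) :
    mapH1 φ (cocycleClass hf) = cocycleClass (isMulCocycle₁_comp hf φ) := by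
  refine (H1π_comp_map_apply (MonoidHom.id G) _ _).trans (congrArg _ ?_)
  exact cocycles₁_ext fun g ↦ congrFun (coe_mapCocycles₁ (MonoidHom.id G) _ _) g

theorem nonempty_H1_equiv_pi {ι : Type} {M' : ι → Type} [∀ i, CommGroup (M' i)]
    [∀ i, MulDistribMulAction G (M' i)] (φ : ∀ i, M →*[G] M' i)
    (hinj : ∀ f : G → M, IsMulCocycle₁ f → (∀ i, IsMulCoboundary₁ (φ i ∘ f)) →
      IsMulCoboundary₁ f)
    (hsurj : ∀ f : ∀ i, G → M' i, (∀ i, IsMulCocycle₁ (f i)) →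
      ∃ f' : G → M, IsMulCocycle₁ f' ∧ ∀ i, IsMulCoboundary₁ (φ i ∘ f' / f i)) :
    Nonempty (H1 (Rep.ofMulDistribMulAction G M) ≃+
      ((i : ι) → H1 (Rep.ofMulDistribMulAction G (M' i)))) := by
  refine ⟨AddEquiv.ofBijective (AddMonoidHom.pi fun i ↦ mapH1 (φ i)) ⟨?_, fun y ↦ ?_⟩⟩
  · refine (injective_iff_map_eq_zero _).mpr fun x hx ↦ ?_
    obtain ⟨f, hf, rfl⟩ := exists_cocycleClass_eq x
    refine (cocycleClass_eq_zero_iff hf).mpr (hinj f hf fun i ↦ ?_)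
    rw [← cocycleClass_eq_zero_iff (isMulCocycle₁_comp hf (φ i)), ← mapH1_cocycleClass]
    exact congrFun hx i
  · choose f hf hy using fun i ↦ exists_cocycleClass_eq (y i)
    obtain ⟨f', hf', h⟩ := hsurj f hf
    refine ⟨cocycleClass hf', funext fun i ↦ ?_⟩
    rw [← hy i]
    exact (mapH1_cocycleClass (φ i) hf').trans
      (cocycleClass_eq_of_isMulCoboundary₁_div _ (hf i) (h i))

end Cohomology

section Cyclic

open scoped CategoryTheory

open groupCohomology Rep.FiniteCyclicGroup

section

variable (G M : Type*) [Group G] [CommGroup M] [MulDistribMulAction G M]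

/-- The norm endomorphism `x ↦ ∏ σ, σ x` of a multiplicative `G`-module. -/
def gNorm [Fintype G] : M →* M where
  toFun x := ∏ σ : G, σ • x
  map_one' := by simp
  map_mul' x y := by simp [smul_mul', Finset.prod_mul_distrib]

lemma gNorm_apply [Fintype G] (x : M) : gNorm G M x = ∏ σ : G, σ • x := rfl

variable {G}

/-- The endomorphism `x ↦ g x / x` of a multiplicative `G`-module. -/
def gDiff (g : G) : M →* M where
  toFun x := g • x / x
  map_one' := by simp
  map_mul' x y := by rw [smul_mul', mul_div_mul_comm]

lemma gDiff_apply (g : G) (x : M) : gDiff M g x = g • x / x := rfl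

variable {M}

lemma smul_gNorm [Fintype G] (g : G) (x : M) : g • gNorm G M x = gNorm G M x := by
  rw [gNorm_apply, Finset.smul_prod']
  exact Fintype.prod_equiv (Equiv.mulLeft g) _ _ fun σ ↦ by simp [mul_smul]

lemma gNorm_smul [Fintype G] (g : G) (x : M) : gNorm G M (g • x) = gNorm G M x := by
  rw [gNorm_apply]
  exact Fintype.prod_equiv (Equiv.mulRight g) _ _ fun σ ↦ by simp [mul_smul]

lemma map_gNorm [Fintype G] {A : Type*} [CommMonoid A] [MulDistribMulAction G A] (ι : M →*[G] A)
    (x : M) : ι (gNorm G M x) = ∏ σ : G, σ • ι x := by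
  simp_rw [gNorm_apply, map_prod, map_smul]

end

lemma surjective_groupCohomologyπOdd {R G : Type} [CommRing R] [CommGroup G] [Fintype G]
    (A : Rep R G) (g : G) (hg : ∀ x, x ∈ Subgroup.zpowers g) (i : ℕ) (hi : Odd i) :
    Function.Surjective (groupCohomologyπOdd A g hg i hi) := by
  refine (ModuleCat.epi_iff_surjective _).mp ?_
  have : CategoryTheory.Epi (CategoryTheory.ShortComplex.homologyπ (subCompNormHom A g) ≫
      (groupCohomologyIsoOdd A g hg i hi).inv) := CategoryTheory.epi_comp _ _
  have : CategoryTheory.Epi (subCompNormHom A g).moduleCatCyclesIso.inv :=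
    CategoryTheory.IsSplitEpi.epi (hf := CategoryTheory.IsSplitEpi.of_iso _)
  exact CategoryTheory.epi_comp' ‹_› ‹_›

lemma card_H1_of_forall_mem_zpowers {G M : Type} [CommGroup G] [Fintype G] [CommGroup M]
    [MulDistribMulAction G M] (g : G) (hg : ∀ x, x ∈ Subgroup.zpowers g) :
    Nat.card (H1 (Rep.ofMulDistribMulAction G M)) =
      (gDiff M g).range.relIndex (gNorm G M).ker := by
  let A := Rep.ofMulDistribMulAction G M
  have hnorm (x : M) : A.norm.hom (Rep.toAdditive.symm (Additive.ofMul x)) =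
      Rep.toAdditive.symm (Additive.ofMul (gNorm G M x)) :=
    Representation.norm_ofMulDistribMulAction_eq (G := G) (Additive.ofMul x)
  have hker (x : (gNorm G M).ker) : Rep.toAdditive.symm (Additive.ofMul (x : M)) ∈
      LinearMap.ker A.norm.hom.toLinearMap := by
    rw [LinearMap.mem_ker]
    exact (hnorm x).trans (congrArg _ x.2)
  let F : (gNorm G M).ker →* Multiplicative (H1 A) :=
    MonoidHom.mk' (fun x ↦ Multiplicative.ofAdd (groupCohomologyπOdd A g hg 1 odd_one
      ⟨Rep.toAdditive.symm (Additive.ofMul (x : M)), hker x⟩)) fun x y ↦ by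
        rw [← ofAdd_add, ← map_add]; rfl
  have hF : Function.Surjective F := fun y ↦ by
    obtain ⟨x, hx⟩ := surjective_groupCohomologyπOdd A g hg 1 odd_one y.toAdd
    refine ⟨⟨(Rep.toAdditive x.1).toMul, ?_⟩, congrArg Multiplicative.ofAdd hx⟩
    exact (hnorm _).symm.trans x.2
  have hFker : F.ker = (gDiff M g).range.subgroupOf (gNorm G M).ker := by
    ext x
    exact groupCohomologyπOdd_eq_zero_iff A g hg 1 odd_one
      ⟨Rep.toAdditive.symm (Additive.ofMul (x : M)), hker x⟩
  rw [Subgroup.relIndex, Subgroup.index, ← hFker]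
  exact (Nat.card_congr (QuotientGroup.quotientKerEquivOfSurjective F hF).toEquiv).symm

attribute [local instance] IsCyclic.commGroup in
theorem card_H1_of_cyclic {G M : Type} [Group G] [Fintype G] [CommGroup M]
    [MulDistribMulAction G M] (g : G) (hg : ∀ x, x ∈ Subgroup.zpowers g) :
    Nat.card (H1 (Rep.ofMulDistribMulAction G M)) =
      (gDiff M g).range.relIndex (gNorm G M).ker := by
  have : IsCyclic G := ⟨g, hg⟩
  exact card_H1_of_forall_mem_zpowers (G := G) g hg

end Cyclic

/-! ### The Herbrand quotient -/

section Herbrand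

variable {U : Type*} [CommGroup U]

lemma relIndex_map_mk {V A B : Subgroup U} (hAB : A ≤ B) (h : B ⊓ V ≤ A) :
    (A.map (QuotientGroup.mk' V)).relIndex (B.map (QuotientGroup.mk' V)) = A.relIndex B := by
  rw [← Subgroup.relIndex_comap, Subgroup.comap_map_eq, QuotientGroup.ker_mk',
    ← Subgroup.inf_relIndex_right]
  congr 1
  refine le_antisymm ?_ (le_inf le_sup_left hAB)
  rintro x ⟨hx, hxB⟩
  obtain ⟨a, ha, v, hv, rfl⟩ := Subgroup.mem_sup.mp hx
  exact mul_mem ha (h ⟨(mul_mem_cancel_left (hAB ha)).mp hxB, hv⟩)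

lemma relIndex_range_ker_comm_of_finite [Finite U] {N D : U →* U} (hND : ∀ x, N (D x) = 1)
    (hDN : ∀ x, D (N x) = 1) :
    D.range.relIndex N.ker = N.range.relIndex D.ker := by
  have hN : D.range ≤ N.ker := by rintro _ ⟨x, rfl⟩; exact hND x
  have hD : N.range ≤ D.ker := by rintro _ ⟨x, rfl⟩; exact hDN x
  have kerN := Subgroup.relIndex_mul_relIndex ⊥ D.range N.ker bot_le hN
  have kerD := Subgroup.relIndex_mul_relIndex ⊥ N.range D.ker bot_le hD
  simp only [Subgroup.relIndex_bot_left] at kerN kerD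
  have cardN := Subgroup.card_mul_index N.ker
  have cardD := Subgroup.card_mul_index D.ker
  rw [Subgroup.index_ker] at cardN cardD
  have : 0 < Nat.card N.range * Nat.card D.range := mul_pos Nat.card_pos Nat.card_pos
  refine Nat.eq_of_mul_eq_mul_left this ?_
  calc Nat.card N.range * Nat.card D.range * D.range.relIndex N.ker
      = (Nat.card D.range * D.range.relIndex N.ker) * Nat.card N.range := by ring
    _ = (Nat.card N.range * N.range.relIndex D.ker) * Nat.card D.range := by
      rw [kerN, kerD, cardN, cardD]
    _ = Nat.card N.range * Nat.card D.range * N.range.relIndex D.ker := by ring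

variable {V : Subgroup U}

lemma range_quotientMap {D : U →* U} (hDV : V ≤ V.comap D) :
    (QuotientGroup.map V V D hDV).range = D.range.map (QuotientGroup.mk' V) := by
  ext q
  constructor
  · rintro ⟨y, rfl⟩
    obtain ⟨x, rfl⟩ := QuotientGroup.mk_surjective y
    exact ⟨D x, ⟨x, rfl⟩, rfl⟩
  · rintro ⟨_, ⟨x, rfl⟩, rfl⟩
    exact ⟨x, rfl⟩

lemma ker_quotientMap {N : U →* U} (hNV : V ≤ V.comap N)
    (h : ∀ x, N x ∈ V → ∃ y ∈ V, N y = N x) :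
    (QuotientGroup.map V V N hNV).ker = N.ker.map (QuotientGroup.mk' V) := by
  ext q
  obtain ⟨x, rfl⟩ := QuotientGroup.mk_surjective q
  constructor
  · intro hx
    obtain ⟨v, hv, hvx⟩ := h x ((QuotientGroup.eq_one_iff _).mp hx)
    refine ⟨x / v, ?_, ?_⟩
    · rw [SetLike.mem_coe, MonoidHom.mem_ker, map_div, hvx, div_self']
    · rw [QuotientGroup.mk'_apply, QuotientGroup.mk_div, (QuotientGroup.eq_one_iff v).mpr hv,
        div_one]
  · rintro ⟨y, hy, hyx⟩
    rw [← hyx, MonoidHom.mem_ker, QuotientGroup.mk'_apply, QuotientGroup.map_mk,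
      show N y = 1 from hy, QuotientGroup.mk_one]

lemma relIndex_range_ker_quotientMap {N D : U →* U} (hND : ∀ x, N (D x) = 1)
    (hDN : ∀ x, D (N x) = 1) (hNV : V ≤ V.comap N) (hDV : V ≤ V.comap D)
    (hN : ∀ x ∈ V, N x = 1 → ∃ y ∈ V, D y = x) (hD : ∀ x ∈ V, D x = 1 → ∃ y ∈ V, N y = x) :
    (QuotientGroup.map V V D hDV).range.relIndex (QuotientGroup.map V V N hNV).ker =
      D.range.relIndex N.ker := by
  rw [range_quotientMap, ker_quotientMap hNV fun x hx ↦ hD _ hx (hDN x)]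
  refine relIndex_map_mk (by rintro _ ⟨x, rfl⟩; exact hND x) fun x ⟨hx, hxV⟩ ↦ ?_
  obtain ⟨y, -, hy⟩ := hN x hxV hx
  exact ⟨y, hy⟩

theorem relIndex_range_ker_comm [Finite (U ⧸ V)] {N D : U →* U}
    (hND : ∀ x, N (D x) = 1) (hDN : ∀ x, D (N x) = 1)
    (hNV : V ≤ V.comap N) (hDV : V ≤ V.comap D)
    (hN : ∀ x ∈ V, N x = 1 → ∃ y ∈ V, D y = x) (hD : ∀ x ∈ V, D x = 1 → ∃ y ∈ V, N y = x) :
    D.range.relIndex N.ker = N.range.relIndex D.ker ∧ D.range.relIndex N.ker ≠ 0 := by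
  have hq {f g : U →* U} (hf : V ≤ V.comap f) (hg : V ≤ V.comap g) (hfg : ∀ x, f (g x) = 1)
      (q : U ⧸ V) : QuotientGroup.map V V f hf (QuotientGroup.map V V g hg q) = 1 := by
    obtain ⟨x, rfl⟩ := QuotientGroup.mk_surjective q
    exact congrArg (QuotientGroup.mk' V) (hfg x)
  rw [← relIndex_range_ker_quotientMap hND hDN hNV hDV hN hD,
    ← relIndex_range_ker_quotientMap hDN hND hDV hNV hD hN]
  exact ⟨relIndex_range_ker_comm_of_finite (hq hNV hDV hND) (hq hDV hNV hDN),
    Subgroup.index_ne_zero_of_finite⟩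

end Herbrand

/-! ### Traces and dual normal bases -/

section Trace

/-- The trace `x ↦ ∑ σ, σ x` of an additive group with an action of a finite group. -/
def gTrace (G : Type*) {A : Type*} [Group G] [Fintype G] [AddCommMonoid A] [DistribMulAction G A] :
    A →+ A where
  toFun x := ∑ σ : G, σ • x
  map_zero' := by simp
  map_add' x y := by simp [Finset.sum_add_distrib]

section

variable {G A : Type*} [Group G] [Fintype G] [AddCommMonoid A] [DistribMulAction G A]

lemma gTrace_apply (x : A) : gTrace G x = ∑ σ : G, σ • x := rfl

lemma smul_gTrace (g : G) (x : A) : g • gTrace G x = gTrace G x := by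
  rw [gTrace_apply, Finset.smul_sum]
  exact Fintype.sum_equiv (Equiv.mulLeft g) _ _ fun σ ↦ by simp [mul_smul]

lemma gTrace_smul (g : G) (x : A) : gTrace G (g • x) = gTrace G x := by
  rw [gTrace_apply]
  exact Fintype.sum_equiv (Equiv.mulRight g) _ _ fun σ ↦ by simp [mul_smul]

end

section

variable {G A : Type*} [Group G] [Fintype G] [CommSemiring A] [MulSemiringAction G A]

lemma gTrace_mul_of_fixed {a : A} (ha : ∀ g : G, g • a = a) (x : A) :
    gTrace G (a * x) = a * gTrace G x := by
  simp_rw [gTrace_apply, smul_mul', ha, Finset.mul_sum]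

lemma gTrace_of_fixed_mul {a : A} (ha : ∀ g : G, g • a = a) (x : A) :
    gTrace G (x * a) = gTrace G x * a := by
  rw [mul_comm, gTrace_mul_of_fixed ha, mul_comm]

end

/-- In a cyclic group generated by `g`, a `1`-cocycle is determined by its value at `g`, which
can be any element of trace zero. -/
lemma exists_cocycle_of_gTrace_eq_zero {G A : Type*} [Group G] [Fintype G] [AddCommGroup A]
    [DistribMulAction G A] {g : G} (hg : ∀ x, x ∈ Subgroup.zpowers g) {L : AddSubgroup A}
    (hL : ∀ (σ : G), ∀ y ∈ L, σ • y ∈ L) {x : A} (hx : x ∈ L) (htr : gTrace G x = 0) :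
    ∃ c : G → A, (∀ σ τ, c (σ * τ) = c σ + σ • c τ) ∧ (∀ σ, c σ ∈ L) ∧ c g = x := by
  classical
  let S (n : ℕ) : A := ∑ i ∈ Finset.range n, g ^ i • x
  have hS_add (m n : ℕ) : S (m + n) = S m + g ^ m • S n := by
    simp only [S, Finset.sum_range_add, Finset.smul_sum, smul_smul, pow_add]
  have hS_order : S (orderOf g) = 0 := by
    rw [← htr, gTrace_apply]
    refine Finset.sum_nbij (g ^ ·) (by simp) (fun i hi j hj h ↦ ?_) (fun σ _ ↦ ?_) (by simp)
    · exact pow_injOn_Iio_orderOf (by simpa using hi) (by simpa using hj) h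
    · simpa using (isOfFinOrder_of_finite g).mem_zpowers_iff_mem_range_orderOf.mp (hg σ)
  have hS_periodic : Function.Periodic S (orderOf g) := fun n ↦ by
    rw [hS_add, hS_order, smul_zero, add_zero]
  have hS_congr {m n : ℕ} (h : g ^ m = g ^ n) : S m = S n := by
    rw [← hS_periodic.map_mod_nat m, ← hS_periodic.map_mod_nat n, pow_eq_pow_iff_modEq.mp h]
  choose e he using fun σ ↦
    (Submonoid.mem_powers_iff _ _).mp (mem_powers_iff_mem_zpowers.mpr (hg σ))
  refine ⟨fun σ ↦ S (e σ), fun σ τ ↦ ?_, fun σ ↦ sum_mem fun i _ ↦ hL _ _ hx, ?_⟩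
  · change S (e (σ * τ)) = S (e σ) + σ • S (e τ)
    rw [hS_congr (n := e σ + e τ) (by simp only [pow_add, he]), hS_add, he]
  · change S (e g) = x
    rw [hS_congr (n := 1) (by rw [he, pow_one])]
    simp [S]

end Trace

/-- Elements `α`, `β` of a ring `A` with an action of a finite group `G` whose conjugates are dual
to each other for the trace; the conjugates of `α` then form a normal basis of `A` over its ring
of invariants. -/
structure DualNormalBasis (G A : Type*) [Group G] [Fintype G] [CommRing A]
    [MulSemiringAction G A] where
  α : A
  β : A
  gTrace_mul_self : gTrace G (α * β) = 1
  gTrace_mul_smul : ∀ τ : G, τ ≠ 1 → gTrace G (α * τ • β) = 0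

namespace DualNormalBasis

variable {G A : Type*} [Group G] [Fintype G] [CommRing A] [MulSemiringAction G A]

/-- The image of a dual normal basis under an equivariant homomorphism. -/
def map {B : Type*} [CommRing B] [MulSemiringAction G B] (D : DualNormalBasis G A)
    (f : A →+*[G] B) : DualNormalBasis G B where
  α := f D.α
  β := f D.β
  gTrace_mul_self := by
    simpa only [gTrace_apply, map_sum, map_smul, map_mul, map_one] using
      congrArg f D.gTrace_mul_self
  gTrace_mul_smul τ hτ := by
    simpa only [gTrace_apply, map_sum, map_smul, map_mul, map_zero] using
      congrArg f (D.gTrace_mul_smul τ hτ)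

/-- The dual normal basis `(u α, u⁻¹ β)`, for an invariant unit `u`. -/
def rescale (D : DualNormalBasis G A) (u : Aˣ) (hu : ∀ g : G, g • (u : A) = u) :
    DualNormalBasis G A where
  α := u * D.α
  β := ↑u⁻¹ * D.β
  gTrace_mul_self := by
    rw [mul_mul_mul_comm, u.mul_inv, one_mul, D.gTrace_mul_self]
  gTrace_mul_smul τ hτ := by
    have hu' : τ • (↑u⁻¹ : A) = ↑u⁻¹ := by
      refine left_inv_eq_right_inv (a := (u : A)) ?_ u.mul_inv
      rw [← smul_one τ, ← u.inv_mul, smul_mul', hu]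
    rw [smul_mul', hu', mul_mul_mul_comm, u.mul_inv, one_mul, D.gTrace_mul_smul τ hτ]

variable (D : DualNormalBasis G A)

lemma matrix_β_mul_matrix_α [DecidableEq G] : (Matrix.of fun σ ρ : G ↦ (ρ * σ) • D.β) *
    (Matrix.of fun ρ σ : G ↦ (ρ * σ) • D.α) = 1 := by
  ext σ τ
  have hterm (ρ : G) : (ρ * σ) • D.β * (ρ * τ) • D.α = ρ • τ • (D.α * (τ⁻¹ * σ) • D.β) := by
    rw [smul_smul, smul_mul', smul_smul, mul_comm]
    group
  simp only [Matrix.mul_apply, Matrix.of_apply, hterm, Matrix.one_apply]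
  rw [← gTrace_apply, gTrace_smul]
  split_ifs with h
  · rw [h, inv_mul_cancel, one_smul, D.gTrace_mul_self]
  · exact D.gTrace_mul_smul _ fun h' ↦ h (inv_mul_eq_one.mp h').symm

lemma isUnit_det_matrix_α [DecidableEq G] :
    IsUnit (Matrix.of fun ρ σ : G ↦ (ρ * σ) • D.α).det :=
  (Matrix.isUnit_iff_isUnit_det _).mp (.of_mul_eq_one_right _ D.matrix_β_mul_matrix_α)

lemma sum_smul_mul_smul [DecidableEq G] (τ : G) :
    ∑ σ : G, σ • D.α * (τ * σ) • D.β = if τ = 1 then 1 else 0 := by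
  have hPQ := Matrix.ext_iff.mpr (mul_eq_one_comm.mp D.matrix_β_mul_matrix_α) 1 τ
  simpa only [Matrix.mul_apply, Matrix.of_apply, one_mul, Matrix.one_apply, eq_comm] using hPQ

/-- The coordinates of `x` in the basis of the conjugates of `α`. -/
def coord (x : A) (σ : G) : A := gTrace G (x * σ • D.β)

lemma smul_coord (g : G) (x : A) (σ : G) : g • D.coord x σ = D.coord x σ := smul_gTrace g _

lemma coord_smul (g : G) (x : A) (σ : G) : D.coord (g • x) σ = D.coord x (g⁻¹ * σ) := by
  rw [coord, coord, ← gTrace_smul g (x * _), smul_mul', smul_smul, mul_inv_cancel_left]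

lemma coord_add (x y : A) (σ : G) : D.coord (x + y) σ = D.coord x σ + D.coord y σ := by
  rw [coord, add_mul, map_add, coord, coord]

lemma coord_sub (x y : A) (σ : G) : D.coord (x - y) σ = D.coord x σ - D.coord y σ := by
  rw [coord, sub_mul, map_sub, coord, coord]

lemma coord_mul {a : A} (ha : ∀ g : G, g • a = a) (x : A) (σ : G) :
    D.coord (a * x) σ = a * D.coord x σ := by
  rw [coord, mul_assoc, gTrace_mul_of_fixed ha, coord]

lemma sum_coord_mul (x : A) : ∑ σ : G, D.coord x σ * σ • D.α = x := by
  classical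
  calc ∑ σ : G, D.coord x σ * σ • D.α
      = ∑ τ : G, τ • x * ∑ σ : G, σ • D.α * (τ * σ) • D.β := by
        simp_rw [coord, gTrace_apply, smul_mul', smul_smul, Finset.sum_mul, Finset.mul_sum]
        rw [Finset.sum_comm]
        exact Finset.sum_congr rfl fun τ _ ↦ Finset.sum_congr rfl fun σ _ ↦ by ring
    _ = x := by simp [sum_smul_mul_smul]

lemma coord_smul_α_self (σ : G) : D.coord (σ • D.α) σ = 1 := by
  rw [coord, ← smul_mul', gTrace_smul, D.gTrace_mul_self]

lemma coord_smul_α_of_ne {σ τ : G} (h : σ ≠ τ) : D.coord (σ • D.α) τ = 0 := by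
  rw [coord_smul, coord, D.gTrace_mul_smul _ fun h' ↦ h (inv_mul_eq_one.mp h')]

lemma coord_sum_mul {c : G → A} (hc : ∀ g σ : G, g • c σ = c σ) (τ : G) :
    D.coord (∑ σ, c σ * σ • D.α) τ = c τ := by
  have hsum : D.coord (∑ σ, c σ * σ • D.α) τ = ∑ σ, D.coord (c σ * σ • D.α) τ := by
    simp only [coord, Finset.sum_mul, map_sum]
  rw [hsum, Finset.sum_eq_single τ, D.coord_mul (hc · τ), D.coord_smul_α_self, mul_one]
  · intro σ _ hσ
    rw [D.coord_mul (hc · σ), D.coord_smul_α_of_ne hσ, mul_zero]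
  · simp

section Norm

variable {R : Type*} [CommRing R] [Algebra R A] [Algebra.IsInvariant R A G] [SMulCommClass G R A]

lemma exists_basis [FaithfulSMul R A] : ∃ b : Module.Basis G R A, ∀ σ, b σ = σ • D.α := by
  let Φ : (G → R) →ₗ[R] A := Fintype.linearCombination R fun σ : G ↦ σ • D.α
  have hΦ (c : G → R) : Φ c = ∑ σ, algebraMap R A (c σ) * σ • D.α := by
    simp only [Φ, Fintype.linearCombination_apply, Algebra.smul_def]
  have hinj : Function.Injective Φ := fun c c' h ↦ by
    rw [hΦ, hΦ] at h
    refine funext fun τ ↦ FaithfulSMul.algebraMap_injective R A ?_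
    rw [← D.coord_sum_mul (c := fun σ ↦ algebraMap R A (c σ)) (fun g σ ↦ smul_algebraMap g _) τ,
      h, D.coord_sum_mul fun g σ ↦ smul_algebraMap g _]
  have hsurj : Function.Surjective Φ := fun x ↦ by
    choose c hc using fun σ ↦
      Algebra.IsInvariant.isInvariant (A := R) (D.coord x σ) fun g : G ↦ D.smul_coord g x σ
    exact ⟨c, by simp only [hΦ, hc, D.sum_coord_mul]⟩
  classical
  refine ⟨.ofEquivFun (LinearEquiv.ofBijective Φ ⟨hinj, hsurj⟩).symm, fun σ ↦ ?_⟩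
  rw [Module.Basis.coe_ofEquivFun, LinearEquiv.symm_symm]
  change Φ (Pi.single σ 1) = σ • D.α
  rw [Fintype.linearCombination_apply_single, one_smul]

lemma algebraMap_norm (D : DualNormalBasis G A) [FaithfulSMul R A] (x : A) :
    algebraMap R A (Algebra.norm R x) = ∏ σ : G, σ • x := by
  classical
  obtain ⟨b, hb⟩ := D.exists_basis (R := R)
  let P : Matrix G G A := Matrix.of fun ρ σ ↦ (ρ * σ) • D.α
  have hconj : Matrix.diagonal (fun ρ : G ↦ ρ • x) * P =
      P * (algebraMap R A).mapMatrix (Algebra.leftMulMatrix b x) := by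
    ext ρ σ
    have hmul : x * σ • D.α =
        ∑ τ, algebraMap R A (Algebra.leftMulMatrix b x τ σ) * τ • D.α := by
      rw [← hb, ← b.sum_repr (x * b σ)]
      simp only [Algebra.leftMulMatrix_eq_repr_mul, Algebra.smul_def, hb]
    rw [Matrix.diagonal_mul, Matrix.mul_apply]
    calc ρ • x * (ρ * σ) • D.α
        = ρ • ∑ τ, algebraMap R A (Algebra.leftMulMatrix b x τ σ) * τ • D.α := by
          rw [← hmul, smul_mul', smul_smul]
      _ = ∑ τ, (ρ * τ) • D.α * algebraMap R A (Algebra.leftMulMatrix b x τ σ) := by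
          simp only [Finset.smul_sum, smul_mul', smul_algebraMap, smul_smul, mul_comm]
  have hdet := congrArg Matrix.det hconj
  rw [Matrix.det_mul, Matrix.det_mul, Matrix.det_diagonal, mul_comm, ← RingHom.map_det] at hdet
  rw [Algebra.norm_eq_matrix_det b]
  exact (D.isUnit_det_matrix_α.mul_left_cancel hdet).symm

end Norm

lemma gTrace_α_mul_gTrace_β : gTrace G D.α * gTrace G D.β = 1 := by
  classical
  rw [← gTrace_of_fixed_mul (fun g ↦ smul_gTrace g _), gTrace_apply D.β, Finset.mul_sum,
    map_sum, Finset.sum_eq_single 1 (fun σ _ hσ ↦ D.gTrace_mul_smul σ hσ) (by simp), one_smul,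
    D.gTrace_mul_self]

lemma coord_mul_gTrace_α {r : A} (hr : ∀ g : G, g • r = r) (σ : G) :
    D.coord r σ * gTrace G D.α = r := by
  rw [coord, gTrace_mul_of_fixed hr, gTrace_smul, mul_assoc, mul_comm (gTrace G D.β),
    D.gTrace_α_mul_gTrace_β, mul_one]

lemma eq_sub_smul_of_cocycle {c : G → A} (hc : ∀ σ τ, c (σ * τ) = c σ + σ • c τ) (σ : G) :
    c σ = (∑ τ, D.coord (c τ) τ * τ • D.α) - σ • ∑ τ, D.coord (c τ) τ * τ • D.α := by
  have hterm (τ : G) : σ • (D.coord (c τ) τ * τ • D.α) =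
      D.coord (c (σ * τ)) (σ * τ) * (σ * τ) • D.α - D.coord (c σ) (σ * τ) * (σ * τ) • D.α := by
    have hcoord : D.coord (c τ) τ = D.coord (σ • c τ) (σ * τ) := by
      rw [coord_smul, inv_mul_cancel_left]
    rw [smul_mul', D.smul_coord, smul_smul, hcoord, ← sub_mul, ← coord_sub, hc,
      add_sub_cancel_left]
  rw [Finset.smul_sum, Fintype.sum_equiv (Equiv.mulLeft σ) _
    (fun τ ↦ D.coord (c τ) τ * τ • D.α - D.coord (c σ) τ * τ • D.α) hterm,
    Finset.sum_sub_distrib, sum_coord_mul, sub_sub_cancel]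

/-- Additive Hilbert 90 for a lattice with a normal basis. -/
lemma exists_sub_smul_eq {g : G} (hg : ∀ x, x ∈ Subgroup.zpowers g) {L : AddSubgroup A}
    (hL : ∀ (σ : G), ∀ y ∈ L, σ • y ∈ L)
    (hLα : ∀ y ∈ L, ∀ σ : G, D.coord y σ * σ • D.α ∈ L) {x : A} (hx : x ∈ L)
    (htr : gTrace G x = 0) : ∃ l ∈ L, l - g • l = x := by
  obtain ⟨c, hc, hcL, rfl⟩ := exists_cocycle_of_gTrace_eq_zero hg hL hx htr
  exact ⟨_, sum_mem fun τ _ ↦ hLα _ (hcL τ) τ, (D.eq_sub_smul_of_cocycle hc g).symm⟩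

end DualNormalBasis

theorem nonempty_dualNormalBasis (k K : Type*) [Field k] [Field K] [Algebra k K]
    [FiniteDimensional k K] [IsGalois k K] : Nonempty (DualNormalBasis (K ≃ₐ[k] K) K) := by
  classical
  let b := IsGalois.normalBasis k K
  let d := (Algebra.traceForm k K).dualBasis (traceForm_nondegenerate k K) b
  have hdual (τ : K ≃ₐ[k] K) : Algebra.trace k K (d 1 * τ (b 1)) = if τ = 1 then 1 else 0 := by
    rw [← IsGalois.normalBasis_apply]
    exact LinearMap.BilinForm.apply_dualBasis_left (traceForm_nondegenerate k K) b 1 τ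
  have htrace (x : K) : gTrace (K ≃ₐ[k] K) x = algebraMap k K (Algebra.trace k K x) :=
    (trace_eq_sum_automorphisms x).symm
  refine ⟨⟨d 1, b 1, ?_, fun τ hτ ↦ ?_⟩⟩
  · rw [htrace]
    simpa using congrArg (algebraMap k K) (hdual 1)
  · rw [htrace, AlgEquiv.smul_def, hdual, if_neg hτ, map_zero]

/-! ### The Herbrand quotient of a group of units near `1` -/

lemma map_div_sub_one {U A : Type*} [CommGroup U] [Ring A] (ι : U →* A) (a b : U) :
    ι (a / b) - 1 = ι b⁻¹ * (ι a - ι b) := by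
  rw [mul_sub, ← map_mul, ← map_mul, inv_mul_cancel, map_one, div_eq_inv_mul]

/-- A dual normal basis of a topological ring `A` together with an invariant compact open subring
`O` containing `α` and an invariant topologically nilpotent unit `ϖ ∈ O`. The invariants of `O`
then span an invariant lattice on the conjugates of `α`, which contains `ϖ ^ c O`. -/
structure NormalLattice (G A : Type*) [Group G] [Fintype G] [CommRing A] [MulSemiringAction G A]
    [TopologicalSpace A] extends DualNormalBasis G A where
  O : Subring A
  smul_mem : ∀ (g : G) {x : A}, x ∈ O → g • x ∈ O
  isCompact : IsCompact (O : Set A)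
  isOpen : IsOpen (O : Set A)
  ϖ : Aˣ
  ϖ_mem : (ϖ : A) ∈ O
  smul_ϖ : ∀ g : G, g • (ϖ : A) = ϖ
  separated : ∀ x : A, (∀ n : ℕ, ∃ y ∈ O, x = ϖ ^ n * y) → x = 0
  α_mem : α ∈ O
  c : ℕ
  β_mem : ϖ ^ c * β ∈ O

namespace NormalLattice

variable {G A : Type*} [Group G] [Fintype G] [CommRing A] [MulSemiringAction G A]
    [TopologicalSpace A] (D : NormalLattice G A)

/-- The same lattice with the exponent `c` raised by `n`. -/
def raise (n : ℕ) : NormalLattice G A where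
  __ := D
  c := n + D.c
  β_mem := by
    rw [pow_add, mul_assoc]
    exact mul_mem (pow_mem D.ϖ_mem n) D.β_mem

lemma smul_ϖ_pow (g : G) (n : ℕ) : g • (D.ϖ : A) ^ n = (D.ϖ : A) ^ n := by
  rw [smul_pow', D.smul_ϖ]

/-- The additive group `ϖⁿ O`. -/
def ball (n : ℕ) : AddSubgroup A where
  carrier := {x | ∃ y ∈ D.O, x = (D.ϖ : A) ^ n * y}
  zero_mem' := ⟨0, zero_mem _, by simp⟩
  add_mem' := by
    rintro _ _ ⟨y, hy, rfl⟩ ⟨z, hz, rfl⟩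
    exact ⟨y + z, add_mem hy hz, by ring⟩
  neg_mem' := by
    rintro _ ⟨y, hy, rfl⟩
    exact ⟨-y, neg_mem hy, by ring⟩

lemma mem_ball {n : ℕ} {x : A} : x ∈ D.ball n ↔ ∃ y ∈ D.O, x = (D.ϖ : A) ^ n * y := Iff.rfl

lemma ball_anti {n m : ℕ} (h : n ≤ m) : D.ball m ≤ D.ball n := by
  rintro _ ⟨y, hy, rfl⟩
  obtain ⟨d, rfl⟩ := Nat.exists_eq_add_of_le h
  exact ⟨(D.ϖ : A) ^ d * y, mul_mem (pow_mem D.ϖ_mem d) hy, by ring⟩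

lemma mul_mem_ball {n m : ℕ} {x y : A} (hx : x ∈ D.ball n) (hy : y ∈ D.ball m) :
    x * y ∈ D.ball (n + m) := by
  obtain ⟨x, hx, rfl⟩ := hx
  obtain ⟨y, hy, rfl⟩ := hy
  exact ⟨x * y, mul_mem hx hy, by ring⟩

lemma mul_mem_ball_left {n : ℕ} {x y : A} (hx : x ∈ D.O) (hy : y ∈ D.ball n) :
    x * y ∈ D.ball n := by
  obtain ⟨y, hy, rfl⟩ := hy
  exact ⟨x * y, mul_mem hx hy, by ring⟩

lemma smul_mem_ball {n : ℕ} {x : A} (g : G) (hx : x ∈ D.ball n) : g • x ∈ D.ball n := by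
  obtain ⟨x, hx, rfl⟩ := hx
  exact ⟨g • x, D.smul_mem g hx, by rw [smul_mul', D.smul_ϖ_pow]⟩

lemma gTrace_mem_ball {n : ℕ} {x : A} (hx : x ∈ D.ball n) : gTrace G x ∈ D.ball n :=
  sum_mem fun g _ ↦ D.smul_mem_ball g hx

/-- The lattice of the elements with coordinates in `ϖⁿ O`. -/
def lattice (n : ℕ) : AddSubgroup A where
  carrier := {x | ∀ σ : G, D.coord x σ ∈ D.ball n}
  zero_mem' σ := by
    rw [DualNormalBasis.coord, zero_mul, map_zero]
    exact zero_mem _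
  add_mem' hx hy σ := by
    rw [D.coord_add]
    exact add_mem (hx σ) (hy σ)
  neg_mem' hx σ := by
    rw [DualNormalBasis.coord, neg_mul, map_neg]
    exact neg_mem (hx σ)

lemma mem_lattice {n : ℕ} {x : A} : x ∈ D.lattice n ↔ ∀ σ : G, D.coord x σ ∈ D.ball n := Iff.rfl

lemma lattice_le_ball (n : ℕ) : D.lattice n ≤ D.ball n := fun x hx ↦ by
  rw [← D.sum_coord_mul x]
  refine sum_mem fun σ _ ↦ ?_
  rw [mul_comm]
  exact D.mul_mem_ball_left (D.smul_mem σ D.α_mem) (hx σ)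

lemma ball_le_lattice {n m : ℕ} (h : n + D.c ≤ m) : D.ball m ≤ D.lattice n := fun x hx σ ↦ by
  obtain ⟨y, hy, rfl⟩ := D.ball_anti h hx
  refine D.gTrace_mem_ball ⟨y * σ • ((D.ϖ : A) ^ D.c * D.β), mul_mem hy (D.smul_mem σ D.β_mem), ?_⟩
  rw [smul_mul', D.smul_ϖ_pow]
  ring

lemma lattice_anti {n m : ℕ} (h : n ≤ m) : D.lattice m ≤ D.lattice n :=
  fun _ hx σ ↦ D.ball_anti h (hx σ)

lemma smul_mem_lattice {n : ℕ} {x : A} (g : G) (hx : x ∈ D.lattice n) :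
    g • x ∈ D.lattice n := fun σ ↦ by
  rw [D.coord_smul]
  exact hx _

lemma mul_smul_α_mem_lattice {n : ℕ} {a : A} (ha : ∀ g : G, g • a = a)
    (ha_ball : a ∈ D.ball n) (σ : G) :
    a * σ • D.α ∈ D.lattice n := fun τ ↦ by
  rw [D.coord_mul ha]
  rcases eq_or_ne σ τ with rfl | h
  · rwa [D.coord_smul_α_self, mul_one]
  · rw [D.coord_smul_α_of_ne h, mul_zero]
    exact zero_mem _

lemma coord_mul_α_mem_lattice {n : ℕ} {x : A} (hx : x ∈ D.lattice n) :
    D.coord x 1 * D.α ∈ D.lattice n := by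
  simpa only [one_smul] using D.mul_smul_α_mem_lattice (fun g ↦ D.smul_coord g x 1) (hx 1) 1

lemma mul_mem_lattice {u x : A} (hu : u - 1 ∈ D.ball D.c) {n : ℕ} (hx : x ∈ D.lattice n) :
    u * x ∈ D.lattice n := by
  have : u * x = (u - 1) * x + x := by ring
  rw [this]
  exact add_mem (D.ball_le_lattice (by lia) (D.mul_mem_ball hu (D.lattice_le_ball n hx))) hx

lemma prod_one_add_sub_mem {ι : Type*} (s : Finset ι) (x : ι → A) {i : ℕ}
    (hx : ∀ j ∈ s, x j ∈ D.ball i) :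
    ∏ j ∈ s, (1 + x j) - 1 - ∑ j ∈ s, x j ∈ D.ball (i + i) := by
  classical
  induction s using Finset.induction_on with
  | empty => simp
  | insert a s ha ih =>
    have ih' := ih fun j hj ↦ hx j (Finset.mem_insert_of_mem hj)
    have hsum : ∑ j ∈ s, x j ∈ D.ball i := sum_mem fun j hj ↦ hx j (Finset.mem_insert_of_mem hj)
    have hmul := D.mul_mem_ball (hx a (Finset.mem_insert_self a s))
      (add_mem (D.ball_anti (Nat.le_add_right i i) ih') hsum)
    rw [Finset.prod_insert ha, Finset.sum_insert ha]
    convert! add_mem ih' hmul using 1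
    ring

lemma prod_smul_sub_mem {i : ℕ} (hi : D.c < i) {x : A} (hx : x ∈ D.lattice i) :
    ∏ σ : G, σ • (1 + x) - 1 - gTrace G x ∈ D.lattice (i + 1) := by
  simp_rw [smul_add, smul_one]
  exact D.ball_le_lattice (by lia) (D.prod_one_add_sub_mem Finset.univ (fun σ : G ↦ σ • x)
    fun σ _ ↦ D.smul_mem_ball σ (D.lattice_le_ball _ hx))

lemma exists_prod_smul_sub_mem {i : ℕ} (hi : D.c < i) {r : A} (hr : r ∈ D.lattice i)
    (hfix : ∀ g : G, g • r = r) :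
    ∃ x ∈ D.lattice i, ∏ σ : G, σ • (1 + x) - (1 + r) ∈ D.lattice (i + 1) := by
  refine ⟨_, D.coord_mul_α_mem_lattice hr, ?_⟩
  convert! D.prod_smul_sub_mem hi (D.coord_mul_α_mem_lattice hr) using 1
  rw [gTrace_mul_of_fixed (fun g ↦ D.smul_coord g r 1), D.coord_mul_gTrace_α hfix, sub_sub]

lemma exists_one_add_mul_sub_mem {g : G} (hg : ∀ x, x ∈ Subgroup.zpowers g) {i : ℕ}
    (hi : D.c < i) {r : A} (hr : r ∈ D.lattice i) (hN : ∏ σ : G, σ • (1 + r) = 1) :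
    ∃ x ∈ D.lattice i, (1 + r) * (1 + x) - g • (1 + x) ∈ D.lattice (i + 1) := by
  have htr : gTrace G r ∈ D.lattice (i + 1) := by
    simpa only [hN, sub_self, zero_sub, neg_mem_iff] using D.prod_smul_sub_mem hi hr
  set s : A := D.coord (gTrace G r) 1
  have hsα : s * D.α ∈ D.lattice (i + 1) := D.coord_mul_α_mem_lattice htr
  have htr' : gTrace G (r - s * D.α) = 0 := by
    rw [map_sub, gTrace_mul_of_fixed (fun g ↦ D.smul_coord g _ _),
      D.coord_mul_gTrace_α fun g ↦ smul_gTrace g r, sub_self]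
  obtain ⟨l, hl, hlr⟩ := D.exists_sub_smul_eq hg (fun σ y hy ↦ D.smul_mem_lattice σ hy)
    (fun y hy σ ↦ D.mul_smul_α_mem_lattice (fun g ↦ D.smul_coord g y σ) (hy σ) σ)
    (sub_mem hr (D.lattice_anti (Nat.le_succ _) hsα)) htr'
  have heq : (1 + r) * (1 + -l) - g • (1 + -l) = s * D.α - r * l := by
    rw [smul_add, smul_neg, smul_one]
    linear_combination -hlr
  refine ⟨-l, neg_mem hl, heq ▸ sub_mem hsα ?_⟩
  exact D.ball_le_lattice (by lia)
    (D.mul_mem_ball (D.lattice_le_ball _ hr) (D.lattice_le_ball _ hl))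

section Topology

variable [IsTopologicalRing A]

lemma isCompact_ball (n : ℕ) : IsCompact (D.ball n : Set A) := by
  have : (D.ball n : Set A) = (fun y ↦ (D.ϖ : A) ^ n * y) '' D.O := by
    ext x
    simp [mem_ball, eq_comm]
  rw [this]
  exact D.isCompact.image (by fun_prop)

lemma isOpen_ball (n : ℕ) : IsOpen (D.ball n : Set A) := by
  have : (D.ball n : Set A) = (fun y ↦ (↑(D.ϖ ^ n)⁻¹ : A) * y) ⁻¹' D.O := by
    ext x
    rw [SetLike.mem_coe, mem_ball, Set.mem_preimage, SetLike.mem_coe, ← Units.val_pow_eq_pow_val]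
    refine ⟨?_, fun h ↦ ⟨_, h, ((D.ϖ ^ n).mul_inv_cancel_left x).symm⟩⟩
    rintro ⟨y, hy, rfl⟩
    rwa [Units.inv_mul_cancel_left]
  rw [this]
  exact D.isOpen.preimage (by fun_prop)

variable [ContinuousConstSMul G A]

lemma continuous_coord (σ : G) : Continuous fun x ↦ D.coord x σ := by
  simp only [DualNormalBasis.coord, gTrace_apply]
  exact continuous_finsetSum _ fun τ _ ↦
    (continuous_const_smul τ).comp (continuous_mul_const _)

variable [T2Space A]

lemma isClosed_lattice (n : ℕ) : IsClosed (D.lattice n : Set A) := by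
  have : (D.lattice n : Set A) = ⋂ σ : G, (fun x ↦ D.coord x σ) ⁻¹' D.ball n := by
    ext x
    simp [mem_lattice]
  rw [this]
  exact isClosed_iInter fun σ ↦ (D.isCompact_ball n).isClosed.preimage (D.continuous_coord σ)

lemma isCompact_lattice (n : ℕ) : IsCompact (D.lattice n : Set A) :=
  (D.isCompact_ball n).of_isClosed_subset (D.isClosed_lattice n) (D.lattice_le_ball n)

lemma exists_eq_zero_of_forall_mem_ball {Φ : A → A} (hΦ : Continuous Φ) (n : ℕ)
    (h : ∀ i, ∃ w, w - 1 ∈ D.lattice n ∧ Φ w ∈ D.ball i) : ∃ w, w - 1 ∈ D.lattice n ∧ Φ w = 0 := by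
  let T : Set A := (fun w ↦ w - 1) ⁻¹' D.lattice n
  have hT : IsCompact T :=
    (Homeomorph.subRight (1 : A)).isCompact_preimage.mpr (D.isCompact_lattice n)
  have hclosed i : IsClosed (T ∩ Φ ⁻¹' D.ball i) :=
    hT.isClosed.inter ((D.isCompact_ball _).isClosed.preimage hΦ)
  obtain ⟨w, hw⟩ := IsCompact.nonempty_iInter_of_sequence_nonempty_isCompact_isClosed
    (fun i ↦ T ∩ Φ ⁻¹' D.ball i)
    (fun i ↦ Set.inter_subset_inter_right _ (Set.preimage_mono (D.ball_anti (Nat.le_succ i))))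
    h (hT.of_isClosed_subset (hclosed 0) Set.inter_subset_left) hclosed
  rw [Set.mem_iInter] at hw
  exact ⟨w, (hw 0).1, D.separated _ fun i ↦ (hw i).2⟩

end Topology

section Units

variable {U : Type*} [CommGroup U]

/-- The elements of a group `U` of units of `O` that lie in `1 + lattice (c + 1 + i)`; from the
exponent `c + 1` on these form groups and the norm is close to the trace. -/
def units (ι : U →* A) (hO : ∀ u, ι u ∈ D.O) (i : ℕ) : Subgroup U where
  carrier := {u | ι u - 1 ∈ D.lattice (D.c + 1 + i)}
  one_mem' := by simp
  mul_mem' {a b} ha hb := by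
    have : ι (a * b) - 1 = ι a * (ι b - 1) + (ι a - 1) := by rw [map_mul]; ring
    rw [Set.mem_ofPred_eq, this]
    exact add_mem (D.mul_mem_lattice (D.ball_anti (by lia) (D.lattice_le_ball _ ha)) hb) ha
  inv_mem' {a} ha := by
    have hinv : ι a⁻¹ - 1 = ι a⁻¹ * -(ι a - 1) := by
      rw [← one_div, map_div_sub_one, map_one, one_div, neg_sub]
    have hball : ι a⁻¹ - 1 ∈ D.ball (D.c + 1 + i) :=
      hinv ▸ D.mul_mem_ball_left (hO _) (neg_mem (D.lattice_le_ball _ ha))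
    rw [Set.mem_ofPred_eq, hinv]
    exact D.mul_mem_lattice (D.ball_anti (by lia) hball) (neg_mem ha)

section

variable {ι : U →* A} {hO : ∀ u, ι u ∈ D.O} {i : ℕ}

lemma mem_units {u : U} : u ∈ D.units ι hO i ↔ ι u - 1 ∈ D.lattice (D.c + 1 + i) := Iff.rfl

lemma units_anti {j : ℕ} (h : i ≤ j) : D.units ι hO j ≤ D.units ι hO i :=
  fun _ hu ↦ D.lattice_anti (by lia) hu

lemma div_mem_units {j : ℕ} {a b : U} (hb : b ∈ D.units ι hO j)
    (h : ι a - ι b ∈ D.lattice (D.c + 1 + i)) :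
    a / b ∈ D.units ι hO i := by
  rw [mem_units, map_div_sub_one]
  exact D.mul_mem_lattice (D.ball_anti (by lia) (D.lattice_le_ball _ (inv_mem hb))) h

lemma exists_mem_units (hU : ∀ x ∈ D.ball D.c, ∃ u, ι u = 1 + x) {x : A}
    (hx : x ∈ D.lattice (D.c + 1 + i)) : ∃ w ∈ D.units ι hO i, ι w = 1 + x := by
  obtain ⟨w, hw⟩ := hU x (D.ball_anti (by lia) (D.lattice_le_ball _ hx))
  exact ⟨w, by rwa [mem_units, hw, add_sub_cancel_left], hw⟩

lemma finite_quotient_units [IsTopologicalRing A] : Finite (U ⧸ D.units ι hO i) := by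
  have : CompactSpace D.O := isCompact_iff_compactSpace.mp D.isCompact
  let H : AddSubgroup D.O := (D.ball (D.c + 1 + i + D.c)).comap D.O.subtype.toAddMonoidHom
  have : Finite (D.O ⧸ H) := AddSubgroup.quotient_finite_of_isOpen H
    ((D.isOpen_ball _).preimage continuous_subtype_val)
  let z (u : U) : D.O := ⟨ι u, hO u⟩
  refine Finite.of_injective (β := D.O ⧸ H) (fun q ↦ QuotientAddGroup.mk (z q.out))
    fun q q' h ↦ ?_
  have hball : ι q'.out - ι q.out ∈ D.ball (D.c + 1 + i + D.c) := by
    have hz : -z q.out + z q'.out ∈ H := QuotientAddGroup.eq.mp h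
    rw [sub_eq_neg_add]
    exact hz
  rw [← q.out_eq, ← q'.out_eq]
  refine QuotientGroup.eq.mpr ?_
  rw [inv_mul_eq_div, mem_units, map_div_sub_one]
  exact D.ball_le_lattice le_rfl (D.mul_mem_ball_left (hO _) hball)

/-- Successive approximation by `hstep`, followed by a compactness argument; multiplication by `v`
turns the equation `f w = u` into a continuous one on `A`. -/
lemma exists_map_eq [IsTopologicalRing A] [ContinuousConstSMul G A] [T2Space A]
    (hι : Function.Injective ι) (hU : ∀ x ∈ D.ball D.c, ∃ u, ι u = 1 + x) {f : U →* U}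
    {K : Subgroup U} (hfK : ∀ w, f w ∈ K)
    (hstep : ∀ i, ∀ u ∈ D.units ι hO i, u ∈ K →
      ∃ w ∈ D.units ι hO i, u / f w ∈ D.units ι hO (i + 1))
    {u : U} {Φ : A → A} (hΦ : Continuous Φ)
    (hΦf : ∀ w, ∃ v, Φ (ι w) = ι v * (ι (u / f w) - 1))
    (hu : u ∈ D.units ι hO 0) (huK : u ∈ K) : ∃ w ∈ D.units ι hO 0, f w = u := by
  have happrox (i) : ∃ w ∈ D.units ι hO 0, u / f w ∈ D.units ι hO i := by
    induction i with
    | zero => exact ⟨1, one_mem _, by rwa [map_one, div_one]⟩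
    | succ i ih =>
      obtain ⟨w, hw, hwu⟩ := ih
      obtain ⟨w', hw', hwu'⟩ := hstep i _ hwu (div_mem huK (hfK w))
      exact ⟨w * w', mul_mem hw (D.units_anti i.zero_le hw'), by rwa [map_mul, ← div_div]⟩
  obtain ⟨y, hy, hΦy⟩ := D.exists_eq_zero_of_forall_mem_ball hΦ (D.c + 1) fun i ↦ by
    obtain ⟨w, hw, hwu⟩ := happrox i
    obtain ⟨v, hv⟩ := hΦf w
    exact ⟨ι w, hw, hv ▸ D.mul_mem_ball_left (hO v)
      (D.ball_anti (by lia) (D.lattice_le_ball _ hwu))⟩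
  obtain ⟨w, hw, hwy⟩ := D.exists_mem_units (i := 0) (hO := hO) hU hy
  obtain ⟨v, hv⟩ := hΦf w
  rw [hwy, add_sub_cancel, hΦy] at hv
  have hunit : IsUnit (ι v) := (Group.isUnit v).map ι
  have hone : ι (u / f w) = ι 1 := by
    rw [map_one, ← sub_eq_zero, ← hunit.mul_right_eq_zero, hv]
  exact ⟨w, hw, (div_eq_one.mp (hι hone)).symm⟩

end

variable [MulDistribMulAction G U]

variable {ι : U →*[G] A} {hO : ∀ u, (ι : U →* A) u ∈ D.O}

lemma smul_mem_units {i : ℕ} {u : U} (g : G) (hu : u ∈ D.units ι hO i) :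
    g • u ∈ D.units ι hO i := by
  have : ι (g • u) - 1 = g • (ι u - 1) := by rw [map_smul, smul_sub, smul_one]
  exact (congrArg (· ∈ _) this).mpr (D.smul_mem_lattice g hu)

lemma gNorm_mem_units {i : ℕ} {u : U} (hu : u ∈ D.units ι hO i) : gNorm G U u ∈ D.units ι hO i :=
  prod_mem fun σ _ ↦ D.smul_mem_units σ hu

lemma exists_div_gNorm_mem (hU : ∀ x ∈ D.ball D.c, ∃ u, ι u = 1 + x) {i : ℕ} {u : U}
    (hu : u ∈ D.units ι hO i) (hfix : ∀ g : G, g • u = u) :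
    ∃ w ∈ D.units ι hO i, u / gNorm G U w ∈ D.units ι hO (i + 1) := by
  obtain ⟨x, hx, hxu⟩ := D.exists_prod_smul_sub_mem (by lia) hu fun g ↦ by
    rw [smul_sub, smul_one, MonoidHom.coe_coe, ← map_smul, hfix]
  obtain ⟨w, hw, hwx⟩ := D.exists_mem_units (ι := (ι : U →* A)) hU hx
  refine ⟨w, hw, D.div_mem_units (D.gNorm_mem_units hw) ?_⟩
  rw [MonoidHom.coe_coe] at hwx
  rw [add_sub_cancel, ← hwx, MonoidHom.coe_coe, ← map_gNorm] at hxu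
  exact neg_sub (ι _) (ι u) ▸ neg_mem hxu

lemma exists_div_gDiff_mem (hU : ∀ x ∈ D.ball D.c, ∃ u, ι u = 1 + x) {g : G}
    (hg : ∀ x, x ∈ Subgroup.zpowers g) {i : ℕ} {u : U} (hu : u ∈ D.units ι hO i)
    (hNu : gNorm G U u = 1) : ∃ w ∈ D.units ι hO i, u / gDiff U g w ∈ D.units ι hO (i + 1) := by
  obtain ⟨x, hx, hxu⟩ := D.exists_one_add_mul_sub_mem hg (by lia) hu <| by
    rw [add_sub_cancel, MonoidHom.coe_coe, ← map_gNorm, hNu, map_one]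
  obtain ⟨w, hw, hwx⟩ := D.exists_mem_units (ι := (ι : U →* A)) hU hx
  refine ⟨w, hw, ?_⟩
  rw [gDiff_apply, div_div_eq_mul_div]
  refine D.div_mem_units (D.smul_mem_units g hw) ?_
  rwa [add_sub_cancel, ← hwx, ← map_mul, MonoidHom.coe_coe, ← map_smul] at hxu

variable [IsTopologicalRing A] [ContinuousConstSMul G A] [T2Space A]

lemma exists_gNorm_eq (hι : Function.Injective ι) (hU : ∀ x ∈ D.ball D.c, ∃ u, ι u = 1 + x) {u : U}
    (hu : u ∈ D.units ι hO 0) (hfix : ∀ g : G, g • u = u) :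
    ∃ w ∈ D.units ι hO 0, gNorm G U w = u := by
  let K : Subgroup U := ⨅ g : G, (gDiff U g).ker
  have hK {w : U} : w ∈ K ↔ ∀ g : G, g • w = w := by
    simp only [K, Subgroup.mem_iInf, MonoidHom.mem_ker, gDiff_apply, div_eq_one]
  refine D.exists_map_eq hι hU (K := K) (fun w ↦ hK.mpr fun g ↦ smul_gNorm g w)
    (fun i u hu huK ↦ D.exists_div_gNorm_mem hU hu (hK.mp huK))
    (Φ := fun w ↦ ι u - ∏ σ : G, σ • w)
    (continuous_const.sub (continuous_finsetProd _ fun σ _ ↦ continuous_const_smul σ))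
    (fun w ↦ ⟨gNorm G U w, ?_⟩) hu (hK.mpr hfix)
  rw [map_div_sub_one, ← mul_assoc, ← map_mul, mul_inv_cancel, map_one, one_mul]
  exact congrArg (ι u - ·) (map_gNorm ι w).symm

lemma exists_gDiff_eq (hι : Function.Injective ι) (hU : ∀ x ∈ D.ball D.c, ∃ u, ι u = 1 + x) {g : G}
    (hg : ∀ x, x ∈ Subgroup.zpowers g) {u : U} (hu : u ∈ D.units ι hO 0) (hNu : gNorm G U u = 1) :
    ∃ w ∈ D.units ι hO 0, gDiff U g w = u := by
  refine D.exists_map_eq hι hU (K := (gNorm G U).ker)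
    (fun w ↦ by rw [MonoidHom.mem_ker, gDiff_apply, map_div, gNorm_smul, div_self'])
    (fun i u hu huK ↦ D.exists_div_gDiff_mem hU hg hu huK) (Φ := fun w ↦ ι u * w - g • w)
    ((continuous_const_mul _).sub (continuous_const_smul g)) (fun w ↦ ⟨g • w, ?_⟩) hu hNu
  rw [gDiff_apply, div_div_eq_mul_div, map_div_sub_one, ← mul_assoc, ← map_mul, mul_inv_cancel,
    map_one, one_mul, map_mul]
  exact congrArg (ι u * ι w - ·) (map_smul ι g w).symm

lemma relIndex_range_gDiff_ker_gNorm_of_ball_c (hι : Function.Injective ι)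
    (hO : ∀ u, (ι : U →* A) u ∈ D.O) (hU : ∀ x ∈ D.ball D.c, ∃ u, ι u = 1 + x) {g : G}
    (hg : ∀ x, x ∈ Subgroup.zpowers g) :
    (gDiff U g).range.relIndex (gNorm G U).ker = (gNorm G U).range.relIndex (gDiff U g).ker ∧
      (gDiff U g).range.relIndex (gNorm G U).ker ≠ 0 := by
  have hfix (u : U) (hu : gDiff U g u = 1) (σ : G) : σ • u = u := by
    have : g ∈ MulAction.stabilizer G u := div_eq_one.mp hu
    exact (Subgroup.zpowers_le.mpr this) (hg σ)
  have : Finite (U ⧸ D.units (ι : U →* A) hO 0) := D.finite_quotient_units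
  refine relIndex_range_ker_comm (V := D.units (ι : U →* A) hO 0) (fun x ↦ ?_) (fun x ↦ ?_)
    (fun x hx ↦ Subgroup.mem_comap.mpr (D.gNorm_mem_units hx))
    (fun x hx ↦ Subgroup.mem_comap.mpr (div_mem (D.smul_mem_units g hx) hx))
    (fun x hx ↦ D.exists_gDiff_eq hι hU hg hx)
    (fun x hx hgx ↦ D.exists_gNorm_eq hι hU hx (hfix x hgx))
  · rw [gDiff_apply, map_div, gNorm_smul, div_self']
  · rw [gDiff_apply, smul_gNorm, div_self']

theorem relIndex_range_gDiff_ker_gNorm (hι : Function.Injective ι)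
    (hO : ∀ u, (ι : U →* A) u ∈ D.O) {n : ℕ} (hU : ∀ x ∈ D.ball n, ∃ u, ι u = 1 + x) {g : G}
    (hg : ∀ x, x ∈ Subgroup.zpowers g) :
    (gDiff U g).range.relIndex (gNorm G U).ker = (gNorm G U).range.relIndex (gDiff U g).ker ∧
      (gDiff U g).range.relIndex (gNorm G U).ker ≠ 0 :=
  (D.raise n).relIndex_range_gDiff_ker_gNorm_of_ball_c hι hO
    (fun x hx ↦ hU x (D.ball_anti (Nat.le_add_right n D.c) hx)) hg

end Units

end NormalLattice

/-! ### Weak approximation and the places above a given place -/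

namespace FinitePlace

variable {F F' : Type*} [Field F] [Field F']

/-- A real absolute value defining the place `w`; the base `2` is an arbitrary choice. -/
def abv (w : FinitePlace F) : AbsoluteValue F ℝ :=
  (IsDiscreteValuationRing.maximalIdeal w.ring).adicAbv (b := 2) one_lt_two

lemma abv_le_abv_iff (w : FinitePlace F) {x y : F} : w.abv x ≤ w.abv y ↔ w.val x ≤ w.val y :=
  NNReal.coe_le_coe.trans (WithZeroMulInt.toNNReal_strictMono one_lt_two).le_iff_le

lemma abv_lt_abv_iff (w : FinitePlace F) {x y : F} : w.abv x < w.abv y ↔ w.val x < w.val y :=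
  lt_iff_lt_of_le_iff_le w.abv_le_abv_iff

lemma abv_le_one_iff (w : FinitePlace F) {x : F} : w.abv x ≤ 1 ↔ x ∈ w.ring := by
  rw [← val_le_one_iff, ← map_one w.abv, abv_le_abv_iff, map_one]

lemma exists_val_lt_one (w : FinitePlace F) : ∃ π : F, π ≠ 0 ∧ w.val π < 1 := by
  obtain ⟨π, hπ⟩ := HeightOneSpectrum.valuation_exists_uniformizer F
    (IsDiscreteValuationRing.maximalIdeal w.ring)
  refine ⟨π, ?_, ?_⟩
  · rintro rfl
    rw [map_zero] at hπ
    exact WithZero.coe_ne_zero hπ.symm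
  · rw [val, hπ]
    decide

lemma val_le_val_iff_of_comap {f : F →+* F'} {v : FinitePlace F} {w : FinitePlace F'}
    (h : w.ring.comap f = v.ring) {a b : F} : w.val (f a) ≤ w.val (f b) ↔ v.val a ≤ v.val b := by
  rcases eq_or_ne b 0 with rfl | hb
  · simp
  have hvb : 0 < v.val b := zero_lt_iff.mpr (by simpa using hb)
  have hwb : 0 < w.val (f b) := zero_lt_iff.mpr (by simpa using hb)
  rw [← div_le_one₀ hvb, ← div_le_one₀ hwb, ← map_div₀, ← map_div₀, ← map_div₀, val_le_one_iff,
    val_le_one_iff, ← h, ValuationSubring.mem_comap]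

lemma val_lt_one_iff_of_comap {f : F →+* F'} {v : FinitePlace F} {w : FinitePlace F'}
    (h : w.ring.comap f = v.ring) {a : F} : w.val (f a) < 1 ↔ v.val a < 1 := by
  simpa using lt_iff_lt_of_le_iff_le (val_le_val_iff_of_comap h (a := 1) (b := a))

lemma val_eq_one_iff_of_comap {f : F →+* F'} {v : FinitePlace F} {w : FinitePlace F'}
    (h : w.ring.comap f = v.ring) {a : F} : w.val (f a) = 1 ↔ v.val a = 1 := by
  simpa [le_antisymm_iff] using and_congr (val_le_val_iff_of_comap h (a := a) (b := 1))
    (val_le_val_iff_of_comap h (a := 1) (b := a))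

lemma val_eq_one_of_sub_one (w : FinitePlace F) {x : F} (h : w.val (x - 1) < 1) :
    w.val x = 1 := by
  simpa using Valuation.map_one_add_of_lt _ h

lemma isNontrivial_abv (w : FinitePlace F) : w.abv.IsNontrivial := by
  obtain ⟨π, hπ0, hπ⟩ := w.exists_val_lt_one
  refine ⟨π, hπ0, ne_of_lt ?_⟩
  rwa [← map_one w.abv, abv_lt_abv_iff, map_one]

lemma isEquiv_abv_iff {w w' : FinitePlace F} : w.abv.IsEquiv w'.abv ↔ w = w' := by
  refine ⟨fun h ↦ ?_, fun h ↦ h ▸ .rfl⟩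
  ext x
  rw [← abv_le_one_iff, ← abv_le_one_iff, h.le_one_iff]

lemma not_isEquiv_abv_infinitePlace (w : FinitePlace F) (u : InfinitePlace F) :
    ¬ w.abv.IsEquiv u.1 := by
  intro h
  have htwo : w.abv ((2 : ℕ) : F) ≤ 1 := w.abv_le_one_iff.mpr (natCast_mem w.ring 2)
  rw [h.le_one_iff, ← InfinitePlace.coe_apply, u.map_natCast] at htwo
  norm_num at htwo

end FinitePlace

section Approximation

variable {F : Type*} [Field F]

theorem exists_approx {T : Set (FinitePlace F)} (hT : T.Finite) {T' : Set (InfinitePlace F)}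
    (hT' : T'.Finite) (x a : FinitePlace F → F) (ha : ∀ w ∈ T, a w ≠ 0) (y : InfinitePlace F → F) :
    ∃ b : F, (∀ w ∈ T, w.val (b - x w) < w.val (a w)) ∧ ∀ w ∈ T', w (b - y w) < 1 := by
  have := hT.to_subtype
  have := hT'.to_subtype
  let u : T ⊕ T' → AbsoluteValue F ℝ := Sum.elim (fun w ↦ w.1.abv) (fun w ↦ w.1.1)
  have hnontrivial : ∀ i, (u i).IsNontrivial := by
    rintro (w | w)
    · exact w.1.isNontrivial_abv
    · exact w.1.isNontrivial
  have hinequiv : Pairwise fun i j ↦ ¬ (u i).IsEquiv (u j) := by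
    rintro (w | w) (w' | w') hne h
    · exact hne (congrArg _ (Subtype.ext (FinitePlace.isEquiv_abv_iff.mp h)))
    · exact w.1.not_isEquiv_abv_infinitePlace w'.1 h
    · exact w'.1.not_isEquiv_abv_infinitePlace w.1 h.symm
    · exact hne (congrArg _ (Subtype.ext (InfinitePlace.eq_iff_isEquiv.mpr h)))
  let z : (i : T ⊕ T') → WithAbs (u i) := fun i ↦
    WithAbs.toAbs (u i) (Sum.elim (fun w ↦ x w.1) (fun w ↦ y w.1) i)
  let s : (i : T ⊕ T') → Set (WithAbs (u i)) := fun i ↦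
    Metric.ball (z i) (Sum.elim (fun w ↦ w.1.abv (a w.1)) (fun _ ↦ 1) i)
  have hs : Set.univ.pi s ∈ nhds z := by
    refine set_pi_mem_nhds Set.finite_univ fun i _ ↦ Metric.ball_mem_nhds _ ?_
    rcases i with w | w
    · exact w.1.abv.pos (ha w.1 w.2)
    · exact one_pos
  obtain ⟨b, hb⟩ := (AbsoluteValue.denseRange_algebraMap_pi hnontrivial hinequiv).exists_mem_open
    isOpen_interior ⟨z, mem_interior_iff_mem_nhds.mpr hs⟩
  replace hb := interior_subset hb
  refine ⟨b, fun w hw ↦ w.abv_lt_abv_iff.mp ?_, fun w hw ↦ ?_⟩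
  · exact mem_ball_iff_norm.mp (hb (Sum.inl ⟨w, hw⟩) (Set.mem_univ _))
  · exact mem_ball_iff_norm.mp (hb (Sum.inr ⟨w, hw⟩) (Set.mem_univ _))

lemma exists_approx_finite {T : Set (FinitePlace F)} (hT : T.Finite) (x a : FinitePlace F → F)
    (ha : ∀ w ∈ T, a w ≠ 0) : ∃ b : F, ∀ w ∈ T, w.val (b - x w) < w.val (a w) := by
  obtain ⟨b, hb, -⟩ := exists_approx hT Set.finite_empty x a ha fun _ ↦ 0
  exact ⟨b, hb⟩

lemma exists_val_eq_one_and_val_lt_one {T : Set (FinitePlace F)} (hT : T.Finite)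
    (s : Set (FinitePlace F)) :
    ∃ b : F, ∀ w ∈ T, (w ∈ s → w.val b = 1) ∧ (w ∉ s → w.val b < 1) := by
  classical
  obtain ⟨b, hb⟩ := exists_approx_finite hT (fun w ↦ if w ∈ s then 1 else 0) (fun _ ↦ 1)
    fun _ _ ↦ one_ne_zero
  refine ⟨b, fun w hw ↦ ⟨fun hs ↦ w.val_eq_one_of_sub_one ?_, fun hs ↦ ?_⟩⟩
  · simpa only [if_pos hs, map_one] using hb w hw
  · simpa only [if_neg hs, map_one, sub_zero] using hb w hw

end Approximation

namespace FinitePlace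

section LinearIndependence

variable {k ι : Type*} [Field k] [Fintype ι]

lemma exists_coeff_eq_one_of_not_linearIndependent {V : Type*} [AddCommGroup V] [Module k V]
    (v : FinitePlace k) {b : ι → V} (hb : ¬ LinearIndependent k b) :
    ∃ (c : ι → v.ring) (i : ι), c i = 1 ∧ ∑ j, (c j : k) • b j = 0 := by
  rw [Fintype.linearIndependent_iff] at hb
  push Not at hb
  obtain ⟨c, hc, j, hj⟩ := hb
  have : Nonempty ι := ⟨j⟩
  obtain ⟨i, hi⟩ := Finite.exists_max fun i ↦ v.val (c i)
  have hci : c i ≠ 0 := fun h ↦ hj (by simpa [h] using hi j)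
  have hmem : ∀ l, (c i)⁻¹ * c l ∈ v.ring := fun l ↦ by
    rw [← val_le_one_iff, map_mul, map_inv₀, inv_mul_eq_div]
    exact div_le_one_of_le₀ (hi l) zero_le
  refine ⟨fun l ↦ ⟨_, hmem l⟩, i, Subtype.ext (inv_mul_cancel₀ hci), ?_⟩
  simp only [mul_smul, ← Finset.smul_sum, hc, smul_zero]

end LinearIndependence

variable {k : Type*} {K : Type*} [Field k] [Field K] [Algebra k K]

lemma val_twist_lt_one_iff (w : FinitePlace K) (σ : K ≃ₐ[k] K) {a : K} :
    (w.twist σ).val a < 1 ↔ w.val (σ a) < 1 :=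
  (val_lt_one_iff_of_comap (f := (σ : K →+* K)) (v := w.twist σ) (w := w) rfl).symm

lemma val_twist_eq_one_iff (w : FinitePlace K) (σ : K ≃ₐ[k] K) {a : K} :
    (w.twist σ).val a = 1 ↔ w.val (σ a) = 1 :=
  (val_eq_one_iff_of_comap (f := (σ : K →+* K)) (v := w.twist σ) (w := w) rfl).symm

variable [FiniteDimensional k K]

lemma Over.comap_ring {v : FinitePlace k} (w : v.Over K) :
    w.1.ring.comap (algebraMap k K) = v.ring := congrArg FinitePlace.ring w.2

lemma Over.val_le_val_iff {v : FinitePlace k} (w : v.Over K) {a b : k} :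
    w.1.val (algebraMap k K a) ≤ w.1.val (algebraMap k K b) ↔ v.val a ≤ v.val b :=
  val_le_val_iff_of_comap w.comap_ring

lemma Over.val_lt_one_iff {v : FinitePlace k} (w : v.Over K) {a : k} :
    w.1.val (algebraMap k K a) < 1 ↔ v.val a < 1 :=
  val_lt_one_iff_of_comap w.comap_ring

lemma Over.val_eq_one_iff {v : FinitePlace k} (w : v.Over K) {a : k} :
    w.1.val (algebraMap k K a) = 1 ↔ v.val a = 1 :=
  val_eq_one_iff_of_comap w.comap_ring

lemma linearIndependent_of_val {v : FinitePlace k} {ι : Type*} [Finite ι] {w : ι → v.Over K}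
    {b : ι → K} (hself : ∀ i, (w i).1.val (b i) = 1)
    (hother : ∀ i j, i ≠ j → (w i).1.val (b j) < 1) : LinearIndependent k b := by
  classical
  have := Fintype.ofFinite ι
  by_contra hb
  obtain ⟨c, i, hci, hc⟩ := v.exists_coeff_eq_one_of_not_linearIndependent hb
  rw [← Finset.add_sum_erase _ _ (Finset.mem_univ i), hci, OneMemClass.coe_one, one_smul] at hc
  have hlt : (w i).1.val (∑ j ∈ Finset.univ.erase i, (c j : k) • b j) < 1 := by
    refine Valuation.map_sum_lt _ one_ne_zero fun j hj ↦ ?_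
    have hcj : (w i).1.val (algebraMap k K (c j)) ≤ 1 := by
      simpa using ((w i).val_le_val_iff (a := c j) (b := 1)).mpr
        (by simpa using (v.val_le_one_iff _).mpr (c j).2)
    rw [Algebra.smul_def, map_mul]
    exact (mul_le_of_le_one_left' hcj).trans_lt (hother i j (Finset.ne_of_mem_erase hj).symm)
  rw [← Valuation.map_neg, ← eq_neg_of_add_eq_zero_left hc, hself] at hlt
  exact lt_irrefl _ hlt

lemma card_over_le_finrank {v : FinitePlace k} (s : Finset (v.Over K)) :
    s.card ≤ Module.finrank k K := by
  have hT : (Subtype.val '' (s : Set (v.Over K))).Finite := s.finite_toSet.image _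
  choose b hb using fun w : s ↦ exists_val_eq_one_and_val_lt_one hT {w.1.1}
  have hli : LinearIndependent k b := linearIndependent_of_val (w := fun w : s ↦ w.1)
    (fun w ↦ (hb w w.1.1 ⟨w.1, w.2, rfl⟩).1 rfl)
    (fun w w' hne ↦ (hb w' w.1.1 ⟨w.1, w.2, rfl⟩).2
      fun h ↦ hne (Subtype.ext (Subtype.ext h)))
  simpa using hli.fintype_card_le_finrank

-- The extension may be inseparable, so the argument is by independence of valuations.
lemma finite_over_of_finiteDimensional (v : FinitePlace k) : Finite (v.Over K) := by
  by_contra h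
  rw [not_finite_iff_infinite] at h
  obtain ⟨s, hs⟩ := Infinite.exists_subset_card_eq (v.Over K) (Module.finrank k K + 1)
  have := card_over_le_finrank s
  lia

lemma Over.twist_mul_inv_eq {v : FinitePlace k} {w w' : v.Over K} {σ τ : K ≃ₐ[k] K}
    (h : w.twist τ = w'.twist σ) : w.twist (τ * σ⁻¹) = w' := by
  refine Subtype.ext (FinitePlace.ext (SetLike.ext fun x ↦ ?_))
  have hiff : τ (σ⁻¹ x) ∈ w.1.ring ↔ σ (σ⁻¹ x) ∈ w'.1.ring :=
    iff_of_eq (congrArg (fun u : v.Over K ↦ σ⁻¹ x ∈ u.1.ring) h)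
  exact hiff.trans (by rw [show σ (σ⁻¹ x) = x from σ.apply_symm_apply x])

theorem exists_twist_eq [IsGalois k K] {v : FinitePlace k} (w w' : v.Over K) :
    ∃ σ : K ≃ₐ[k] K, w.twist σ = w' := by
  by_contra! hc
  obtain ⟨b, hb⟩ := exists_val_eq_one_and_val_lt_one
    (Set.finite_range fun u : v.Over K ↦ u.1) (Set.range fun σ : K ≃ₐ[k] K ↦ (w.twist σ).1)
  have hw : ∀ σ : K ≃ₐ[k] K, w.1.val (σ b) = 1 := fun σ ↦
    (val_twist_eq_one_iff w.1 σ).mp ((hb _ ⟨w.twist σ, rfl⟩).1 ⟨σ, rfl⟩)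
  have hw' : ∀ σ : K ≃ₐ[k] K, w'.1.val (σ b) < 1 := fun σ ↦
    (val_twist_lt_one_iff w'.1 σ).mp ((hb _ ⟨w'.twist σ, rfl⟩).2
      fun ⟨τ, hτ⟩ ↦ hc _ (Over.twist_mul_inv_eq (Subtype.ext hτ)))
  have hnorm := Algebra.norm_eq_prod_automorphisms k b
  have hnorm_w : w.1.val (algebraMap k K (Algebra.norm k b)) = 1 := by
    rw [hnorm, map_prod]
    exact Finset.prod_eq_one fun σ _ ↦ hw σ
  have hnorm_w' : w'.1.val (algebraMap k K (Algebra.norm k b)) < 1 := by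
    classical
    rw [hnorm, map_prod, ← Finset.mul_prod_erase _ _ (Finset.mem_univ 1)]
    exact mul_lt_one_of_lt_of_le (hw' 1) (Finset.prod_le_one' fun σ _ ↦ (hw' σ).le)
  exact (w'.val_lt_one_iff.mp hnorm_w').ne (w.val_eq_one_iff.mp hnorm_w)

end FinitePlace

/-! ### Finiteness properties of the places of a global field -/

/-- The finiteness properties common to all global fields: every nonzero element is a unit at almost
all finite places, and all residue fields are finite. -/
structure HasFinitePlaces (F : Type*) [Field F] : Prop where
  finite_val_ne_one : ∀ c : F, c ≠ 0 → {w : FinitePlace F | w.val c ≠ 1}.Finite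
  finite_residueField : ∀ w : FinitePlace F, Finite (IsLocalRing.ResidueField w.ring)

section Extension

variable {E F : Type*} [Field E] [Field F] [Algebra E F]

namespace FinitePlace

lemma isUnit_iff_val_eq_one (w : FinitePlace F) (a : w.ring) : IsUnit a ↔ w.val a = 1 := by
  have hlt : w.val a < 1 ↔ a ∈ IsLocalRing.maximalIdeal w.ring :=
    HeightOneSpectrum.valuation_lt_one_iff_mem _ a
  rw [← not_iff_not, ← ne_eq (w.val a), ← ((w.val_le_one_iff a).mpr a.2).lt_iff_ne, hlt,
    IsLocalRing.mem_maximalIdeal, mem_nonunits_iff]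

lemma val_le_one_of_aeval_eq_zero (w : FinitePlace F) {p : Polynomial E} (hp : p.Monic)
    (hcoeff : ∀ i, w.val (algebraMap E F (p.coeff i)) ≤ 1) {c : F}
    (hc : Polynomial.aeval c p = 0) : w.val c ≤ 1 := by
  by_contra! hlt
  rw [Polynomial.aeval_eq_sum_range, Finset.sum_range_succ, hp.coeff_natDegree, one_smul] at hc
  have hsum : w.val (∑ i ∈ Finset.range p.natDegree, p.coeff i • c ^ i) <
      w.val c ^ p.natDegree := by
    refine Valuation.map_sum_lt _ (pow_ne_zero _ (zero_lt_one.trans hlt).ne') fun i hi ↦ ?_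
    rw [Algebra.smul_def, map_mul, map_pow]
    refine (mul_le_of_le_one_left' (hcoeff i)).trans_lt ?_
    exact pow_lt_pow_right₀ hlt (Finset.mem_range.mp hi)
  rw [eq_neg_of_add_eq_zero_left hc, Valuation.map_neg, map_pow] at hsum
  exact lt_irrefl _ hsum

lemma val_eq_one_of_aeval_eq_zero (w : FinitePlace F) {p : Polynomial E} (hp : p.Monic)
    (hcoeff : ∀ i, w.val (algebraMap E F (p.coeff i)) ≤ 1)
    (hcoeff_zero : w.val (algebraMap E F (p.coeff 0)) = 1) {c : F}
    (hc : Polynomial.aeval c p = 0) : w.val c = 1 := by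
  have hle : w.val c ≤ 1 := w.val_le_one_of_aeval_eq_zero hp hcoeff hc
  have hdivX : Polynomial.aeval c p.divX * c + algebraMap E F (p.coeff 0) = 0 := by
    rw [← hc]
    conv_rhs => rw [← Polynomial.divX_mul_X_add p]
    simp
  have hdivX_le : w.val (Polynomial.aeval c p.divX) ≤ 1 := by
    rw [Polynomial.aeval_eq_sum_range]
    refine Valuation.map_sum_le _ fun i _ ↦ ?_
    rw [Algebra.smul_def, map_mul, map_pow, Polynomial.coeff_divX]
    exact mul_le_one' (hcoeff _) (pow_le_one' hle i)
  refine le_antisymm hle ?_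
  rw [← hcoeff_zero, eq_neg_of_add_eq_zero_right hdivX, Valuation.map_neg, map_mul]
  exact mul_le_of_le_one_left' hdivX_le

variable [FiniteDimensional E F]

/-- The inclusion of the valuation ring of the place below `w` into that of `w`. -/
def ringMap (E : Type*) [Field E] [Algebra E F] [FiniteDimensional E F] (w : FinitePlace F) :
    (w.under E).ring →+* w.ring :=
  (algebraMap E F).restrict _ _ fun _ hx ↦ hx

instance (w : FinitePlace F) : IsLocalHom (w.ringMap E) where
  map_nonunit a ha := ((w.under E).isUnit_iff_val_eq_one a).mpr
    ((val_eq_one_iff_of_comap rfl).mp ((w.isUnit_iff_val_eq_one _).mp ha))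

lemma linearIndependent_of_residue (w : FinitePlace F) {ι : Type*} [Fintype ι] (x : ι → w.ring)
    (h : ∀ c : ι → (w.under E).ring,
      ∑ i, IsLocalRing.ResidueField.map (w.ringMap E) (IsLocalRing.residue _ (c i)) *
        IsLocalRing.residue w.ring (x i) = 0 → ∀ i, IsLocalRing.residue _ (c i) = 0) :
    LinearIndependent E fun i ↦ (x i : F) := by
  by_contra hx
  obtain ⟨c, i, hci, hc⟩ := (w.under E).exists_coeff_eq_one_of_not_linearIndependent hx
  have hsum : ∑ j, w.ringMap E (c j) * x j = 0 := by
    refine Subtype.ext ?_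
    simp only [Algebra.smul_def] at hc
    rw [AddSubmonoidClass.coe_finsetSum]
    exact hc
  refine one_ne_zero (α := IsLocalRing.ResidueField (w.under E).ring) ?_
  rw [← map_one (IsLocalRing.residue _), ← hci]
  refine h c ?_ i
  simpa using congrArg (IsLocalRing.residue w.ring) hsum

lemma finite_residueField_of_under (w : FinitePlace F)
    [Finite (IsLocalRing.ResidueField (w.under E).ring)] :
    Finite (IsLocalRing.ResidueField w.ring) := by
  let _ : Algebra (IsLocalRing.ResidueField (w.under E).ring) (IsLocalRing.ResidueField w.ring) :=
    (IsLocalRing.ResidueField.map (w.ringMap E)).toAlgebra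
  have hrank : Module.rank (IsLocalRing.ResidueField (w.under E).ring)
      (IsLocalRing.ResidueField w.ring) ≤ Module.finrank E F := by
    refine rank_le fun s hs ↦ ?_
    choose x hx using fun i : s ↦ IsLocalRing.residue_surjective (R := w.ring) i.1
    have hli := w.linearIndependent_of_residue (E := E) x fun c hc ↦ by
      refine Fintype.linearIndependent_iff.mp hs _ ?_
      simp only [hx] at hc
      exact (Finset.sum_congr rfl fun i _ ↦ Algebra.smul_def _ _).trans hc
    simpa using hli.fintype_card_le_finrank
  have : Module.Finite (IsLocalRing.ResidueField (w.under E).ring)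
      (IsLocalRing.ResidueField w.ring) :=
    Module.rank_lt_aleph0_iff.mp (hrank.trans_lt (Cardinal.natCast_lt_aleph0))
  exact Module.finite_of_finite (IsLocalRing.ResidueField (w.under E).ring)

end FinitePlace

lemma HasFinitePlaces.of_finiteDimensional [FiniteDimensional E F] (h : HasFinitePlaces E) :
    HasFinitePlaces F where
  finite_val_ne_one c hc := by
    -- `c` is a unit at `w` as soon as the nonzero coefficients of its minimal polynomial are.
    let p := minpoly E c
    have hint : IsIntegral E c := Algebra.IsIntegral.isIntegral c
    let T : Set (FinitePlace E) := ⋃ i ∈ p.support, {v | v.val (p.coeff i) ≠ 1}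
    have hT : T.Finite := Set.Finite.biUnion p.support.finite_toSet fun i hi ↦
      h.finite_val_ne_one _ (Polynomial.mem_support_iff.mp hi)
    have hT' : (⋃ v ∈ T, Set.range fun w : v.Over F ↦ w.1).Finite := hT.biUnion fun v _ ↦ by
      have : Finite (v.Over F) := v.finite_over_of_finiteDimensional
      exact Set.finite_range _
    refine hT'.subset fun w hw ↦ Set.mem_iUnion₂.mpr ⟨w.under E, ?_, ⟨w, rfl⟩, rfl⟩
    by_contra hwT
    have hunit : ∀ i ∈ p.support, w.val (algebraMap E F (p.coeff i)) = 1 := fun i hi ↦ by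
      refine (FinitePlace.val_eq_one_iff_of_comap (v := w.under E) rfl).mpr ?_
      by_contra hne
      exact hwT (Set.mem_iUnion₂.mpr ⟨i, hi, hne⟩)
    refine hw (w.val_eq_one_of_aeval_eq_zero (minpoly.monic hint) (fun i ↦ ?_) ?_
      (minpoly.aeval E c))
    · by_cases hi : i ∈ p.support
      · exact (hunit i hi).le
      · rw [Polynomial.notMem_support_iff.mp hi, map_zero, map_zero]
        exact zero_le
    · exact hunit 0 (Polynomial.mem_support_iff.mpr (minpoly.coeff_zero_ne_zero hint hc))
  finite_residueField w := by
    have := h.finite_residueField (w.under E)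
    exact w.finite_residueField_of_under (E := E)

end Extension

section Base

variable {A E : Type*} [CommRing A] [Field E] [Algebra A E]

namespace FinitePlace

/-- The center on `A` of a place `v` whose valuation ring contains `A`: the prime ideal of the
elements of `A` that are not units at `v`. -/
def center (v : FinitePlace E) (hv : ∀ a : A, algebraMap A E a ∈ v.ring) : Ideal A :=
  (IsLocalRing.maximalIdeal v.ring).comap ((algebraMap A E).codRestrict v.ring.toSubring hv)

lemma mem_center {v : FinitePlace E} {hv : ∀ a : A, algebraMap A E a ∈ v.ring} {a : A} :
    a ∈ v.center hv ↔ v.val (algebraMap A E a) < 1 :=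
  (HeightOneSpectrum.valuation_lt_one_iff_mem (K := E)
    (IsDiscreteValuationRing.maximalIdeal v.ring) ⟨algebraMap A E a, hv a⟩).symm

lemma val_eq_one_of_notMem_center {v : FinitePlace E} {hv : ∀ a : A, algebraMap A E a ∈ v.ring}
    {a : A} (ha : a ∉ v.center hv) : v.val (algebraMap A E a) = 1 :=
  le_antisymm ((v.val_le_one_iff _).mpr (hv a)) (not_lt.mp fun h ↦ ha (mem_center.mpr h))

lemma algebraMap_ne_zero_of_notMem_center {v : FinitePlace E}
    {hv : ∀ a : A, algebraMap A E a ∈ v.ring} {a : A} (ha : a ∉ v.center hv) :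
    algebraMap A E a ≠ 0 := fun h ↦
  ha (by simp [mem_center, h])

instance (v : FinitePlace E) (hv : ∀ a : A, algebraMap A E a ∈ v.ring) : (v.center hv).IsPrime :=
  Ideal.comap_isPrime _ _

variable [IsFractionRing A E]

lemma center_ne_bot (v : FinitePlace E) (hv : ∀ a : A, algebraMap A E a ∈ v.ring) :
    v.center hv ≠ ⊥ := by
  intro h
  have hunit : ∀ a : A, a ≠ 0 → v.val (algebraMap A E a) = 1 := fun a ha ↦
    val_eq_one_of_notMem_center (hv := hv) (by rwa [h, Ideal.mem_bot])
  have : Nontrivial A := (algebraMap A E).domain_nontrivial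
  obtain ⟨π, hπ0, hπ⟩ := v.exists_val_lt_one
  obtain ⟨a, b, hb, rfl⟩ := IsFractionRing.div_surjective (A := A) π
  rw [map_div₀, hunit a (by rintro rfl; simp at hπ0), hunit b (nonZeroDivisors.ne_zero hb),
    div_one] at hπ
  exact lt_irrefl _ hπ

variable [IsDedekindDomain A]

lemma exists_eq_div_of_mem {v : FinitePlace E} (hv : ∀ a : A, algebraMap A E a ∈ v.ring) {x : E}
    (hx : x ∈ v.ring) : ∃ n d : A, d ∉ v.center hv ∧ x = algebraMap A E n / algebraMap A E d := by
  obtain ⟨n, ⟨d, hd⟩, hnd | hnd⟩ := HeightOneSpectrum.exists_primeCompl_mul_eq_or_mul_eq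
    (⟨v.center hv, inferInstance, v.center_ne_bot hv⟩ : HeightOneSpectrum A) x
  · exact ⟨n, d, hd, (eq_div_iff (algebraMap_ne_zero_of_notMem_center hd)).mpr hnd⟩
  · have hn : n ∉ v.center hv := fun hn ↦ by
      have hlt : v.val x * v.val (algebraMap A E n) < 1 :=
        (mul_le_of_le_one_left' ((v.val_le_one_iff x).mpr hx)).trans_lt (mem_center.mp hn)
      rw [← map_mul, hnd, val_eq_one_of_notMem_center (a := d) hd] at hlt
      exact lt_irrefl _ hlt
    exact ⟨d, n, hn, (eq_div_iff (algebraMap_ne_zero_of_notMem_center hn)).mpr hnd⟩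

lemma ring_le_of_center_eq {v v' : FinitePlace E} (hv : ∀ a : A, algebraMap A E a ∈ v.ring)
    (hv' : ∀ a : A, algebraMap A E a ∈ v'.ring) (h : v.center hv = v'.center hv') :
    v.ring ≤ v'.ring := by
  intro x hx
  obtain ⟨n, d, hd, rfl⟩ := exists_eq_div_of_mem hv hx
  rw [h] at hd
  rw [← val_le_one_iff, map_div₀, val_eq_one_of_notMem_center hd, div_one, val_le_one_iff]
  exact hv' n

variable [Ring.HasFiniteQuotients A]

lemma finite_val_algebraMap_lt_one {a : A} (ha : a ≠ 0) :
    {v : FinitePlace E | (∀ b : A, algebraMap A E b ∈ v.ring) ∧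
      v.val (algebraMap A E a) < 1}.Finite := by
  have : Finite (A ⧸ Ideal.span {a}) := Ring.HasFiniteQuotients.finiteQuotient (by simpa using ha)
  have : Finite {I : Ideal A // Ideal.span {a} ≤ I} := by
    refine Finite.of_injective (fun I ↦ I.1.map (Ideal.Quotient.mk (Ideal.span {a}))) fun I J h ↦ ?_
    have hcomap := congrArg (Ideal.comap (Ideal.Quotient.mk (Ideal.span {a}))) h
    simp only [Ideal.comap_map_mk I.2, Ideal.comap_map_mk J.2] at hcomap
    exact Subtype.ext hcomap
  rw [← Set.finite_coe_iff]
  refine Finite.of_injective (fun v ↦ (⟨v.1.center v.2.1, ?_⟩ :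
    {I : Ideal A // Ideal.span {a} ≤ I})) fun v v' h ↦ ?_
  · rw [Ideal.span_singleton_le_iff_mem, mem_center]
    exact v.2.2
  · have hcenter : v.1.center v.2.1 = v'.1.center v'.2.1 := congrArg Subtype.val h
    exact Subtype.ext (FinitePlace.ext (le_antisymm (ring_le_of_center_eq _ _ hcenter)
      (ring_le_of_center_eq _ _ hcenter.symm)))

variable (A) in
lemma finite_val_ne_one_of_algebraMap_mem {c : E} (hc : c ≠ 0) :
    {v : FinitePlace E | (∀ a : A, algebraMap A E a ∈ v.ring) ∧ v.val c ≠ 1}.Finite := by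
  obtain ⟨a, b, hb, rfl⟩ := IsFractionRing.div_surjective (A := A) c
  have ha : a ≠ 0 := by
    rintro rfl
    simp at hc
  refine ((finite_val_algebraMap_lt_one ha).union
    (finite_val_algebraMap_lt_one (nonZeroDivisors.ne_zero hb))).subset ?_
  rintro v ⟨hv, hv1⟩
  by_contra hcon
  rw [Set.mem_union, not_or] at hcon
  refine hv1 ?_
  rw [map_div₀, val_eq_one_of_notMem_center (hv := hv) fun h ↦ hcon.1 ⟨hv, mem_center.mp h⟩,
    val_eq_one_of_notMem_center (hv := hv) fun h ↦ hcon.2 ⟨hv, mem_center.mp h⟩, div_one]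

lemma finite_residueField_of_algebraMap_mem (v : FinitePlace E)
    (hv : ∀ a : A, algebraMap A E a ∈ v.ring) : Finite (IsLocalRing.ResidueField v.ring) := by
  have : Finite (A ⧸ v.center hv) :=
    Ring.HasFiniteQuotients.finiteQuotient (v.center_ne_bot hv)
  let ψ : A →+* IsLocalRing.ResidueField v.ring := (IsLocalRing.residue v.ring).comp
    ((algebraMap A E).codRestrict v.ring.toSubring hv)
  have hψ : ∀ a ∈ v.center hv, ψ a = 0 := fun a ha ↦ (IsLocalRing.residue_eq_zero_iff _).mpr ha
  let χ : A ⧸ v.center hv →+* IsLocalRing.ResidueField v.ring := Ideal.Quotient.lift _ ψ hψ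
  refine Finite.of_surjective (fun p : (A ⧸ v.center hv) × (A ⧸ v.center hv) ↦ χ p.1 / χ p.2)
    fun y ↦ ?_
  obtain ⟨x, rfl⟩ := IsLocalRing.residue_surjective y
  obtain ⟨n, d, hd, hx⟩ := exists_eq_div_of_mem hv x.2
  refine ⟨(Ideal.Quotient.mk _ n, Ideal.Quotient.mk _ d), ?_⟩
  have hd0 : ψ d ≠ 0 := fun h ↦ hd ((IsLocalRing.residue_eq_zero_iff _).mp h)
  have hmul : (⟨algebraMap A E n, hv n⟩ : v.ring) = x * ⟨algebraMap A E d, hv d⟩ :=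
    Subtype.ext ((eq_div_iff (algebraMap_ne_zero_of_notMem_center hd)).mp hx).symm
  exact (div_eq_iff hd0).mpr ((congrArg (IsLocalRing.residue v.ring) hmul).trans (map_mul _ _ _))

end FinitePlace

end Base

section RingHom

variable {A E : Type*} [CommRing A] [IsDedekindDomain A] [Ring.HasFiniteQuotients A] [Field E]

lemma FinitePlace.finite_val_ne_one_of_ringHom_mem (φ : A →+* E) (hinj : Function.Injective φ)
    (hsurj : ∀ x, ∃ a b, x = φ a / φ b) {c : E} (hc : c ≠ 0) :
    {v : FinitePlace E | (∀ a, φ a ∈ v.ring) ∧ v.val c ≠ 1}.Finite := by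
  let _ : Algebra A E := φ.toAlgebra
  have : FaithfulSMul A E := (faithfulSMul_iff_algebraMap_injective _ _).mpr hinj
  have : IsFractionRing A E := IsFractionRing.of_field _ _ hsurj
  exact FinitePlace.finite_val_ne_one_of_algebraMap_mem A hc

lemma FinitePlace.finite_residueField_of_ringHom_mem (φ : A →+* E) (hinj : Function.Injective φ)
    (hsurj : ∀ x, ∃ a b, x = φ a / φ b) (v : FinitePlace E) (hv : ∀ a, φ a ∈ v.ring) :
    Finite (IsLocalRing.ResidueField v.ring) := by
  let _ : Algebra A E := φ.toAlgebra
  have : FaithfulSMul A E := (faithfulSMul_iff_algebraMap_injective _ _).mpr hinj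
  have : IsFractionRing A E := IsFractionRing.of_field _ _ hsurj
  exact v.finite_residueField_of_algebraMap_mem hv

end RingHom

lemma hasFinitePlaces_rat : HasFinitePlaces ℚ where
  finite_val_ne_one c hc := by
    refine (FinitePlace.finite_val_ne_one_of_algebraMap_mem ℤ hc).subset fun v hv ↦ ⟨?_, hv⟩
    exact fun a ↦ by simp
  finite_residueField v := v.finite_residueField_of_algebraMap_mem (A := ℤ) fun a ↦ by simp

instance (F : Type*) [Field F] [Finite F] : Ring.HasFiniteQuotients (Polynomial F) where
  finiteQuotient {I} hI := by
    obtain ⟨f, hf⟩ := IsPrincipalIdealRing.principal I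
    rw [Ideal.submodule_span_eq] at hf
    have hf0 : f ≠ 0 := fun h ↦ hI (by rw [hf, h]; simp)
    subst hf
    have : Module.Finite F (AdjoinRoot f) := (AdjoinRoot.powerBasis hf0).finite
    exact Module.finite_of_finite F (M := AdjoinRoot f)

section RatFunc

open Polynomial

variable (F : Type*) [Field F]

/-- The embedding `F[X] → F(X)` with `X ↦ X⁻¹`, whose image is the second affine chart of the
projective line. -/
def polyInv : F[X] →+* RatFunc F := eval₂RingHom (algebraMap F (RatFunc F)) (RatFunc.X)⁻¹

lemma polyInv_injective : Function.Injective (polyInv F) := by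
  rw [injective_iff_map_eq_zero]
  intro f hf
  have hX : (RatFunc.X : RatFunc F) ≠ 0 := RatFunc.X_ne_zero
  let _ : Invertible (RatFunc.X : RatFunc F)⁻¹ := invertibleOfNonzero (inv_ne_zero hX)
  have hrev : eval₂ (algebraMap F (RatFunc F)) (⅟(RatFunc.X : RatFunc F)⁻¹) f.reverse = 0 :=
    (eval₂_reverse_eq_zero_iff _ _ f).mpr hf
  rw [invOf_eq_inv, inv_inv, ← aeval_def, RatFunc.aeval_X_left_eq_algebraMap,
    FaithfulSMul.algebraMap_eq_zero_iff, reverse_eq_zero] at hrev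
  exact hrev

lemma polyInv_div_surjective (x : RatFunc F) : ∃ a b, x = polyInv F a / polyInv F b := by
  have hX : (RatFunc.X : RatFunc F) ≠ 0 := RatFunc.X_ne_zero
  have hreverse : ∀ f : F[X], algebraMap F[X] (RatFunc F) f =
      polyInv F f.reverse * RatFunc.X ^ f.natDegree := by
    intro f
    let _ : Invertible (RatFunc.X : RatFunc F) := invertibleOfNonzero hX
    have := eval₂_reverse_mul_pow (algebraMap F (RatFunc F)) RatFunc.X f
    rw [invOf_eq_inv, ← aeval_def RatFunc.X, RatFunc.aeval_X_left_eq_algebraMap] at this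
    exact this.symm
  obtain ⟨f, g, hg, rfl⟩ := IsFractionRing.div_surjective (A := F[X]) x
  have hXi : polyInv F X = (RatFunc.X)⁻¹ := by simp [polyInv]
  refine ⟨f.reverse * X ^ g.natDegree, g.reverse * X ^ f.natDegree, ?_⟩
  rw [hreverse, hreverse, map_mul, map_mul, map_pow, map_pow, hXi]
  have hg0 : polyInv F g.reverse ≠ 0 := by
    rw [Ne, map_eq_zero_iff _ (polyInv_injective F), reverse_eq_zero]
    exact nonZeroDivisors.ne_zero hg
  rw [inv_pow, inv_pow]
  field_simp

variable [Finite F]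

lemma algebraMap_mem_ring (v : FinitePlace (RatFunc F)) (c : F) :
    algebraMap F (RatFunc F) c ∈ v.ring := by
  have := Fintype.ofFinite F
  rcases eq_or_ne c 0 with rfl | hc
  · rw [map_zero]
    exact zero_mem _
  rw [← FinitePlace.val_le_one_iff]
  by_contra! h
  have hpow := congrArg (fun c ↦ v.val (algebraMap F (RatFunc F) c))
    (FiniteField.pow_card_sub_one_eq_one c hc)
  simp only [map_pow, map_one] at hpow
  exact (one_lt_pow₀ h (Nat.sub_pos_of_lt Fintype.one_lt_card).ne').ne' hpow

lemma mem_ring_or_polyInv_mem_ring (v : FinitePlace (RatFunc F)) :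
    (∀ f : F[X], algebraMap F[X] (RatFunc F) f ∈ v.ring) ∨ ∀ f : F[X], polyInv F f ∈ v.ring := by
  have heval : ∀ y ∈ v.ring, ∀ f : F[X], eval₂ (algebraMap F (RatFunc F)) y f ∈ v.ring := by
    intro y hy f
    rw [eval₂_eq_sum]
    exact sum_mem fun i _ ↦ mul_mem (algebraMap_mem_ring F v _) (pow_mem hy i)
  rcases v.ring.mem_or_inv_mem RatFunc.X with h | h
  · left
    intro f
    rw [← RatFunc.aeval_X_left_eq_algebraMap]
    exact heval _ h f
  · exact Or.inr (heval _ h)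

lemma hasFinitePlaces_ratFunc : HasFinitePlaces (RatFunc F) := by
  have hinj := polyInv_injective F
  refine ⟨fun c hc ↦ ?_, fun v ↦ ?_⟩
  · refine ((FinitePlace.finite_val_ne_one_of_algebraMap_mem F[X] hc).union
      (FinitePlace.finite_val_ne_one_of_ringHom_mem _ hinj (polyInv_div_surjective F) hc)).subset ?_
    intro v hv
    exact (mem_ring_or_polyInv_mem_ring F v).imp (fun h ↦ ⟨h, hv⟩) (fun h ↦ ⟨h, hv⟩)
  · exact (mem_ring_or_polyInv_mem_ring F v).elim v.finite_residueField_of_algebraMap_mem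
      (v.finite_residueField_of_ringHom_mem _ hinj (polyInv_div_surjective F))

end RatFunc

theorem IsGlobalField.hasFinitePlaces {F : Type*} [Field F] (h : IsGlobalField F) :
    HasFinitePlaces F := by
  obtain h | ⟨p, _, _, _⟩ := h
  · exact hasFinitePlaces_rat.of_finiteDimensional
  · exact (hasFinitePlaces_ratFunc (ZMod p)).of_finiteDimensional

/-! ### Completions -/

namespace FinitePlace

variable {F F' : Type*} [Field F] [Field F']

lemma valued_algebraMap (w : FinitePlace F) (x : F) :
    Valued.v (algebraMap F w.Completion x) = w.val x :=
  HeightOneSpectrum.valuedAdicCompletion_eq_valuation' _ x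

lemma mem_integers_iff (w : FinitePlace F) {x : w.Completion} : x ∈ w.Integers ↔ Valued.v x ≤ 1 :=
  Iff.rfl

lemma algebraMap_mem_integers_iff (w : FinitePlace F) {x : F} :
    algebraMap F w.Completion x ∈ w.Integers ↔ x ∈ w.ring := by
  rw [mem_integers_iff, valued_algebraMap, val_le_one_iff]

lemma exists_valued_sub_le (w : FinitePlace F) (x : w.Completion) {a : w.Completion} (ha : a ≠ 0) :
    ∃ b : F, Valued.v (algebraMap F w.Completion b - x) ≤ Valued.v a := by
  have hopen : IsOpen {y : w.Completion | Valued.v (y - x) ≤ Valued.v a} := by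
    have : {y : w.Completion | Valued.v (y - x) ≤ Valued.v a} =
        (fun y ↦ a⁻¹ * (y - x)) ⁻¹' (w.Integers : Set w.Completion) := by
      ext y
      rw [Set.mem_preimage, SetLike.mem_coe, mem_integers_iff, map_mul, map_inv₀,
        inv_mul_le_one₀ (zero_lt_iff.mpr (by simpa using ha))]
      rfl
    rw [this]
    exact (Valued.isOpen_integer _).preimage (by fun_prop)
  obtain ⟨b, hb⟩ := (HeightOneSpectrum.denseRange_algebraMap F
    (IsDiscreteValuationRing.maximalIdeal w.ring)).exists_mem_open hopen
    ⟨x, by simp⟩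
  exact ⟨b, hb⟩

lemma mem_maximalIdeal_integers_iff (w : FinitePlace F) {x : w.Integers} :
    x ∈ IsLocalRing.maximalIdeal w.Integers ↔ Valued.v (x : w.Completion) < 1 := by
  rw [IsLocalRing.mem_maximalIdeal, mem_nonunits_iff,
    HeightOneSpectrum.adicCompletionIntegers.isUnit_iff_valued_eq_one]
  exact ⟨fun h ↦ lt_of_le_of_ne x.2 h, fun h ↦ h.ne⟩

lemma finite_residueField_integers (w : FinitePlace F)
    [Finite (IsLocalRing.ResidueField w.ring)] :
    Finite (IsLocalRing.ResidueField w.Integers) := by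
  let θ : w.ring →+* IsLocalRing.ResidueField w.Integers :=
    (IsLocalRing.residue w.Integers).comp (algebraMap w.ring w.Integers)
  have hθ : ∀ a ∈ IsLocalRing.maximalIdeal w.ring, θ a = 0 := fun a ha ↦ by
    refine (IsLocalRing.residue_eq_zero_iff _).mpr ((w.mem_maximalIdeal_integers_iff).mpr ?_)
    rw [HeightOneSpectrum.algebraMap_adicCompletionIntegers_apply,
      HeightOneSpectrum.valuedAdicCompletion_eq_valuation']
    exact (HeightOneSpectrum.valuation_lt_one_iff_mem _ _).mpr ha
  refine Finite.of_surjective (α := IsLocalRing.ResidueField w.ring)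
    (Ideal.Quotient.lift (IsLocalRing.maximalIdeal w.ring) θ hθ) fun y ↦ ?_
  obtain ⟨x, rfl⟩ := IsLocalRing.residue_surjective y
  obtain ⟨π, hπ0, hπ⟩ := w.exists_val_lt_one
  obtain ⟨b, hb⟩ := w.exists_valued_sub_le (x : w.Completion)
    (a := algebraMap F w.Completion π) (by simpa using hπ0)
  rw [valued_algebraMap] at hb
  have hb' : b ∈ w.ring := by
    rw [← algebraMap_mem_integers_iff, ← sub_add_cancel (algebraMap F w.Completion b) x]
    exact add_mem ((mem_integers_iff _).mpr (hb.trans hπ.le)) x.2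
  refine ⟨Ideal.Quotient.mk _ ⟨b, hb'⟩, ?_⟩
  rw [Ideal.Quotient.lift_mk]
  refine Ideal.Quotient.eq.mpr ?_
  rw [w.mem_maximalIdeal_integers_iff]
  exact hb.trans_lt hπ

open Valued.integer in
lemma isCompact_integers (w : FinitePlace F) [Finite (IsLocalRing.ResidueField w.ring)] :
    IsCompact (w.Integers : Set w.Completion) := by
  let _ : (Valued.v : Valuation w.Completion ℤᵐ⁰).RankOne :=
    Valuation.IsRankOneDiscrete.rankOne _ (e := 2) one_lt_two
  have hcomplete : CompleteSpace (Valued.integer w.Completion) :=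
    (Valued.isClosed_integer w.Completion).completeSpace_coe
  have hdvr : IsDiscreteValuationRing (Valued.integer w.Completion) :=
    inferInstanceAs (IsDiscreteValuationRing w.Integers)
  have hfinite : Finite (IsLocalRing.ResidueField (Valued.integer w.Completion)) :=
    w.finite_residueField_integers
  rw [isCompact_iff_compactSpace]
  exact compactSpace_iff_completeSpace_and_isDiscreteValuationRing_and_finite_residueField.mpr
    ⟨hcomplete, hdvr, hfinite⟩

lemma completionMap_congr {f g : F →+* F'} (hfg : f = g) {v : FinitePlace F} {w : FinitePlace F'}
    (hf : w.ring.comap f = v.ring) (hg : w.ring.comap g = v.ring) (x : v.Completion) :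
    completionMap f hf x = completionMap g hg x := by
  subst hfg
  rfl

lemma completionMap_mem_integers_iff (f : F →+* F') {v : FinitePlace F} {w : FinitePlace F'}
    (h : w.ring.comap f = v.ring) {x : v.Completion} :
    completionMap f h x ∈ w.Integers ↔ x ∈ v.Integers := by
  refine ⟨fun hx ↦ ?_, completionMap_mem_integers f h⟩
  obtain ⟨b, hb⟩ := v.exists_valued_sub_le x one_ne_zero
  have hbx : algebraMap F v.Completion b - x ∈ v.Integers := by
    simpa [mem_integers_iff] using hb
  have hfb : algebraMap F' w.Completion (f b) ∈ w.Integers := by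
    rw [← completionMap_algebraMap f h, ← sub_add_cancel (algebraMap F v.Completion b) x, map_add]
    exact add_mem (completionMap_mem_integers f h hbx) hx
  rw [algebraMap_mem_integers_iff, ← ValuationSubring.mem_comap, h,
    ← algebraMap_mem_integers_iff] at hfb
  simpa using sub_mem hfb hbx

end FinitePlace

/-! ### The algebra `∏_{w ∣ v} K_w` -/

namespace FinitePlace

variable {F F' : Type*} [Field F] [Field F']

lemma valued_completionMap_le_iff (f : F →+* F') {v : FinitePlace F} {w : FinitePlace F'}
    (h : w.ring.comap f = v.ring) {x : v.Completion} {a : F} (ha : a ≠ 0) :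
    Valued.v (completionMap f h x) ≤ w.val (f a) ↔ Valued.v x ≤ v.val a := by
  have hmem := completionMap_mem_integers_iff f h (x := x / algebraMap F v.Completion a)
  rwa [map_div₀, completionMap_algebraMap, mem_integers_iff, mem_integers_iff, map_div₀, map_div₀,
    valued_algebraMap, valued_algebraMap, div_le_one₀ (zero_lt_iff.mpr (by simpa using ha)),
    div_le_one₀ (zero_lt_iff.mpr (by simpa using ha))] at hmem

lemma mem_maximalIdeal_of_one_lt_val (v : FinitePlace F) {a : F} (ha : 1 < v.val a) :
    ∃ b ∈ IsLocalRing.maximalIdeal v.ring, (b : F) = a⁻¹ := by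
  have hlt : v.val a⁻¹ < 1 := by rw [map_inv₀]; exact inv_lt_one_of_one_lt₀ ha
  exact ⟨⟨a⁻¹, (v.val_le_one_iff _).mp hlt.le⟩,
    (HeightOneSpectrum.valuation_lt_one_iff_mem (K := F)
      (IsDiscreteValuationRing.maximalIdeal v.ring) ⟨a⁻¹, _⟩).mp hlt, rfl⟩

lemma comap_valuationSubring_eq {K B : Type*} [Field K] [CommRing B] [IsDedekindDomain B]
    [Algebra B K] [IsFractionRing B K] (v : FinitePlace F) [Algebra v.ring B] {f : F →+* K}
    (hf : ∀ a : v.ring, algebraMap B K (algebraMap v.ring B a) = f a) (Q : HeightOneSpectrum B)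
    (hQ : IsLocalRing.maximalIdeal v.ring ≤ Q.asIdeal.comap (algebraMap v.ring B)) :
    (Q.valuation K).valuationSubring.comap f = v.ring := by
  refine SetLike.ext fun a ↦ ⟨fun h ↦ ?_, fun h ↦ ?_⟩
  · by_contra ha
    rw [← val_le_one_iff, not_le] at ha
    obtain ⟨b, hb, hba⟩ := v.mem_maximalIdeal_of_one_lt_val ha
    have hlt : Q.valuation K (algebraMap B K _) < 1 := (Q.valuation_lt_one_iff_mem _).mpr (hQ hb)
    rw [hf, hba, map_inv₀, map_inv₀] at hlt
    have ha0 : a ≠ 0 := by rintro rfl; simp at ha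
    exact ((inv_lt_one₀ (zero_lt_iff.mpr (by simpa using ha0))).mp hlt).not_ge h
  · have hle : Q.valuation K (algebraMap B K (algebraMap v.ring B ⟨a, h⟩)) ≤ 1 :=
      Q.valuation_le_one _
    rw [hf] at hle
    exact hle

lemma nonempty_over {k : Type*} (K : Type*) [Field k] [Field K] [Algebra k K]
    [FiniteDimensional k K] [Algebra.IsSeparable k K] (v : FinitePlace k) :
    Nonempty (v.Over K) := by
  let B := integralClosure v.ring K
  have : IsDedekindDomain B := integralClosure.isDedekindDomain v.ring k K
  have : IsFractionRing B K := integralClosure.isFractionRing_of_finite_extension k K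
  have hinj : Function.Injective (algebraMap v.ring B) := fun a b hab ↦
    Subtype.ext ((algebraMap k K).injective (congrArg Subtype.val hab))
  have : FaithfulSMul v.ring B := (faithfulSMul_iff_algebraMap_injective _ _).mpr hinj
  have : Module.IsTorsionFree v.ring B :=
    (Module.isTorsionFree_iff_algebraMap_injective).mpr hinj
  have : Algebra.IsIntegral v.ring B := integralClosure.AlgebraIsIntegral
  obtain ⟨P, hP⟩ : Nonempty ((IsLocalRing.maximalIdeal v.ring).primesOver B) := inferInstance
  let Q : HeightOneSpectrum B := ⟨P, hP.1, Ideal.ne_bot_of_mem_primesOver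
    (IsDiscreteValuationRing.not_a_field v.ring) hP⟩
  exact ⟨⟨⟨(Q.valuation K).valuationSubring, inferInstance⟩, FinitePlace.ext <|
    v.comap_valuationSubring_eq (K := K) (B := B) (fun _ ↦ rfl) Q hP.2.over.le⟩⟩

end FinitePlace

variable {k : Type*} [Field k]

/-- The ring `∏_{w ∣ v} K_w`. -/
def LocalAlg (v : FinitePlace k) (K : Type*) [Field K] [Algebra k K] [FiniteDimensional k K] :
    Type _ :=
  (w : v.Over K) → w.1.Completion

variable {v : FinitePlace k} {K : Type*} [Field K] [Algebra k K] [FiniteDimensional k K]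

namespace LocalAlg

instance : CommRing (LocalAlg v K) :=
  inferInstanceAs (CommRing ((w : v.Over K) → w.1.Completion))

instance : TopologicalSpace (LocalAlg v K) :=
  inferInstanceAs (TopologicalSpace ((w : v.Over K) → w.1.Completion))

instance : IsTopologicalRing (LocalAlg v K) :=
  inferInstanceAs (IsTopologicalRing ((w : v.Over K) → w.1.Completion))

instance : T2Space (LocalAlg v K) :=
  inferInstanceAs (T2Space ((w : v.Over K) → w.1.Completion))

/-- The projection to a factor. -/
def proj (w : v.Over K) : LocalAlg v K →+* w.1.Completion :=
  Pi.evalRingHom (fun w : v.Over K ↦ w.1.Completion) w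

lemma continuous_proj (w : v.Over K) : Continuous (proj w) := continuous_apply w

@[ext]
lemma ext {x y : LocalAlg v K} (h : ∀ w, proj w x = proj w y) : x = y := funext h

instance : MulSemiringAction (K ≃ₐ[k] K) (LocalAlg v K) where
  smul σ x := fun w ↦
    FinitePlace.completionMap (v := (w.twist σ).1) (w := w.1) (σ : K →+* K) rfl (x (w.twist σ))
  one_smul x := by
    funext w
    exact FinitePlace.completionMap_id rfl _
  mul_smul σ τ x := by
    funext w
    exact FinitePlace.completionMap_comp (u := ((w.twist σ).twist τ).1)
      (v := (w.twist σ).1) (w := w.1) (τ : K →+* K) (σ : K →+* K) rfl rfl rfl _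
  smul_zero σ := by
    funext w
    exact map_zero _
  smul_add σ x y := by
    funext w
    exact map_add _ _ _
  smul_one σ := by
    funext w
    exact map_one _
  smul_mul σ x y := by
    funext w
    exact map_mul _ _ _

lemma proj_smul (σ : K ≃ₐ[k] K) (x : LocalAlg v K) (w : v.Over K) :
    proj w (σ • x) = FinitePlace.completionMap (v := (w.twist σ).1) (w := w.1) (σ : K →+* K) rfl
      (proj (w.twist σ) x) := rfl

instance : ContinuousConstSMul (K ≃ₐ[k] K) (LocalAlg v K) where
  continuous_const_smul σ := continuous_pi fun w ↦
    (FinitePlace.continuous_completionMap (v := (w.twist σ).1) (w := w.1) (σ : K →+* K) rfl).comp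
      (continuous_apply (w.twist σ))

variable (v K) in
/-- The diagonal embedding of `K`. -/
def diag : K →+* LocalAlg v K :=
  RingHom.pi fun w : v.Over K ↦ algebraMap K w.1.Completion

lemma proj_diag (w : v.Over K) (x : K) : proj w (diag v K x) = algebraMap K w.1.Completion x := rfl

lemma smul_diag (σ : K ≃ₐ[k] K) (x : K) : σ • diag v K x = diag v K (σ x) := by
  refine LocalAlg.ext fun w ↦ ?_
  exact FinitePlace.completionMap_algebraMap (v := (w.twist σ).1) (w := w.1) (σ : K →+* K) rfl x

variable (v K) in
/-- The diagonal embedding of `K`, as an equivariant homomorphism. -/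
def diagHom : K →+*[K ≃ₐ[k] K] LocalAlg v K :=
  { diag v K with map_smul' := fun σ x ↦ (smul_diag σ x).symm }

variable (v K) in
/-- The diagonal embedding of `k_v`. -/
def ofBase : v.Completion →+* LocalAlg v K :=
  RingHom.pi fun w : v.Over K ↦ FinitePlace.completionMap (algebraMap k K) w.comap_ring

lemma proj_ofBase (w : v.Over K) (x : v.Completion) :
    proj w (ofBase v K x) = FinitePlace.completionMap (algebraMap k K) w.comap_ring x := rfl

lemma continuous_ofBase : Continuous (ofBase v K) :=
  continuous_pi fun w ↦ FinitePlace.continuous_completionMap (algebraMap k K) w.comap_ring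

lemma ofBase_algebraMap (x : k) :
    ofBase v K (algebraMap k v.Completion x) = diag v K (algebraMap k K x) := by
  refine LocalAlg.ext fun w ↦ ?_
  exact FinitePlace.completionMap_algebraMap (algebraMap k K) w.comap_ring x

lemma smul_ofBase (σ : K ≃ₐ[k] K) (x : v.Completion) : σ • ofBase v K x = ofBase v K x := by
  refine LocalAlg.ext fun w ↦ ?_
  rw [proj_smul, proj_ofBase, proj_ofBase,
    ← FinitePlace.completionMap_comp (u := v) (v := (w.twist σ).1) (w := w.1) (algebraMap k K)
      (σ : K →+* K) (w.twist σ).comap_ring rfl]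
  · exact FinitePlace.completionMap_congr (RingHom.ext fun x ↦ σ.commutes x) _ _ _
  · refine SetLike.ext fun x ↦ ?_
    change σ (algebraMap k K x) ∈ w.1.ring ↔ _
    rw [σ.commutes, ← w.comap_ring]
    rfl

variable (v K) in
/-- The ring `∏_{w ∣ v} 𝒪_w`. -/
def integers : Subring (LocalAlg v K) where
  carrier := {x | ∀ w, proj w x ∈ w.1.Integers}
  mul_mem' ha hb w := mul_mem (ha w) (hb w)
  one_mem' w := one_mem w.1.Integers
  add_mem' ha hb w := add_mem (ha w) (hb w)
  zero_mem' w := zero_mem w.1.Integers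
  neg_mem' ha w := neg_mem (ha w)

lemma smul_mem_integers (σ : K ≃ₐ[k] K) {x : LocalAlg v K} (hx : x ∈ integers v K) :
    σ • x ∈ integers v K := fun w ↦
  FinitePlace.completionMap_mem_integers (v := (w.twist σ).1) (w := w.1) (σ : K →+* K) rfl
    (hx (w.twist σ))

lemma coe_integers : (integers v K : Set (LocalAlg v K)) =
    Set.univ.pi fun w : v.Over K ↦ (w.1.Integers : Set w.1.Completion) :=
  Set.ext fun _ ↦ ⟨fun h w _ ↦ h w, fun h w ↦ h w trivial⟩

lemma isOpen_integers : IsOpen (integers v K : Set (LocalAlg v K)) := by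
  have : Finite (v.Over K) := v.finite_over_of_finiteDimensional
  rw [coe_integers]
  exact isOpen_set_pi Set.finite_univ fun w _ ↦ Valued.isOpen_integer _

lemma isCompact_integers [Finite (IsLocalRing.ResidueField v.ring)] :
    IsCompact (integers v K : Set (LocalAlg v K)) := by
  rw [coe_integers]
  refine isCompact_univ_pi fun w ↦ ?_
  have : Finite (IsLocalRing.ResidueField (w.1.under k).ring) := by rwa [w.2]
  have := w.1.finite_residueField_of_under (E := k)
  exact w.1.isCompact_integers

lemma exists_pow_mul_diag_mem {π : k} (hπ : v.val π < 1) (x : K) :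
    ∃ n : ℕ, diag v K (algebraMap k K π ^ n * x) ∈ integers v K := by
  have : Finite (v.Over K) := v.finite_over_of_finiteDimensional
  have := Fintype.ofFinite (v.Over K)
  have hex : ∀ w : v.Over K, ∃ n : ℕ, w.1.val (algebraMap k K π ^ n * x) ≤ 1 := by
    intro w
    rcases eq_or_ne x 0 with rfl | hx
    · exact ⟨0, by simp⟩
    have hx' : (w.1.val x)⁻¹ ≠ 0 := by simpa using hx
    obtain ⟨n, hn⟩ := exists_pow_lt₀ (w.val_lt_one_iff.mpr hπ) (Units.mk0 _ hx')
    refine ⟨n, ?_⟩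
    rw [map_mul, map_pow]
    exact (mul_le_mul_left hn.le _).trans (by
      rw [Units.val_mk0, inv_mul_cancel₀ (by simpa using hx)])
  choose n hn using hex
  refine ⟨Finset.univ.sup n, fun w ↦ ?_⟩
  rw [proj_diag, FinitePlace.mem_integers_iff, FinitePlace.valued_algebraMap]
  obtain ⟨d, hd⟩ := Nat.exists_eq_add_of_le (Finset.le_sup (f := n) (Finset.mem_univ w))
  rw [hd, add_comm, pow_add, mul_assoc, map_mul, map_pow]
  exact mul_le_one' (pow_le_one' (w.val_lt_one_iff.mpr hπ).le _) (hn w)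

variable (v K) in
/-- The subgroup `a ∏_{w ∣ v} 𝒪_w`. -/
def ball (a : k) : AddSubgroup (LocalAlg v K) where
  carrier := {x | ∀ w, Valued.v (proj w x) ≤ w.1.val (algebraMap k K a)}
  zero_mem' w := by simp
  add_mem' {x y} hx hy w := by
    rw [map_add]
    exact Valuation.map_add_le _ (hx w) (hy w)
  neg_mem' {x} hx w := by
    rw [map_neg, Valuation.map_neg]
    exact hx w

lemma mem_ball {a : k} {x : LocalAlg v K} :
    x ∈ ball v K a ↔ ∀ w, Valued.v (proj w x) ≤ w.1.val (algebraMap k K a) := Iff.rfl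

lemma mem_ball_one {x : LocalAlg v K} : x ∈ ball v K 1 ↔ x ∈ integers v K := by
  simp only [mem_ball, map_one]
  exact Iff.rfl

lemma mul_mem_ball {a b : k} {x y : LocalAlg v K} (hx : x ∈ ball v K a) (hy : y ∈ ball v K b) :
    x * y ∈ ball v K (a * b) := fun w ↦ by
  rw [map_mul, map_mul, map_mul, map_mul]
  exact mul_le_mul' (hx w) (hy w)

lemma ofBase_mem_ball_iff [Nonempty (v.Over K)] {a : k} (ha : a ≠ 0) {x : v.Completion} :
    ofBase v K x ∈ ball v K a ↔ Valued.v x ≤ v.val a := by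
  rw [mem_ball]
  simp only [proj_ofBase, FinitePlace.valued_completionMap_le_iff _ _ ha, forall_const]

lemma diag_mem_ball (a : k) : diag v K (algebraMap k K a) ∈ ball v K a := fun w ↦
  (w.1.valued_algebraMap _).le

lemma ball_anti {a b : k} (h : v.val b ≤ v.val a) : ball v K b ≤ ball v K a := fun _ hx w ↦
  (hx w).trans (w.val_le_val_iff.mpr h)

lemma smul_mem_ball {a : k} (ha : a ≠ 0) (σ : K ≃ₐ[k] K) {x : LocalAlg v K}
    (hx : x ∈ ball v K a) : σ • x ∈ ball v K a := fun w ↦ by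
  rw [proj_smul, ← σ.commutes]
  exact (FinitePlace.valued_completionMap_le_iff (v := (w.twist σ).1) (w := w.1) (σ : K →+* K) rfl
    (by simpa using ha)).mpr (hx (w.twist σ))

lemma isClosed_ball {a : k} (ha : a ≠ 0) : IsClosed (ball v K a : Set (LocalAlg v K)) := by
  have : (ball v K a : Set (LocalAlg v K)) = ⋂ w : v.Over K,
      (fun x ↦ (algebraMap K w.1.Completion (algebraMap k K a))⁻¹ * proj w x) ⁻¹'
        (w.1.Integers : Set w.1.Completion) := by
    ext x
    rw [Set.mem_iInter]
    refine forall_congr' fun w ↦ ?_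
    rw [Set.mem_preimage, SetLike.mem_coe, FinitePlace.mem_integers_iff, map_mul, map_inv₀,
      FinitePlace.valued_algebraMap, inv_mul_le_one₀ (zero_lt_iff.mpr (by simpa using ha))]
  rw [this]
  refine isClosed_iInter fun w ↦ (Valued.isClosed_integer _).preimage ?_
  exact continuous_const.mul (continuous_proj w)

lemma eq_zero_of_forall_mem_ball {π : k} (hπ : v.val π < 1) {x : LocalAlg v K}
    (hx : ∀ n : ℕ, x ∈ ball v K (π ^ n)) : x = 0 := by
  refine LocalAlg.ext fun w ↦ ?_
  rw [map_zero]
  by_contra h0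
  obtain ⟨n, hn⟩ := exists_pow_lt₀ (w.val_lt_one_iff.mpr hπ)
    (Units.mk0 (Valued.v (proj w x)) (by simpa using h0))
  have := hx n w
  rw [map_pow, map_pow] at this
  exact hn.not_ge this

lemma exists_diag_sub_mem_ball {T : Set (FinitePlace k)} (hT : T.Finite)
    {T' : Set (InfinitePlace K)} (hT' : T'.Finite) (x : ∀ v, LocalAlg v K) (a : FinitePlace k → k)
    (ha : ∀ v, a v ≠ 0) (y : InfinitePlace K → K) :
    ∃ b : K, (∀ v ∈ T, diag v K b - x v ∈ ball v K (a v)) ∧ ∀ w ∈ T', w (b - y w) < 1 := by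
  have hfin : {w : FinitePlace K | w.under k ∈ T}.Finite := by
    refine (hT.biUnion (t := fun v ↦ Set.range fun w : v.Over K ↦ w.1) fun v _ ↦ ?_).subset ?_
    · have := v.finite_over_of_finiteDimensional (K := K)
      exact Set.finite_range _
    · intro w hw
      exact Set.mem_biUnion hw ⟨⟨w, rfl⟩, rfl⟩
  have hex : ∀ w : FinitePlace K, ∃ b : K, Valued.v (algebraMap K w.Completion b -
      proj ⟨w, rfl⟩ (x (w.under k))) ≤ w.val (algebraMap k K (a (w.under k))) := by
    intro w
    obtain ⟨b, hb⟩ := w.exists_valued_sub_le (proj ⟨w, rfl⟩ (x (w.under k)))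
      (a := algebraMap K w.Completion (algebraMap k K (a (w.under k)))) (by simpa using ha _)
    exact ⟨b, by rwa [FinitePlace.valued_algebraMap] at hb⟩
  choose x' hx' using hex
  obtain ⟨b, hb, hb'⟩ := exists_approx hfin hT' x' (fun w ↦ algebraMap k K (a (w.under k)))
    (fun w _ ↦ by simpa using ha _) y
  refine ⟨b, fun v hv ↦ ?_, hb'⟩
  rintro ⟨w, rfl⟩
  have hbx' := hb w hv
  rw [← FinitePlace.valued_algebraMap, map_sub] at hbx'
  have hbx := Valuation.map_add_le _ hbx'.le (hx' w)
  rwa [sub_add_sub_cancel] at hbx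

lemma exists_diag_sub_mem (x : LocalAlg v K) {a : k} (ha : a ≠ 0) :
    ∃ b : K, diag v K b - x ∈ ball v K a := by
  classical
  obtain ⟨b, hb, -⟩ := exists_diag_sub_mem_ball (K := K) (Set.finite_singleton v)
    (T' := ∅) Set.finite_empty (fun v' ↦ if h : v' = v then h ▸ x else 0) (fun _ ↦ a)
    (fun _ ↦ ha) 0
  exact ⟨b, by simpa using hb v rfl⟩

lemma exists_pow_mul_mem {π : k} (hπ : v.val π < 1) (x : LocalAlg v K) :
    ∃ n : ℕ, diag v K (algebraMap k K π ^ n) * x ∈ integers v K := by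
  obtain ⟨b, hb⟩ := exists_diag_sub_mem x (one_ne_zero (α := k))
  obtain ⟨n, hn⟩ := exists_pow_mul_diag_mem hπ b
  refine ⟨n, ?_⟩
  rw [mem_ball_one] at hb
  have hπ' : diag v K (algebraMap k K π ^ n) ∈ integers v K := by
    rw [← map_pow, ← mem_ball_one]
    refine ball_anti ?_ (diag_mem_ball (π ^ n))
    rw [map_one, map_pow]
    exact pow_le_one' hπ.le n
  have : diag v K (algebraMap k K π ^ n) * x = diag v K (algebraMap k K π ^ n * b) -
      diag v K (algebraMap k K π ^ n) * (diag v K b - x) := by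
    rw [map_mul]
    ring
  rw [this]
  exact sub_mem hn (mul_mem hπ' hb)

section Galois

variable [IsGalois k K]

lemma diag_trace_mul_sub {x : LocalAlg v K} (hx : ∀ σ : K ≃ₐ[k] K, σ • x = x) {t : K}
    (ht : Algebra.trace k K t = 1) (b : K) :
    diag v K (algebraMap k K (Algebra.trace k K (t * b))) - x =
      ∑ σ : K ≃ₐ[k] K, σ • (diag v K t * (diag v K b - x)) := by
  have hdiag (s : K) : diag v K (algebraMap k K (Algebra.trace k K s)) =
      ∑ σ : K ≃ₐ[k] K, σ • diag v K s := by
    simp only [smul_diag, trace_eq_sum_automorphisms, map_sum]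
  have hxt : x = ∑ σ : K ≃ₐ[k] K, σ • (diag v K t * x) := by
    simp only [smul_mul', hx]
    rw [← Finset.sum_mul, ← hdiag, ht, map_one, map_one, one_mul]
  conv_lhs => rw [hxt, hdiag, ← Finset.sum_sub_distrib]
  simp only [← smul_sub, map_mul, mul_sub]

lemma exists_algebraMap_sub_mem {x : LocalAlg v K} (hx : ∀ σ : K ≃ₐ[k] K, σ • x = x) {a : k}
    (ha : a ≠ 0) : ∃ c : k, diag v K (algebraMap k K c) - x ∈ ball v K a := by
  obtain ⟨t, ht⟩ := Algebra.trace_surjective k K 1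
  obtain ⟨π, hπ0, hπ⟩ := v.exists_val_lt_one
  obtain ⟨n, hn⟩ := exists_pow_mul_diag_mem hπ t
  obtain ⟨b, hb⟩ := exists_diag_sub_mem x (mul_ne_zero (pow_ne_zero n hπ0) ha)
  have htb : diag v K t * (diag v K b - x) ∈ ball v K a := by
    have hball := mul_mem_ball (mem_ball_one.mpr hn)
      (mul_mem_ball (diag_mem_ball (π ^ n)⁻¹) hb)
    rw [one_mul, inv_mul_cancel_left₀ (pow_ne_zero n hπ0), ← mul_assoc, ← map_mul] at hball
    convert hball using 4
    simp only [map_inv₀, map_pow]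
    field_simp [(map_ne_zero (algebraMap k K)).mpr hπ0]
  refine ⟨Algebra.trace k K (t * b), ?_⟩
  rw [diag_trace_mul_sub hx ht]
  exact sum_mem fun σ _ ↦ smul_mem_ball ha σ htb

lemma ofBase_injective : Function.Injective (ofBase v K) := by
  obtain ⟨w⟩ := v.nonempty_over K
  intro x y h
  exact (FinitePlace.completionMap (algebraMap k K) w.comap_ring).injective
    (congrArg (proj w) h)

lemma cauchySeq_of_ofBase_sub_mem_ball {π : k} (hπ0 : π ≠ 0) (hπ : v.val π < 1) {x : LocalAlg v K}
    {y : ℕ → v.Completion} (hy : ∀ n, ofBase v K (y n) - x ∈ ball v K (π ^ n)) : CauchySeq y := by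
  have := v.nonempty_over K
  refine Valued.cauchy_iff.mpr ⟨inferInstance, fun γ ↦ ?_⟩
  obtain ⟨n, hn⟩ := exists_pow_lt₀ hπ
    (Units.map MonoidWithZeroHom.ValueGroup₀.embedding.toMonoidHom γ)
  have hsub (i : ℕ) (hi : n ≤ i) : ofBase v K (y i) - x ∈ ball v K (π ^ n) :=
    ball_anti (by simpa only [map_pow] using pow_le_pow_right_of_le_one' hπ.le hi) (hy i)
  refine ⟨y '' Set.Ici n, Filter.image_mem_map (Filter.Ici_mem_atTop n), ?_⟩
  rintro _ ⟨i, hi, rfl⟩ _ ⟨j, hj, rfl⟩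
  refine (Valuation.restrict_lt_iff_lt_embedding _).mpr (lt_of_le_of_lt ?_ hn)
  rw [← map_pow, ← ofBase_mem_ball_iff (K := K) (pow_ne_zero n hπ0), map_sub,
    ← sub_sub_sub_cancel_right _ _ x]
  exact sub_mem (hsub j hj) (hsub i hi)

theorem exists_ofBase_eq {x : LocalAlg v K} (hx : ∀ σ : K ≃ₐ[k] K, σ • x = x) :
    ∃ y, ofBase v K y = x := by
  obtain ⟨π, hπ0, hπ⟩ := v.exists_val_lt_one
  choose c hc using fun n : ℕ ↦ exists_algebraMap_sub_mem hx (pow_ne_zero n hπ0)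
  simp only [← ofBase_algebraMap] at hc
  obtain ⟨y, hy⟩ := cauchySeq_tendsto_of_complete (cauchySeq_of_ofBase_sub_mem_ball hπ0 hπ hc)
  refine ⟨y, sub_eq_zero.mp (eq_zero_of_forall_mem_ball hπ fun n ↦ ?_)⟩
  refine (isClosed_ball (pow_ne_zero n hπ0)).mem_of_tendsto
    (((continuous_ofBase.tendsto y).comp hy).sub_const x) ?_
  filter_upwards [Filter.eventually_ge_atTop n] with i hi
  exact ball_anti (by simpa only [map_pow] using pow_le_pow_right_of_le_one' hπ.le hi) (hc i)

lemma exists_normalLattice [Finite (IsLocalRing.ResidueField v.ring)] :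
    ∃ D : NormalLattice (K ≃ₐ[k] K) (LocalAlg v K), D.O = integers v K ∧
      ∀ a : k, a ≠ 0 → ∃ n, D.ball n ≤ ball v K a := by
  obtain ⟨π, hπ0, hπ⟩ := v.exists_val_lt_one
  obtain ⟨B⟩ := nonempty_dualNormalBasis k K
  obtain ⟨n, hn⟩ := exists_pow_mul_diag_mem (K := K) hπ B.α
  let ϖ : Kˣ := Units.mk0 (algebraMap k K π) (by simpa using hπ0)
  let B' := B.rescale (ϖ ^ n) fun σ ↦ by simp [ϖ]
  obtain ⟨c, hc⟩ := exists_pow_mul_diag_mem hπ B'.β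
  have hF {i : ℕ} {y : LocalAlg v K} (hy : y ∈ integers v K) :
      diag v K (algebraMap k K π) ^ i * y ∈ ball v K (π ^ i) := by
    simpa using mul_mem_ball (diag_mem_ball (π ^ i)) (mem_ball_one.mpr hy)
  refine ⟨{
    B'.map (diagHom v K) with
    O := integers v K
    smul_mem := fun g _ hx ↦ smul_mem_integers g hx
    isCompact := isCompact_integers
    isOpen := isOpen_integers
    ϖ := Units.map (diag v K).toMonoidHom ϖ
    ϖ_mem := mem_ball_one.mp (ball_anti (by rw [map_one]; exact hπ.le) (diag_mem_ball π))
    smul_ϖ := fun g ↦ (smul_diag g _).trans (congrArg (diag v K) (g.commutes π))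
    separated := fun x hx ↦ eq_zero_of_forall_mem_ball hπ fun i ↦ by
      obtain ⟨y, hy, rfl⟩ := hx i
      exact hF hy
    α_mem := hn
    c := c
    β_mem := by rw [map_mul, map_pow] at hc; exact hc }, rfl, fun a ha ↦ ?_⟩
  obtain ⟨i, hi⟩ := exists_pow_lt₀ hπ (Units.mk0 (v.val a) (by simpa using ha))
  refine ⟨i, ?_⟩
  rintro _ ⟨y, hy, rfl⟩
  exact ball_anti (by rw [map_pow]; exact hi.le) (hF hy)

end Galois

end LocalAlg

/-! ### Norms and Hilbert 90 for `∏_{w ∣ v} K_w` -/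

lemma det_blockDiagonal' {R ι : Type*} [CommRing R] [Fintype ι] [DecidableEq ι] {n : ι → Type*}
    [∀ i, Fintype (n i)] [∀ i, DecidableEq (n i)] (d : ∀ i, Matrix (n i) (n i) R) :
    (Matrix.blockDiagonal' d).det = ∏ i, (d i).det := by
  let _ : LinearOrder ι := LinearOrder.lift' (Fintype.equivFin ι) (Fintype.equivFin ι).injective
  rw [(Matrix.blockTriangular_blockDiagonal' d).det_fintype]
  refine Finset.prod_congr rfl fun i _ ↦ ?_
  let e : n i ≃ {a : Σ i, n i // a.1 = i} :=
    { toFun := fun a ↦ ⟨⟨i, a⟩, rfl⟩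
      invFun := fun a ↦ a.2 ▸ a.1.2
      left_inv := fun a ↦ rfl
      right_inv := by rintro ⟨⟨j, a⟩, rfl⟩; rfl }
  rw [← Matrix.det_submatrix_equiv_self e]
  congr 1
  ext a b
  exact Matrix.blockDiagonal'_apply_eq d i a b

lemma norm_pi {F ι : Type*} [CommRing F] [Fintype ι] {L : ι → Type*} [∀ i, CommRing (L i)]
    [∀ i, Algebra F (L i)] [∀ i, Module.Free F (L i)] [∀ i, Module.Finite F (L i)]
    (x : ∀ i, L i) : Algebra.norm F x = ∏ i, Algebra.norm F (x i) := by
  classical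
  let b := fun i ↦ Module.Free.chooseBasis F (L i)
  rw [Algebra.norm_eq_matrix_det (Pi.basis b)]
  simp_rw [fun i ↦ Algebra.norm_eq_matrix_det (b i) (x i)]
  rw [← det_blockDiagonal']
  congr 1
  ext ⟨i, p⟩ ⟨j, q⟩
  rw [Algebra.leftMulMatrix_eq_repr_mul, Pi.basis_repr, Pi.basis_apply]
  rcases eq_or_ne i j with rfl | h
  · rw [Matrix.blockDiagonal'_apply_eq, Algebra.leftMulMatrix_eq_repr_mul]
    simp
  · rw [Matrix.blockDiagonal'_apply_ne _ _ _ h]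
    simp [h]

lemma norm_pi_of_field {F ι : Type*} [Field F] [Fintype ι] {L : ι → Type*} [∀ i, Field (L i)]
    [∀ i, Algebra F (L i)] [Module.Finite F (∀ i, L i)] (x : ∀ i, L i) :
    Algebra.norm F x = ∏ i, Algebra.norm F (x i) := by
  have (i : ι) : Module.Finite F (L i) :=
    .of_surjective (LinearMap.proj (φ := L) i) (Function.surjective_eval i)
  exact norm_pi x

namespace LocalUnits

variable {k : Type*} [Field k] {v : FinitePlace k} {K : Type*} [Field K] [Algebra k K]
  [FiniteDimensional k K]

/-- The inclusion `∏_{w ∣ v} K_wˣ → ∏_{w ∣ v} K_w`. -/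
def coe : LocalUnits v K →*[K ≃ₐ[k] K] LocalAlg v K where
  toFun x w := (x w : w.1.Completion)
  map_one' := rfl
  map_mul' _ _ := rfl
  map_smul' _ _ := rfl

lemma proj_coe (x : LocalUnits v K) (w : v.Over K) : LocalAlg.proj w (coe x) = x w := rfl

lemma coe_injective : Function.Injective (coe : LocalUnits v K →*[K ≃ₐ[k] K] LocalAlg v K) :=
  fun _ _ h ↦ funext fun w ↦ Units.ext (congrFun h w)

end LocalUnits

namespace LocalAlg

variable {k : Type*} [Field k] {v : FinitePlace k} {K : Type*} [Field K] [Algebra k K]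
  [FiniteDimensional k K]

/-- `K_w` as an algebra over `k_v`. -/
@[reducible]
def completionAlgebra (w : v.Over K) : Algebra v.Completion w.1.Completion :=
  (FinitePlace.completionMap (algebraMap k K) w.comap_ring).toAlgebra

attribute [local instance] completionAlgebra

instance : Algebra v.Completion (LocalAlg v K) :=
  inferInstanceAs (Algebra v.Completion ((w : v.Over K) → w.1.Completion))

lemma algebraMap_eq : algebraMap v.Completion (LocalAlg v K) = ofBase v K := rfl

instance : SMulCommClass (K ≃ₐ[k] K) v.Completion (LocalAlg v K) where
  smul_comm σ y x := by
    rw [Algebra.smul_def, Algebra.smul_def, smul_mul', algebraMap_eq, smul_ofBase]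

variable [IsGalois k K]

instance : FaithfulSMul v.Completion (LocalAlg v K) :=
  (faithfulSMul_iff_algebraMap_injective _ _).mpr ofBase_injective

instance : Algebra.IsInvariant v.Completion (LocalAlg v K) (K ≃ₐ[k] K) where
  isInvariant _ hx := exists_ofBase_eq hx

lemma ofBase_norm (x : LocalAlg v K) :
    ofBase v K (Algebra.norm v.Completion x) = ∏ σ : K ≃ₐ[k] K, σ • x :=
  ((nonempty_dualNormalBasis k K).some.map (diagHom v K)).algebraMap_norm x

instance : Module.Finite v.Completion (LocalAlg v K) :=
  let D := (nonempty_dualNormalBasis k K).some.map (diagHom v K)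
  .of_basis (D.exists_basis (R := v.Completion)).choose

lemma norm_coe (x : LocalUnits v K) :
    Algebra.norm v.Completion (LocalUnits.coe x) = (normMap v x : v.Completionˣ) := by
  have := Fintype.ofFinite (v.Over K)
  have : Module.Finite v.Completion ((w : v.Over K) → w.1.Completion) :=
    inferInstanceAs (Module.Finite v.Completion (LocalAlg v K))
  have hnormMap : normMap v x = ∏ w : v.Over K, localNorm w (x w) := finprod_eq_prod_of_fintype _
  rw [hnormMap, Units.coe_prod]
  exact (norm_pi_of_field (L := fun w : v.Over K ↦ w.1.Completion) fun w ↦ (x w : w.1.Completion))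

lemma ofBase_normMap (x : LocalUnits v K) :
    ofBase v K (normMap v x : v.Completionˣ) = LocalUnits.coe (gNorm (K ≃ₐ[k] K) _ x) := by
  rw [← norm_coe, ofBase_norm, map_gNorm]

end LocalAlg

namespace LocalUnits

variable {k : Type*} [Field k] {v : FinitePlace k} {K : Type*} [Field K] [Algebra k K]
  [FiniteDimensional k K]

lemma exists_sum_mul_algebraMap_ne_zero {L : Type*} [Field L] [Algebra K L]
    {c : (K ≃ₐ[k] K) → L} (hc : c ≠ 0) :
    ∃ b : K, ∑ σ : K ≃ₐ[k] K, c σ * algebraMap K L (σ b) ≠ 0 := by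
  by_contra! hall
  let χ (σ : K ≃ₐ[k] K) : K →* L := ((algebraMap K L).comp (σ : K →+* K)).toMonoidHom
  have hχ : Function.Injective χ := fun σ τ h ↦ AlgEquiv.ext fun b ↦
    (algebraMap K L).injective (DFunLike.congr_fun h b)
  have hli := (linearIndependent_monoidHom K L).comp χ hχ
  exact hc <| funext <| Fintype.linearIndependent_iff.mp hli c <| funext fun b ↦ by
    rw [Finset.sum_apply]
    exact hall b

/-- The average `∑ σ, f σ * σ b` of a cocycle `f`, from which a cochain with coboundary `f` is
built if it is invertible. -/
def average (f : (K ≃ₐ[k] K) → LocalUnits v K) (b : K) : LocalAlg v K :=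
  ∑ σ : K ≃ₐ[k] K, coe (f σ) * LocalAlg.diag v K (σ b)

lemma coe_mul_smul_average {f : (K ≃ₐ[k] K) → LocalUnits v K}
    (hf : groupCohomology.IsMulCocycle₁ f) (b : K) (τ : K ≃ₐ[k] K) :
    coe (f τ) * τ • average f b = average f b := by
  conv_rhs => rw [average, ← Equiv.sum_comp (Equiv.mulLeft τ)]
  rw [average, Finset.smul_sum, Finset.mul_sum]
  refine Finset.sum_congr rfl fun σ _ ↦ ?_
  rw [Equiv.coe_mulLeft, hf τ σ, map_mul, map_smul, smul_mul', LocalAlg.smul_diag,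
    AlgEquiv.mul_apply]
  ring

variable [IsGalois k K]

theorem isMulCoboundary₁ {f : (K ≃ₐ[k] K) → LocalUnits v K}
    (hf : groupCohomology.IsMulCocycle₁ f) : groupCohomology.IsMulCoboundary₁ f := by
  obtain ⟨w₀⟩ := v.nonempty_over K
  obtain ⟨b, hb⟩ := exists_sum_mul_algebraMap_ne_zero
    (c := fun σ : K ≃ₐ[k] K ↦ (f σ w₀ : w₀.1.Completion)) fun h ↦ (f 1 w₀).ne_zero (congrFun h 1)
  have hne (w : v.Over K) : LocalAlg.proj w (average f b) ≠ 0 := by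
    obtain ⟨τ, rfl⟩ := FinitePlace.exists_twist_eq w w₀
    rw [← coe_mul_smul_average hf b τ, map_mul, proj_coe, LocalAlg.proj_smul]
    refine mul_ne_zero (f τ w).ne_zero ((map_ne_zero _).mpr ?_)
    rwa [average, map_sum]
  let u : LocalUnits v K := fun w ↦ Units.mk0 (LocalAlg.proj w (average f b)) (hne w)
  have hu : coe u = average f b := rfl
  refine ⟨u⁻¹, fun τ ↦ ?_⟩
  rw [smul_inv', div_inv_eq_mul, inv_mul_eq_iff_eq_mul, mul_comm]
  apply coe_injective
  rw [map_mul, map_smul, hu, coe_mul_smul_average hf]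

end LocalUnits

/-! ### Local generators of a modulus -/

namespace FinitePlace

variable {F : Type*} [Field F] (w : FinitePlace F)

lemma integers_ring : w.val.Integers w.ring where
  hom_inj := Subtype.val_injective
  map_le_one x := (w.val_le_one_iff _).mpr x.2
  exists_of_le_one x hx := ⟨⟨x, (w.val_le_one_iff x).mp hx⟩, rfl⟩

lemma integers_integers : (Valued.v : Valuation w.Completion _).Integers w.Integers :=
  Valuation.integer.integers _

end FinitePlace

namespace Modulus

section

variable {F : Type*} [Field F] {S : Set (Place F)} (m : Modulus F S)

/-- `a` is an element of `𝔪_f` generating it locally at `w`. -/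
structure IsGenerator (w : FinitePlace F) (a : F) : Prop where
  ne_zero : a ≠ 0
  mem : ∃ b ∈ m.fin, (b : F) = a
  val_le : ∀ b ∈ m.fin, w.val (b : F) ≤ w.val a

lemma exists_mem_fin_ne_zero : ∃ b ∈ m.fin, (b : F) ≠ 0 := by
  obtain ⟨b, hb, hb0⟩ := Submodule.exists_mem_ne_zero_of_ne_bot m.fin_ne_bot
  exact ⟨b, hb, fun h ↦ hb0 (Subtype.ext h)⟩

lemma exists_isGenerator {w : FinitePlace F} (hw : Place.finite w ∉ S) :
    ∃ a, m.IsGenerator w a := by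
  obtain ⟨b₀, hb₀, hb₀0⟩ := m.exists_mem_fin_ne_zero
  have hmem {b : SIntegers S} (hb : b ∈ m.fin) : ⟨b, b.2 w hw⟩ ∈ m.localIdeal w :=
    Ideal.subset_span ⟨b, hb, rfl⟩
  obtain ⟨g, hg⟩ := IsPrincipalIdealRing.principal (m.localIdeal w)
  have hle {y : w.ring} (hy : y ∈ m.localIdeal w) : w.val (y : F) ≤ w.val g :=
    w.integers_ring.le_of_dvd (Ideal.mem_span_singleton.mp (hg.le hy))
  have hg0 : 0 < w.val (g : F) :=
    (zero_lt_iff.mpr ((map_ne_zero _).mpr hb₀0)).trans_le (hle (hmem hb₀))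
  suffices h : ∃ a ∈ m.fin, w.val (g : F) ≤ w.val a by
    obtain ⟨a, ha, hga⟩ := h
    refine ⟨a, fun h0 ↦ ?_, ⟨a, ha, rfl⟩, fun b hb ↦ (hle (hmem hb)).trans hga⟩
    rw [h0, map_zero] at hga
    exact hga.not_gt hg0
  by_contra! hlt
  suffices h : ∀ y ∈ m.localIdeal w, w.val (y : F) < w.val g from
    (h g (hg.ge (Ideal.mem_span_singleton_self g))).false
  intro y hy
  induction hy using Submodule.span_induction with
  | mem y hy =>
    obtain ⟨b, hb, hby⟩ := hy
    exact hby ▸ hlt b hb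
  | zero => simpa using hg0
  | add x y _ _ hx hy => exact Valuation.map_add_lt _ hx hy
  | smul s x _ hx =>
    refine lt_of_le_of_lt ?_ hx
    exact w.integers_ring.le_of_dvd (dvd_mul_left x s)

variable {m} {w : FinitePlace F} {a : F}

namespace IsGenerator

lemma mem_ring (hw : Place.finite w ∉ S) (h : m.IsGenerator w a) : a ∈ w.ring := by
  obtain ⟨b, -, rfl⟩ := h.mem
  exact b.2 w hw

lemma localIdeal_eq (hw : Place.finite w ∉ S) (h : m.IsGenerator w a) :
    m.localIdeal w = Ideal.span {⟨a, h.mem_ring hw⟩} := by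
  refine le_antisymm (Ideal.span_le.mpr ?_) (Ideal.span_le.mpr ?_)
  · rintro y ⟨b, hb, hby⟩
    exact Ideal.mem_span_singleton.mpr (w.integers_ring.dvd_of_le
      ((congrArg w.val hby.symm).trans_le (h.val_le b hb)))
  · rintro _ rfl
    exact Ideal.subset_span h.mem

lemma mem_localIdeal_iff (hw : Place.finite w ∉ S) (h : m.IsGenerator w a) {y : w.ring} :
    y ∈ m.localIdeal w ↔ w.val (y : F) ≤ w.val a := by
  rw [h.localIdeal_eq hw, Ideal.mem_span_singleton]
  exact w.integers_ring.dvd_iff_le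

lemma mem_completedIdeal_iff (hw : Place.finite w ∉ S) (h : m.IsGenerator w a)
    {y : w.Integers} : y ∈ m.completedIdeal w ↔ Valued.v (y : w.Completion) ≤ w.val a := by
  rw [completedIdeal, h.localIdeal_eq hw, Ideal.map_span, Set.image_singleton,
    Ideal.mem_span_singleton, ← w.valued_algebraMap]
  exact w.integers_integers.dvd_iff_le

lemma mem_finSupport_iff (hw : Place.finite w ∉ S) (h : m.IsGenerator w a) :
    w ∈ m.finSupport ↔ w.val a < 1 := by
  rw [finSupport, Set.mem_ofPred_eq, Ideal.ne_top_iff_one, h.mem_localIdeal_iff hw,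
    OneMemClass.coe_one, map_one, not_le]
  exact and_iff_right hw

lemma mem_rayUnits_iff (hw : w ∈ m.finSupport) (h : m.IsGenerator w a) {u : w.Completionˣ} :
    u ∈ m.rayUnits w ↔ Valued.v ((u : w.Completion) - 1) ≤ w.val a := by
  rw [m.mem_rayUnits_iff hw]
  constructor
  · rintro ⟨y, hy, hu⟩
    rw [hu, add_sub_cancel_left]
    exact (h.mem_completedIdeal_iff hw.1).mp hy
  · intro hle
    have hmem : (u : w.Completion) - 1 ∈ w.Integers :=
      hle.trans ((h.mem_finSupport_iff hw.1).mp hw).le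
    exact ⟨⟨_, hmem⟩, (h.mem_completedIdeal_iff hw.1).mpr hle, (add_sub_cancel _ _).symm⟩

end IsGenerator

variable (m)

lemma finite_finSupport (h : HasFinitePlaces F) : m.finSupport.Finite := by
  obtain ⟨b, hb, hb0⟩ := m.exists_mem_fin_ne_zero
  refine (h.finite_val_ne_one _ hb0).subset fun w hw ↦ ?_
  obtain ⟨a, ha⟩ := m.exists_isGenerator hw.1
  exact ((ha.val_le b hb).trans_lt ((ha.mem_finSupport_iff hw.1).mp hw)).ne

lemma exists_isGenerator_of_mem_finSupport : ∃ a : FinitePlace F → F, (∀ w, a w ≠ 0) ∧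
    ∀ w ∈ m.finSupport, m.IsGenerator w (a w) := by
  have hex (w : FinitePlace F) : ∃ a : F, a ≠ 0 ∧ (w ∈ m.finSupport → m.IsGenerator w a) := by
    by_cases hw : w ∈ m.finSupport
    · obtain ⟨a, ha⟩ := m.exists_isGenerator hw.1
      exact ⟨a, ha.ne_zero, fun _ ↦ ha⟩
    · exact ⟨1, one_ne_zero, fun h ↦ absurd h hw⟩
  choose a ha0 ha using hex
  exact ⟨a, ha0, ha⟩

end

section Extension

variable {k K : Type*} [Field k] [Field K] [Algebra k K] [FiniteDimensional k K]
  {S : Set (Place k)} {m : Modulus k S} {v : FinitePlace k} {a : k}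

lemma finite_mem_under_preimage_iff (w : v.Over K) :
    Place.finite w.1 ∈ (Place.under k ⁻¹' S : Set (Place K)) ↔ Place.finite v ∈ S := by
  rw [Set.mem_preimage, Place.under, w.2]

lemma IsGenerator.induced (hv : Place.finite v ∉ S) (h : m.IsGenerator v a) (w : v.Over K) :
    (m.induced K).IsGenerator w.1 (algebraMap k K a) := by
  refine ⟨by simpa using h.ne_zero, ?_, fun b hb ↦ ?_⟩
  · obtain ⟨b, hb, rfl⟩ := h.mem
    exact ⟨SIntegers.map K S b, Ideal.mem_map_of_mem _ hb, rfl⟩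
  · change b ∈ Ideal.span _ at hb
    induction hb using Submodule.span_induction with
    | mem x hx =>
      obtain ⟨y, hy, rfl⟩ := hx
      exact w.val_le_val_iff.mpr (h.val_le y hy)
    | zero => simp
    | add x y _ _ hx hy => exact Valuation.map_add_le _ hx hy
    | smul s x _ hx =>
      have hs : w.1.val (s : K) ≤ 1 :=
        (w.1.val_le_one_iff _).mpr (s.2 w.1 ((finite_mem_under_preimage_iff w).not.mpr hv))
      exact (map_mul w.1.val (s : K) x).trans_le (mul_le_of_le_one_of_le hs hx)

lemma mem_finSupport_induced_iff (w : v.Over K) :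
    w.1 ∈ (m.induced K).finSupport ↔ v ∈ m.finSupport := by
  have hS := finite_mem_under_preimage_iff (S := S) w
  by_cases hv : Place.finite v ∈ S
  · exact ⟨fun h ↦ absurd (hS.mpr hv) h.1, fun h ↦ absurd hv h.1⟩
  · obtain ⟨a, ha⟩ := m.exists_isGenerator hv
    rw [ha.mem_finSupport_iff hv, (ha.induced hv w).mem_finSupport_iff (hS.not.mpr hv),
      w.val_lt_one_iff]

lemma IsGenerator.mem_rayProduct_iff (hv : v ∈ m.finSupport) (h : m.IsGenerator v a)
    {x : LocalUnits v K} :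
    x ∈ m.rayProduct K v ↔ LocalUnits.coe x - 1 ∈ LocalAlg.ball v K a := by
  refine forall_congr' fun w ↦ ?_
  rw [(h.induced hv.1 w).mem_rayUnits_iff ((mem_finSupport_induced_iff w).mpr hv)]
  rfl

end Extension

end Modulus

/-! ### The index of the norms of `∏_{w ∣ v} (1 + 𝔪 𝒪_w)` -/

section

variable {k : Type*} [Field k] {v : FinitePlace k} {K : Type*} [Field K] [Algebra k K]
  [FiniteDimensional k K]

namespace LocalUnits

variable (v K) in
/-- The diagonal embedding `k_vˣ → ∏_{w ∣ v} K_wˣ`. -/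
def ofBase : v.Completionˣ →* LocalUnits v K where
  toFun x w := Units.map (FinitePlace.completionMap (algebraMap k K) w.comap_ring).toMonoidHom x
  map_one' := funext fun _ ↦ map_one _
  map_mul' _ _ := funext fun _ ↦ map_mul _ _ _

lemma coe_ofBase (x : v.Completionˣ) : coe (ofBase v K x) = LocalAlg.ofBase v K x := rfl

lemma smul_ofBase (σ : K ≃ₐ[k] K) (x : v.Completionˣ) : σ • ofBase v K x = ofBase v K x :=
  coe_injective (LocalAlg.smul_ofBase σ (x : v.Completion))

variable [IsGalois k K]

lemma ofBase_injective : Function.Injective (ofBase v K) := fun _ _ h ↦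
  Units.ext (LocalAlg.ofBase_injective (K := K) (congrArg coe h))

lemma ofBase_normMap (x : LocalUnits v K) : ofBase v K (normMap v x) = gNorm (K ≃ₐ[k] K) _ x :=
  coe_injective (LocalAlg.ofBase_normMap x)

lemma exists_ofBase_eq {x : LocalUnits v K} (hx : ∀ σ : K ≃ₐ[k] K, σ • x = x) :
    ∃ y, ofBase v K y = x := by
  obtain ⟨w⟩ := v.nonempty_over K
  obtain ⟨y, hy⟩ := LocalAlg.exists_ofBase_eq (x := coe x) fun σ ↦ by rw [← map_smul, hx]
  have hy0 : y ≠ 0 := by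
    rintro rfl
    rw [map_zero] at hy
    exact (x w).ne_zero (congrArg (LocalAlg.proj w) hy).symm
  exact ⟨Units.mk0 y hy0, coe_injective hy⟩

end LocalUnits

namespace Modulus

variable {S : Set (Place k)} (m : Modulus k S)

variable (K v) in
/-- The inclusion `∏_{w ∣ v} (1 + 𝔪 𝒪_w) → ∏_{w ∣ v} K_w`. -/
def rayProductCoe : m.rayProduct K v →*[K ≃ₐ[k] K] LocalAlg v K where
  toFun x := LocalUnits.coe (x : LocalUnits v K)
  map_one' := rfl
  map_mul' _ _ := rfl
  map_smul' _ _ := rfl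

lemma rayProductCoe_injective : Function.Injective (m.rayProductCoe v K) :=
  LocalUnits.coe_injective.comp Subtype.val_injective

lemma coe_gNorm_rayProduct (x : m.rayProduct K v) :
    (gNorm (K ≃ₐ[k] K) (m.rayProduct K v) x : LocalUnits v K) = gNorm (K ≃ₐ[k] K) _ x.1 := by
  rw [gNorm_apply, gNorm_apply, Subgroup.val_finsetProd]
  rfl

variable {m} {a : k}

lemma IsGenerator.rayProductCoe_mem_integers (hv : v ∈ m.finSupport) (ha : m.IsGenerator v a)
    (u : m.rayProduct K v) : m.rayProductCoe v K u ∈ LocalAlg.integers v K := by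
  rw [← sub_add_cancel (m.rayProductCoe v K u) 1]
  refine add_mem (LocalAlg.mem_ball_one.mp (LocalAlg.ball_anti ?_
    ((ha.mem_rayProduct_iff hv).mp u.2))) (one_mem _)
  rw [map_one]
  exact ((ha.mem_finSupport_iff hv.1).mp hv).le

lemma IsGenerator.exists_rayProductCoe_eq (hv : v ∈ m.finSupport) (ha : m.IsGenerator v a)
    {x : LocalAlg v K} (hx : x ∈ LocalAlg.ball v K a) : ∃ u, m.rayProductCoe v K u = 1 + x := by
  have hne (w : v.Over K) : 1 + LocalAlg.proj w x ≠ 0 := by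
    intro h0
    have hlt : Valued.v (LocalAlg.proj w x) < 1 :=
      (hx w).trans_lt (w.val_lt_one_iff.mpr ((ha.mem_finSupport_iff hv.1).mp hv))
    rw [← neg_eq_of_add_eq_zero_right h0, Valuation.map_neg, map_one] at hlt
    exact hlt.false
  let u : LocalUnits v K := fun w ↦ Units.mk0 (1 + LocalAlg.proj w x) (hne w)
  have hu : LocalUnits.coe u = 1 + x := rfl
  refine ⟨⟨u, (ha.mem_rayProduct_iff hv).mpr ?_⟩, hu⟩
  rwa [hu, add_sub_cancel_left]

variable [IsGalois k K]

lemma ofBase_mem_rayProduct_iff (hv : v ∈ m.finSupport) {x : v.Completionˣ} :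
    LocalUnits.ofBase v K x ∈ m.rayProduct K v ↔ x ∈ m.rayUnits v := by
  have := v.nonempty_over K
  obtain ⟨a, ha⟩ := m.exists_isGenerator hv.1
  rw [ha.mem_rayProduct_iff hv, ha.mem_rayUnits_iff hv, LocalUnits.coe_ofBase,
    ← map_one (LocalAlg.ofBase v K), ← map_sub, LocalAlg.ofBase_mem_ball_iff ha.ne_zero]

theorem map_normMap_le (hv : v ∈ m.finSupport) :
    (m.rayProduct K v).map (normMap v) ≤ m.rayUnits v := by
  rintro _ ⟨x, hx, rfl⟩
  rw [← ofBase_mem_rayProduct_iff (K := K) hv, LocalUnits.ofBase_normMap,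
    ← coe_gNorm_rayProduct m ⟨x, hx⟩]
  exact Subtype.prop _

variable (m v K) in
lemma map_ofBase_map_normMap :
    ((m.rayProduct K v).map (normMap v)).map (LocalUnits.ofBase v K) =
      (gNorm (K ≃ₐ[k] K) (m.rayProduct K v)).range.map (m.rayProduct K v).subtype := by
  ext x
  constructor
  · rintro ⟨_, ⟨u, hu, rfl⟩, rfl⟩
    exact ⟨_, ⟨⟨u, hu⟩, rfl⟩,
      (coe_gNorm_rayProduct m ⟨u, hu⟩).trans (LocalUnits.ofBase_normMap u).symm⟩
  · rintro ⟨_, ⟨u, rfl⟩, rfl⟩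
    exact ⟨_, ⟨u, u.2, rfl⟩, (LocalUnits.ofBase_normMap _).trans (coe_gNorm_rayProduct m u).symm⟩

lemma map_ofBase_rayUnits (hv : v ∈ m.finSupport) {g : K ≃ₐ[k] K}
    (hg : ∀ x, x ∈ Subgroup.zpowers g) :
    (m.rayUnits v).map (LocalUnits.ofBase v K) =
      (gDiff (m.rayProduct K v) g).ker.map (m.rayProduct K v).subtype := by
  ext x
  constructor
  · rintro ⟨y, hy, rfl⟩
    exact ⟨⟨_, (ofBase_mem_rayProduct_iff (K := K) hv).mpr hy⟩,
      div_eq_one.mpr (Subtype.ext (LocalUnits.smul_ofBase g y)), rfl⟩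
  · rintro ⟨u, hu, rfl⟩
    have hgu : g ∈ MulAction.stabilizer (K ≃ₐ[k] K) u := div_eq_one.mp hu
    obtain ⟨y, hy⟩ := LocalUnits.exists_ofBase_eq (x := (u : LocalUnits v K)) fun σ ↦
      congrArg Subtype.val ((Subgroup.zpowers_le.mpr hgu) (hg σ))
    exact ⟨y, (ofBase_mem_rayProduct_iff (K := K) hv).mp (hy ▸ u.2), hy⟩

theorem relIndex_range_gDiff_ker_gNorm [Finite (IsLocalRing.ResidueField v.ring)]
    (hv : v ∈ m.finSupport) {g : K ≃ₐ[k] K} (hg : ∀ x, x ∈ Subgroup.zpowers g) :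
    (gDiff (m.rayProduct K v) g).range.relIndex (gNorm (K ≃ₐ[k] K) (m.rayProduct K v)).ker =
      ((m.rayProduct K v).map (normMap v)).relIndex (m.rayUnits v) ∧
    (gDiff (m.rayProduct K v) g).range.relIndex
      (gNorm (K ≃ₐ[k] K) (m.rayProduct K v)).ker ≠ 0 := by
  obtain ⟨a, ha⟩ := m.exists_isGenerator hv.1
  obtain ⟨D, hDO, hDF⟩ := LocalAlg.exists_normalLattice (v := v) (K := K)
  obtain ⟨n, hn⟩ := hDF a ha.ne_zero
  obtain ⟨hindex, hne⟩ := D.relIndex_range_gDiff_ker_gNorm (ι := m.rayProductCoe v K)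
    m.rayProductCoe_injective (fun u ↦ hDO ▸ ha.rayProductCoe_mem_integers hv u)
    (fun x hx ↦ ha.exists_rayProductCoe_eq hv (hn hx)) hg
  refine ⟨hindex.trans ?_, hne⟩
  rw [← Subgroup.relIndex_map_map_of_injective _ _ (m.rayProduct K v).subtype_injective,
    ← Subgroup.relIndex_map_map_of_injective _ _ (LocalUnits.ofBase_injective (v := v) (K := K)),
    map_ofBase_map_normMap, map_ofBase_rayUnits hv hg]

end Modulus

end

/-! ### Approximation by global elements -/

namespace LocalUnits

section

variable {k : Type*} [Field k] (v : FinitePlace k) (K : Type*) [Field K] [Algebra k K]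
  [FiniteDimensional k K]

/-- The diagonal embedding `Kˣ → ∏_{w ∣ v} K_wˣ`. -/
def diag : Kˣ →* LocalUnits v K where
  toFun x w := Units.map (algebraMap K w.1.Completion).toMonoidHom x
  map_one' := funext fun _ ↦ map_one _
  map_mul' _ _ := funext fun _ ↦ map_mul _ _ _

variable {v K}

lemma coe_diag (x : Kˣ) : coe (diag v K x) = LocalAlg.diag v K x := rfl

lemma smul_diag (σ : K ≃ₐ[k] K) (x : Kˣ) : σ • diag v K x = diag v K (σ • x) :=
  coe_injective (LocalAlg.smul_diag σ (x : K))

lemma exists_mul_coe_inv_sub_one_mem (x : LocalUnits v K) {a : k} (ha : a ≠ 0) :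
    ∃ e : k, e ≠ 0 ∧ ∀ z, z - coe x ∈ LocalAlg.ball v K e →
      z * coe x⁻¹ - 1 ∈ LocalAlg.ball v K a := by
  obtain ⟨π, hπ0, hπ⟩ := v.exists_val_lt_one
  obtain ⟨n, hn⟩ := LocalAlg.exists_pow_mul_mem hπ (coe x⁻¹)
  rw [← LocalAlg.mem_ball_one] at hn
  refine ⟨a * π ^ n, mul_ne_zero ha (pow_ne_zero n hπ0), fun z hz ↦ ?_⟩
  have hdiv := LocalAlg.mul_mem_ball (LocalAlg.diag_mem_ball (π ^ n)⁻¹)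
    (LocalAlg.mul_mem_ball hz hn)
  rw [mul_one, mul_comm a, inv_mul_cancel_left₀ (pow_ne_zero n hπ0)] at hdiv
  have hπn : LocalAlg.diag v K (algebraMap k K (π ^ n)⁻¹) *
      LocalAlg.diag v K (algebraMap k K π ^ n) = 1 := by
    rw [← map_pow, ← map_mul, ← map_mul, inv_mul_cancel₀ (pow_ne_zero n hπ0), map_one, map_one]
  have hx : coe x * coe x⁻¹ = 1 := by rw [← map_mul, mul_inv_cancel, map_one]
  convert hdiv using 1
  linear_combination (1 - z * coe x⁻¹) * hπn + hx * LocalAlg.diag v K (algebraMap k K (π ^ n)⁻¹) *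
      LocalAlg.diag v K (algebraMap k K π ^ n)

end

end LocalUnits

section InfinitePlaces

variable {k K : Type*} [Field k] [Field K]

lemma embedding_mul_pos_of_apply_sub_lt_one {w : InfinitePlace K} (hw : w.IsReal) {x : K} {s : ℤˣ}
    (h : w (x - (s : ℤ)) < 1) : 0 < InfinitePlace.embedding_of_isReal hw (x * (s : ℤ)) := by
  rw [← InfinitePlace.norm_embedding_of_isReal hw, Real.norm_eq_abs, map_sub, map_intCast,
    abs_lt] at h
  rw [map_mul, map_intCast]
  rcases Int.units_eq_one_or s with rfl | rfl <;> push_cast at h ⊢ <;> linarith [h.1, h.2]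

lemma embedding_comap_apply {w : InfinitePlace K} (f : k →+* K) (hw : w.IsReal) (x : k) :
    InfinitePlace.embedding_of_isReal (hw.comap f) x =
      InfinitePlace.embedding_of_isReal hw (f x) := by
  refine Complex.ofReal_injective ?_
  rw [InfinitePlace.embedding_of_isReal_apply, InfinitePlace.embedding_of_isReal_apply,
    InfinitePlace.comap_embedding_of_isReal f (hw.comap f)]
  rfl

variable [Algebra k K]

lemma comap_algebraMap_comap (σ : K ≃ₐ[k] K) (w : InfinitePlace K) :
    (w.comap (σ : K →+* K)).comap (algebraMap k K) = w.comap (algebraMap k K) := by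
  rw [← InfinitePlace.comap_comp]
  exact congrArg w.comap (RingHom.ext σ.commutes)

lemma finite_setOf_comap_algebraMap_mem [FiniteDimensional k K] [IsGalois k K]
    {T : Set (InfinitePlace k)} (hT : T.Finite) :
    {w : InfinitePlace K | w.comap (algebraMap k K) ∈ T}.Finite := by
  refine hT.preimage' (f := fun w : InfinitePlace K ↦ w.comap (algebraMap k K)) fun u _ ↦ ?_
  rcases Set.eq_empty_or_nonempty
    ((fun w : InfinitePlace K ↦ w.comap (algebraMap k K)) ⁻¹' {u}) with h | ⟨w, hw⟩
  · exact h ▸ Set.finite_empty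
  · refine (Set.finite_range fun σ : K ≃ₐ[k] K ↦ σ • w).subset fun w' hw' ↦ ?_
    exact InfinitePlace.exists_smul_eq_of_comap_eq (Eq.trans hw (Eq.symm hw'))

end InfinitePlaces

namespace Modulus

section

variable {F : Type*} [Field F] {S : Set (Place F)} (m : Modulus F S)

/-- `x` is positive at all the real places in `𝔪_∞`. -/
def IsPositive (x : F) : Prop :=
  ∀ (w : InfinitePlace F) (hw : w ∈ m.inf),
    0 < InfinitePlace.embedding_of_isReal (m.isReal w hw) x

variable {m}

lemma IsPositive.div {x y : F} (hx : m.IsPositive x) (hy : m.IsPositive y) :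
    m.IsPositive (x / y) := fun w hw ↦ by
  rw [map_div₀]
  exact div_pos (hx w hw) (hy w hw)

lemma mem_rayGroup_iff {x : Fˣ} : x ∈ m.rayGroup ↔
    (∀ w ∈ m.finSupport, Units.map (algebraMap F w.Completion).toMonoidHom x ∈ m.rayUnits w) ∧
      m.IsPositive (x : F) := by
  refine and_congr_left fun _ ↦ forall₂_congr fun w hw ↦ ?_
  obtain ⟨a, ha⟩ := m.exists_isGenerator hw.1
  rw [ha.mem_rayUnits_iff hw]
  change _ ↔ Valued.v (algebraMap F w.Completion x - 1) ≤ _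
  rw [← map_one (algebraMap F w.Completion), ← map_sub, FinitePlace.valued_algebraMap]
  constructor
  · rintro ⟨y, hy, hyx⟩
    rw [← hyx]
    exact (ha.mem_localIdeal_iff hw.1).mp hy
  · intro hle
    have hmem : (x : F) - 1 ∈ w.ring :=
      (w.val_le_one_iff _).mp (hle.trans ((ha.mem_finSupport_iff hw.1).mp hw).le)
    exact ⟨⟨_, hmem⟩, (ha.mem_localIdeal_iff hw.1).mpr hle, rfl⟩

end

variable {k K : Type*} [Field k] [Field K] [Algebra k K] [FiniteDimensional k K]
  {S : Set (Place k)} {m : Modulus k S}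

lemma mem_rayGroup_induced_iff {x : Kˣ} : x ∈ (m.induced K).rayGroup ↔
    (∀ v ∈ m.finSupport, LocalUnits.diag v K x ∈ m.rayProduct K v) ∧
      (m.induced K).IsPositive (x : K) := by
  refine mem_rayGroup_iff.trans (and_congr_left fun _ ↦ ⟨fun h v hv w ↦ ?_, fun h w hw ↦ ?_⟩)
  · exact h w.1 ((mem_finSupport_induced_iff w).mpr hv)
  · exact h (w.under k) ((mem_finSupport_induced_iff (m := m) ⟨w, rfl⟩).mp hw) ⟨w, rfl⟩

lemma IsPositive.apply {x : K} (hx : (m.induced K).IsPositive x) (σ : K ≃ₐ[k] K) :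
    (m.induced K).IsPositive (σ x) := fun w hw ↦ by
  refine (hx (w.comap (σ : K →+* K)) ⟨hw.1.comap _, ?_⟩).trans_eq
    (embedding_comap_apply (σ : K →+* K) hw.1 x)
  rw [comap_algebraMap_comap]
  exact hw.2

variable (K m) in
/-- The diagonal map `K^𝔪 → ∏_{w ∣ v} (1 + 𝔪 𝒪_w)`. -/
def rayGroupDiag (v : m.finSupport) :
    (m.induced K).rayGroup →*[K ≃ₐ[k] K] m.rayProduct K v.1 where
  toFun x := ⟨LocalUnits.diag v.1 K x, (mem_rayGroup_induced_iff.mp x.2).1 v.1 v.2⟩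
  map_one' := Subtype.ext (map_one _)
  map_mul' x y := Subtype.ext (map_mul (LocalUnits.diag v.1 K) (x : Kˣ) (y : Kˣ))
  map_smul' σ x := Subtype.ext (LocalUnits.smul_diag σ (x : Kˣ)).symm

variable [IsGalois k K]

lemma IsGenerator.diag_div_mem_rayProduct {v : FinitePlace k} (hv : v ∈ m.finSupport) {a : k}
    (ha : m.IsGenerator v a) {b : K} {x : LocalUnits v K}
    (h : LocalAlg.diag v K b * LocalUnits.coe x⁻¹ - 1 ∈ LocalAlg.ball v K a) :
    b ≠ 0 ∧ ∀ c : Kˣ, (c : K) = b → LocalUnits.diag v K c / x ∈ m.rayProduct K v := by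
  refine ⟨?_, ?_⟩
  · rintro rfl
    obtain ⟨w⟩ := v.nonempty_over K
    have hw := h w
    rw [map_zero, zero_mul, zero_sub, map_neg, Valuation.map_neg, map_one, map_one] at hw
    exact (w.val_lt_one_iff.mpr ((ha.mem_finSupport_iff hv.1).mp hv)).not_ge hw
  · rintro c rfl
    rwa [ha.mem_rayProduct_iff hv, div_eq_mul_inv, map_mul, LocalUnits.coe_diag]

variable (m) in
lemma exists_radius_diag_div_mem_rayProduct (x : ∀ v, LocalUnits v K) :
    ∃ e : FinitePlace k → k, (∀ v, e v ≠ 0) ∧ ∀ v ∈ m.finSupport, ∀ b : K,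
      LocalAlg.diag v K b - LocalUnits.coe (x v) ∈ LocalAlg.ball v K (e v) →
        b ≠ 0 ∧ ∀ c : Kˣ, (c : K) = b → LocalUnits.diag v K c / x v ∈ m.rayProduct K v := by
  obtain ⟨a, ha0, ha⟩ := m.exists_isGenerator_of_mem_finSupport
  choose e he0 he using fun v ↦ LocalUnits.exists_mul_coe_inv_sub_one_mem (x v) (ha0 v)
  exact ⟨e, he0, fun v hv b hb ↦ (ha v hv).diag_div_mem_rayProduct hv (he v _ hb)⟩

lemma exists_units_diag_div_mem (hfin : m.finSupport.Finite) (hinf : m.inf.Finite)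
    (x : ∀ v, LocalUnits v K) :
    ∃ b : Kˣ, (∀ v ∈ m.finSupport, LocalUnits.diag v K b / x v ∈ m.rayProduct K v) ∧
      (m.induced K).IsPositive (b : K) := by
  obtain ⟨e, he0, he⟩ := m.exists_radius_diag_div_mem_rayProduct x
  have hinf' : (m.induced K).inf.Finite :=
    (finite_setOf_comap_algebraMap_mem hinf).subset fun w hw ↦ hw.2
  obtain ⟨b, hb, hb'⟩ := LocalAlg.exists_diag_sub_mem_ball hfin hinf'
    (fun v ↦ LocalUnits.coe (x v)) e he0 1
  have hpos : (m.induced K).IsPositive b := fun w hw ↦ by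
    simpa using embedding_mul_pos_of_apply_sub_lt_one hw.1 (s := 1) (by simpa using hb' w hw)
  rcases eq_or_ne b 0 with rfl | hb0
  · exact ⟨1, fun v hv ↦ absurd rfl (he v hv 0 (hb v hv)).1,
      fun w hw ↦ absurd (hpos w hw) (by simp)⟩
  · exact ⟨Units.mk0 b hb0, fun v hv ↦ (he v hv b (hb v hv)).2 _ rfl, hpos⟩

lemma exists_base_units_diag_div_mem (hfin : m.finSupport.Finite) (hinf : m.inf.Finite)
    (x : ∀ v, LocalUnits v K) (hx : ∀ v (σ : K ≃ₐ[k] K), σ • x v = x v)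
    (s : InfinitePlace k → ℤˣ) :
    ∃ c : kˣ, (∀ v ∈ m.finSupport,
      LocalUnits.diag v K (Units.map (algebraMap k K).toMonoidHom c) / x v ∈ m.rayProduct K v) ∧
      ∀ u ∈ m.inf, u (c - (s u : ℤ)) < 1 := by
  obtain ⟨e, he0, he⟩ := m.exists_radius_diag_div_mem_rayProduct x
  choose y hy using fun v ↦ LocalAlg.exists_algebraMap_sub_mem (x := LocalUnits.coe (x v))
    (fun σ ↦ by rw [← map_smul, hx]) (he0 v)
  obtain ⟨c, hc, hc'⟩ := exists_approx hfin hinf y e (fun v _ ↦ he0 v) fun u ↦ (s u : ℤ)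
  have hball (v) (hv : v ∈ m.finSupport) : LocalAlg.diag v K (algebraMap k K c) -
      LocalUnits.coe (x v) ∈ LocalAlg.ball v K (e v) := by
    rw [← sub_add_sub_cancel _ (LocalAlg.diag v K (algebraMap k K (y v))), ← map_sub, ← map_sub]
    exact add_mem (LocalAlg.ball_anti (hc v hv).le (LocalAlg.diag_mem_ball _)) (hy v)
  rcases eq_or_ne c 0 with rfl | hc0
  · refine ⟨1, fun v hv ↦ absurd (map_zero _) (he v hv _ (hball v hv)).1, fun u hu ↦ ?_⟩
    exact absurd (embedding_mul_pos_of_apply_sub_lt_one (m.isReal u hu) (hc' u hu)) (by simp)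
  · exact ⟨Units.mk0 c hc0, fun v hv ↦ (he v hv _ (hball v hv)).2 _ rfl, hc'⟩

/-- The hypothesis says that `b` has the same sign at conjugate real places. -/
lemma exists_isPositive_mul_sign {b : Kˣ}
    (hb : ∀ σ : K ≃ₐ[k] K, (m.induced K).IsPositive (σ b / b)) :
    ∃ s : InfinitePlace k → ℤˣ, ∀ (w : InfinitePlace K) (hw : w ∈ (m.induced K).inf),
      0 < InfinitePlace.embedding_of_isReal hw.1 (b * (s (w.comap (algebraMap k K)) : ℤ)) := by
  suffices h : ∀ u : InfinitePlace k, ∃ s : ℤˣ, ∀ (w : InfinitePlace K)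
      (hw : w ∈ (m.induced K).inf), w.comap (algebraMap k K) = u →
        0 < InfinitePlace.embedding_of_isReal hw.1 (b * (s : ℤ)) by
    choose s hs using h
    exact ⟨s, fun w hw ↦ hs _ w hw rfl⟩
  intro u
  by_cases! h : ∃ w ∈ (m.induced K).inf, w.comap (algebraMap k K) = u
  · obtain ⟨w, hw, rfl⟩ := h
    obtain ⟨s, hs⟩ : ∃ s : ℤˣ, 0 < InfinitePlace.embedding_of_isReal hw.1 (b * (s : ℤ)) := by
      rcases lt_or_gt_of_ne ((map_ne_zero (InfinitePlace.embedding_of_isReal hw.1)).mpr b.ne_zero)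
        with hneg | hpos
      · exact ⟨-1, by simpa using hneg⟩
      · exact ⟨1, by simpa using hpos⟩
    refine ⟨s, fun w' hw' hww' ↦ ?_⟩
    obtain ⟨σ, rfl⟩ := InfinitePlace.exists_smul_eq_of_comap_eq hww'.symm
    refine (mul_pos (hb σ.symm w hw) hs).trans_eq ?_
    rw [← map_mul, ← mul_assoc, div_mul_cancel₀ _ b.ne_zero, map_mul, map_intCast]
    refine Eq.trans ?_ (map_mul _ _ _).symm
    rw [map_intCast]
    exact congrArg (· * _) (embedding_comap_apply (σ.symm : K →+* K) hw.1 (b : K)).symm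
  · exact ⟨1, fun w hw hwu ↦ absurd hwu (h w hw)⟩

lemma exists_base_units_diag_div_mem_of_isPositive (hfin : m.finSupport.Finite)
    (hinf : m.inf.Finite) {b : Kˣ} (hb : ∀ σ : K ≃ₐ[k] K, (m.induced K).IsPositive (σ b / b))
    (x : ∀ v, LocalUnits v K) (hx : ∀ v (σ : K ≃ₐ[k] K), σ • x v = x v) :
    ∃ c : Kˣ, (∀ σ : K ≃ₐ[k] K, σ • c = c) ∧
      (∀ v ∈ m.finSupport, LocalUnits.diag v K c / x v ∈ m.rayProduct K v) ∧
      (m.induced K).IsPositive (b / c) := by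
  obtain ⟨s, hs⟩ := exists_isPositive_mul_sign hb
  obtain ⟨c, hc, hc'⟩ := exists_base_units_diag_div_mem hfin hinf x hx s
  refine ⟨Units.map (algebraMap k K).toMonoidHom c, fun σ ↦ Units.ext (σ.commutes _), hc,
    fun w hw ↦ ?_⟩
  have hcs : 0 < InfinitePlace.embedding_of_isReal hw.1
      (algebraMap k K c * (s (w.comap (algebraMap k K)) : ℤ)) := by
    refine embedding_mul_pos_of_apply_sub_lt_one hw.1 ?_
    simpa only [InfinitePlace.comap_apply, map_sub, map_intCast] using hc' _ hw.2
  have hs0 : ((s (w.comap (algebraMap k K)) : ℤ) : K) ≠ 0 := by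
    rcases Int.units_eq_one_or (s (w.comap (algebraMap k K))) with h | h <;> simp [h]
  have hpos := div_pos (hs w hw) hcs
  rwa [← map_div₀, mul_div_mul_right _ _ hs0] at hpos

/-! ### Cohomology of the ray group -/

open groupCohomology

lemma isMulCoboundary₁_of_forall (hfin : m.finSupport.Finite) (hinf : m.inf.Finite)
    (f : (K ≃ₐ[k] K) → (m.induced K).rayGroup) (hf : IsMulCocycle₁ f)
    (h : ∀ v, IsMulCoboundary₁ (m.rayGroupDiag K v ∘ f)) : IsMulCoboundary₁ f := by
  obtain ⟨b, hb⟩ : ∃ b : Kˣ, ∀ σ : K ≃ₐ[k] K, σ • b / b = f σ :=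
    isMulCoboundary₁_of_isMulCocycle₁_of_aut_to_units (fun σ ↦ (f σ : Kˣ)) fun σ τ ↦
      congrArg Subtype.val (hf σ τ)
  have hinvariant (v) : ∃ x : LocalUnits v K, (∀ σ : K ≃ₐ[k] K, σ • x = x) ∧
      (v ∈ m.finSupport → LocalUnits.diag v K b / x ∈ m.rayProduct K v) := by
    by_cases hv : v ∈ m.finSupport
    · obtain ⟨u, hu⟩ := h ⟨v, hv⟩
      refine ⟨LocalUnits.diag v K b / u, fun σ ↦ ?_, fun _ ↦ by simp only [div_div_cancel, u.2]⟩
      have hσ : σ • (u : LocalUnits v K) / u = LocalUnits.diag v K (f σ) :=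
        congrArg Subtype.val (hu σ)
      rw [smul_div', LocalUnits.smul_diag, div_eq_div_iff_div_eq_div, hσ, ← hb σ, map_div]
    · exact ⟨1, fun σ ↦ smul_one σ, fun h ↦ absurd h hv⟩
  choose x hx hbx using hinvariant
  have hpos (σ : K ≃ₐ[k] K) : (m.induced K).IsPositive (σ b / b) := by
    have hσ : σ b / b = ((f σ : Kˣ) : K) := by
      rw [← hb σ, Units.val_div_eq_div_val]
      rfl
    exact hσ ▸ (f σ).2.2
  obtain ⟨c, hcσ, hc, hbc⟩ := exists_base_units_diag_div_mem_of_isPositive hfin hinf hpos x hx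
  have hmem : b / c ∈ (m.induced K).rayGroup := by
    refine mem_rayGroup_induced_iff.mpr ⟨fun v hv ↦ ?_, Units.val_div_eq_div_val b c ▸ hbc⟩
    rw [map_div, ← div_div_div_cancel_right _ _ (x v)]
    exact div_mem (hbx v hv) (hc v hv)
  refine ⟨⟨b / c, hmem⟩, fun σ ↦ Subtype.ext ?_⟩
  change σ • (b / c) / (b / c) = f σ
  rw [smul_div', hcσ, div_div_div_cancel_right]
  exact hb σ

lemma exists_isMulCocycle₁ (hfin : m.finSupport.Finite) (hinf : m.inf.Finite)
    (f : ∀ v : m.finSupport, (K ≃ₐ[k] K) → m.rayProduct K v.1) (hf : ∀ v, IsMulCocycle₁ (f v)) :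
    ∃ f' : (K ≃ₐ[k] K) → (m.induced K).rayGroup, IsMulCocycle₁ f' ∧
      ∀ v, IsMulCoboundary₁ (m.rayGroupDiag K v ∘ f' / f v) := by
  have hlocal (v) : ∃ x : LocalUnits v K, ∀ (hv : v ∈ m.finSupport) (σ : K ≃ₐ[k] K),
      σ • x / x = f ⟨v, hv⟩ σ := by
    by_cases hv : v ∈ m.finSupport
    · obtain ⟨x, hx⟩ : IsMulCoboundary₁ fun σ ↦ (f ⟨v, hv⟩ σ : LocalUnits v K) :=
        LocalUnits.isMulCoboundary₁ fun σ τ ↦ congrArg Subtype.val (hf ⟨v, hv⟩ σ τ)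
      exact ⟨x, fun _ ↦ hx⟩
    · exact ⟨1, fun h ↦ absurd h hv⟩
  choose x hx using hlocal
  obtain ⟨b, hb, hpos⟩ := exists_units_diag_div_mem hfin hinf x
  let t (v : m.finSupport) : m.rayProduct K v.1 := ⟨_, hb v.1 v.2⟩
  have hdiag (v : m.finSupport) (σ : K ≃ₐ[k] K) : LocalUnits.diag v.1 K (σ • b / b) =
      ((σ • t v / t v * f v σ : m.rayProduct K v.1) : LocalUnits v.1 K) := by
    change _ = σ • (LocalUnits.diag v.1 K b / x v) / (LocalUnits.diag v.1 K b / x v) * f v σ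
    rw [← hx v v.2 σ, map_div, smul_div', LocalUnits.smul_diag, div_mul_div_comm, div_mul_cancel,
      div_mul_cancel]
  have hmem (σ : K ≃ₐ[k] K) : σ • b / b ∈ (m.induced K).rayGroup := by
    refine mem_rayGroup_induced_iff.mpr ⟨fun v hv ↦ ?_, ?_⟩
    · exact hdiag ⟨v, hv⟩ σ ▸ Subtype.prop _
    · exact Units.val_div_eq_div_val (σ • b) b ▸ (hpos.apply σ).div hpos
  refine ⟨fun σ ↦ ⟨_, hmem σ⟩, fun σ τ ↦ Subtype.ext ?_, fun v ↦ ⟨t v, fun σ ↦ ?_⟩⟩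
  · change (σ * τ) • b / b = σ • (τ • b / b) * (σ • b / b)
    rw [mul_smul, smul_div', div_mul_div_cancel]
  · exact eq_div_iff_mul_eq'.mpr (Subtype.ext (hdiag v σ).symm)

end Modulus

end RayClass

end

theorem proposition4p2_general (k K : Type) [Field k] [Field K] [Algebra k K]
    [FiniteDimensional k K] [IsGalois k K] (S : Set (RayClass.Place k)) (m : RayClass.Modulus k S)
    (hfin : m.finSupport.Finite) (hinf : m.inf.Finite) :
    Nonempty (groupCohomology.H1 (Rep.ofMulDistribMulAction (K ≃ₐ[k] K) (m.induced K).rayGroup) ≃+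
      ((v : m.finSupport) →
        groupCohomology.H1 (Rep.ofMulDistribMulAction (K ≃ₐ[k] K) (m.rayProduct K v.1)))) ∧
    (∀ v ∈ m.finSupport, (m.rayProduct K v).map (RayClass.normMap v) ≤ m.rayUnits v) ∧
    (IsCyclic (K ≃ₐ[k] K) →
      (∀ v ∈ m.finSupport, Finite (IsLocalRing.ResidueField v.ring)) →
      Finite (groupCohomology.H1
        (Rep.ofMulDistribMulAction (K ≃ₐ[k] K) (m.induced K).rayGroup)) ∧
      Nat.card (groupCohomology.H1
          (Rep.ofMulDistribMulAction (K ≃ₐ[k] K) (m.induced K).rayGroup)) =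
        ∏ᶠ v : m.finSupport,
          ((m.rayProduct K v.1).map (RayClass.normMap v.1)).relIndex (m.rayUnits v.1)) := by
  have hiso := RayClass.nonempty_H1_equiv_pi (m.rayGroupDiag K)
    (RayClass.Modulus.isMulCoboundary₁_of_forall hfin hinf)
    (RayClass.Modulus.exists_isMulCocycle₁ hfin hinf)
  refine ⟨hiso, fun v hv ↦ RayClass.Modulus.map_normMap_le hv, ?_⟩
  rintro ⟨g, hg⟩ hres
  obtain ⟨e⟩ := hiso
  have hcard (v : m.finSupport) := RayClass.card_H1_of_cyclic (M := m.rayProduct K v.1) g hg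
  have hindex (v : m.finSupport) :=
    have := hres v.1 v.2
    RayClass.Modulus.relIndex_range_gDiff_ker_gNorm v.2 hg
  have hfinite (v : m.finSupport) := Nat.finite_of_card_ne_zero ((hcard v).trans_ne (hindex v).2)
  have := hfin.to_subtype
  have := Fintype.ofFinite m.finSupport
  refine ⟨Finite.of_equiv _ e.symm.toEquiv, ?_⟩
  rw [Nat.card_congr e.toEquiv, Nat.card_pi, finprod_eq_prod_of_fintype]
  exact Finset.prod_congr rfl fun v _ ↦ (hcard v).trans (hindex v).1

theorem proposition4p2 (k K : Type) [Field k] [Field K] [Algebra k K] [FiniteDimensional k K]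
    [IsGalois k K] (hk : RayClass.IsGlobalField k) (S : Set (RayClass.Place k))
    (hSfin : S.Finite) (hSne : S.Nonempty)
    (hSinf : ∀ v : NumberField.InfinitePlace k, RayClass.Place.infinite v ∈ S)
    (m : RayClass.Modulus k S) :
    Nonempty (groupCohomology.H1 (Rep.ofMulDistribMulAction (K ≃ₐ[k] K) (m.induced K).rayGroup) ≃+
      ((v : m.finSupport) →
        groupCohomology.H1 (Rep.ofMulDistribMulAction (K ≃ₐ[k] K) (m.rayProduct K v.1)))) ∧
    (IsCyclic (K ≃ₐ[k] K) →
      Finite (groupCohomology.H1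
        (Rep.ofMulDistribMulAction (K ≃ₐ[k] K) (m.induced K).rayGroup)) ∧
      (∀ v ∈ m.finSupport, (m.rayProduct K v).map (RayClass.normMap v) ≤ m.rayUnits v) ∧
      Nat.card (groupCohomology.H1
          (Rep.ofMulDistribMulAction (K ≃ₐ[k] K) (m.induced K).rayGroup)) =
        ∏ᶠ v : m.finSupport,
          ((m.rayProduct K v.1).map (RayClass.normMap v.1)).relIndex (m.rayUnits v.1)) := by
  have hplaces := hk.hasFinitePlaces
  obtain ⟨hiso, hnorm, hcyclic⟩ := proposition4p2_general k K S m (m.finite_finSupport hplaces)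
    ((hSfin.preimage fun _ _ _ _ h ↦ RayClass.Place.infinite.inj h).subset fun v _ ↦ hSinf v)
  exact ⟨hiso, fun hc ↦ ⟨(hcyclic hc fun v _ ↦ hplaces.finite_residueField v).1, hnorm,
    (hcyclic hc fun v _ ↦ hplaces.finite_residueField v).2⟩⟩
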